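/- Let $n\ge 1$ and fix a regularity class $r\in\{1,2,\dots,\infty\}$; throughout, "diffeomorphism" means $C^r$ diffeomorphism. Let $M$ and $N$ be nonempty compact connected $C^\infty$ hypersurfaces without boundary, embedded in $\mathbb{R}^{n+1}$. Every such hypersurface $P$ carries the volume form $\omega_P=i_{\eta}\Omega$, where $\Omega=dx_1\wedge\dots\wedge dx_{n+1}$ and $\eta$ is the outer unit normal field of $P$; $\operatorname{Vol}(P)$ is the total volume of $P$. For a diffeomorphism $h:P\to Q$ between two such hypersurfaces let $J(h)$ be its Jacobian with respect to $\omega_P$ and $\omega_Q$, i.e. the function with $h^*\omega_Q=J(h)\,\omega_P$, and put $$\Phi_1(h)=\int_P\bigl(|J(h)|-1\bigr)^2\,\omega_P .$$ Let $F:[0,1]\times M\to\mathbb{R}^{n+1}$ be a morph from $M$ to $N$ that starts at the identity: $F$ is a $C^1$ map and, writing $f^t=F(t,\cdot)$ and $M^t=f^t(M)$, for every $t\in[0,1]$ the set $M^t$ is a compact connected $C^\infty$ hypersurface without boundary embedded in $\mathbb{R}^{n+1}$ and $f^t:M\to M^t$ is a diffeomorphism; moreover $f^0=\mathrm{id}_M$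 and $M^1=N$. The morph $F$ is called distortion pairwise minimal if for all $s,t\in[0,1]$ the map $f^{s,t}=f^t\circ(f^s)^{-1}:M^s\to M^t$ minimizes $\Phi_1$ over the set of all diffeomorphisms $M^s\to M^t$. Then $F$ is distortion pairwise minimal if and only if $$\frac{J(f^t)(m)}{\operatorname{Vol}(M^t)}=\frac{1}{\operatorname{Vol}(M)}\qquad\text{for all } t\in[0,1] \text{ and all } m\in M .$$ -/

import Mathlib

open Set Filter Topology MeasureTheory
open scoped ContDiff

noncomputable section

/-- The ambient space `ℝⁿ⁺¹`. -/
abbrev Amb (n : ℕ) : Type := EuclideanSpace ℝ (Fin (n + 1))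

/-- A compact connected (nonempty) `C^∞` embedded hypersurface without boundary in `ℝⁿ⁺¹`:
around each of its points there is a `C^∞` chart of `ℝⁿ⁺¹` with values in `ℝⁿ × ℝ` that
straightens `M` to the slice `ℝⁿ × {0}`. -/
structure IsClosedHypersurface (n : ℕ) (M : Set (Amb n)) : Prop where
  isCompact : IsCompact M
  isConnected : IsConnected M
  exists_slice_chart : ∀ p ∈ M, ∃ e : OpenPartialHomeomorph (Amb n) (EuclideanSpace ℝ (Fin n) × ℝ),
    p ∈ e.source ∧ ContDiffOn ℝ ∞ e e.source ∧ ContDiffOn ℝ ∞ e.symm e.target ∧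
      ∀ x ∈ e.source, x ∈ M ↔ (e x).2 = 0

/-- The tangent space `T_p M`, as a linear subspace of `ℝⁿ⁺¹` (for a submanifold the tangent cone
consists of the velocities at `p` of curves in `M`, and is already a linear subspace). -/
def tangentAt {n : ℕ} (M : Set (Amb n)) (p : Amb n) : Submodule ℝ (Amb n) :=
  Submodule.span ℝ (tangentConeAt ℝ M p)

/-- `η` is an outer unit normal vector of `M` at `p`: it has length one, is orthogonal to `T_p M`,
and points into the unbounded component of the complement of `M`. -/
def IsOuterUnitNormal {n : ℕ} (M : Set (Amb n)) (p η : Amb n) : Prop :=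
  ‖η‖ = 1 ∧ (∀ v ∈ tangentAt M p, inner ℝ η v = 0) ∧
    ∀ᶠ s : ℝ in 𝓝[>] 0, ¬ Bornology.IsBounded (connectedComponentIn Mᶜ (p + s • η))

/-- The outer unit normal vector of `M` at `p`. -/
def outerNormal {n : ℕ} (M : Set (Amb n)) (p : Amb n) : Amb n :=
  Classical.epsilon (IsOuterUnitNormal M p)

/-- The standard volume form `Ω = dx₁ ∧ … ∧ dxₙ₊₁` of `ℝⁿ⁺¹`. -/
def stdVolForm (n : ℕ) : (Amb n) [⋀^Fin (n + 1)]→ₗ[ℝ] ℝ :=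
  (EuclideanSpace.basisFun (Fin (n + 1)) ℝ).toBasis.det

/-- The volume form `ω_M = i_η Ω` of `M` at `p`, an alternating form on `T_p M`. -/
def volForm {n : ℕ} (M : Set (Amb n)) (p : Amb n) : (tangentAt M p) [⋀^Fin n]→ₗ[ℝ] ℝ :=
  ((stdVolForm n).curryLeft (outerNormal M p)).compLinearMap (tangentAt M p).subtype

/-- The pull-back `(h^* ω_N)_p` of the volume form of `N` under `h : M → N`, an alternating form
on `T_p M`. Only the values of `h` on `M` matter. -/
def pullbackVolForm {n : ℕ} (M N : Set (Amb n)) (h : Amb n → Amb n) (p : Amb n) :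
    (tangentAt M p) [⋀^Fin n]→ₗ[ℝ] ℝ :=
  ((stdVolForm n).curryLeft (outerNormal N (h p))).compLinearMap
    ((fderivWithin ℝ h M p).toLinearMap ∘ₗ (tangentAt M p).subtype)

/-- The (signed) Jacobian `J(h)(p)` of `h : M → N` with respect to the volume forms of `M` and
`N`: the number `c` with `(h^* ω_N)_p = c (ω_M)_p`. -/
def jacobian {n : ℕ} (M N : Set (Amb n)) (h : Amb n → Amb n) (p : Amb n) : ℝ :=
  Classical.epsilon fun c : ℝ => pullbackVolForm M N h p = c • volForm M p

/-- The Riemannian volume measure of a hypersurface `M`: the `n`-dimensional Hausdorff measure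
on `M`, normalized so as to agree with Lebesgue measure on `ℝⁿ`. -/
def volMeasure {n : ℕ} (M : Set (Amb n)) : Measure (Amb n) :=
  (Measure.euclideanHausdorffMeasure n).restrict M

/-- The total volume `Vol(M)`. -/
def Vol {n : ℕ} (M : Set (Amb n)) : ℝ := (volMeasure M).real univ

/-- `h` restricts to a `C^r` diffeomorphism from `M` onto `N`. -/
structure IsDiffeo {n : ℕ} (r : ℕ∞) (M N : Set (Amb n)) (h : Amb n → Amb n) : Prop where
  bijOn : BijOn h M N
  contDiffOn : ContDiffOn ℝ r h M
  contDiffOn_inv : ContDiffOn ℝ r (Function.invFunOn h M) N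

/-- The distortion functional `Φ₁(h) = ∫_M (|J(h)| - 1)² ω_M`. -/
def Phi1 {n : ℕ} (M N : Set (Amb n)) (h : Amb n → Amb n) : ℝ :=
  ∫ p, (|jacobian M N h p| - 1) ^ 2 ∂(volMeasure M)

/-- `F : [0,1] × M → ℝⁿ⁺¹` is a morph from `M` to `N` (only the values of `F` on `[0,1] × M`
matter), where diffeomorphisms are of class `C^r`. -/
structure IsMorph {n : ℕ} (r : ℕ∞) (M N : Set (Amb n)) (F : ℝ → Amb n → Amb n) : Prop where
  contDiffOn : ContDiffOn ℝ 1 (fun x : ℝ × Amb n => F x.1 x.2) (Icc (0 : ℝ) 1 ×ˢ M)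
  isDiffeo : ∀ t ∈ Icc (0 : ℝ) 1, IsDiffeo r M (F t '' M) (F t)
  isClosedHypersurface : ∀ t ∈ Icc (0 : ℝ) 1, IsClosedHypersurface n (F t '' M)
  isDiffeo_zero : IsDiffeo r M M (F 0)
  image_one : F 1 '' M = N

/-- The transition map `f^{s,t} = f^t ∘ (f^s)⁻¹ : M^s → M^t`. -/
def transition {n : ℕ} (M : Set (Amb n)) (F : ℝ → Amb n → Amb n) (s t : ℝ) : Amb n → Amb n :=
  F t ∘ Function.invFunOn (F s) M

/-- `F` is distortion pairwise minimal: for all `s, t ∈ [0,1]` the transition map `f^{s,t}` is a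
minimizer of `Φ₁` among all `C^r` diffeomorphisms from `M^s` onto `M^t`. -/
def IsPairwiseMinimal {n : ℕ} (r : ℕ∞) (M : Set (Amb n)) (F : ℝ → Amb n → Amb n) : Prop :=
  ∀ s ∈ Icc (0 : ℝ) 1, ∀ t ∈ Icc (0 : ℝ) 1,
    IsDiffeo r (F s '' M) (F t '' M) (transition M F s t) ∧
      ∀ k : Amb n → Amb n, IsDiffeo r (F s '' M) (F t '' M) k →
        Phi1 (F s '' M) (F t '' M) (transition M F s t) ≤ Phi1 (F s '' M) (F t '' M) k

end

/-!
For a `C^r` diffeomorphism `h : M → N` the change of variables formula gives `∫_M |J(h)| = Vol N`,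
so `Φ₁(h) = ∫_M J(h)² - 2 Vol N + Vol M`. By the Cauchy–Schwarz inequality
`∫_M J(h)² ≥ (Vol N)² / Vol M`, with equality when `|J(h)|` is constant, and then the constant is
`Vol N / Vol M`. Along a morph with `J(f^t) = Vol(M^t) / Vol M` the chain rule shows that the
transition maps have constant Jacobian, so they are minimizers
(`Phi1_le_of_abs_jacobian_const`).

For the converse it is not used that the lower bound is attained. If `h` minimizes `Φ₁`, it is
compared with `h ∘ ψ⁻¹`, where `ψ` is a diffeomorphism of `M` which in a slice chart is the map
`x ↦ x + ε ζ(x) v` with a bump function `ζ` and a vector `v`. The comparison reads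
`∫_M J(h)² ≤ ∫_M J(h)² / |J(ψ)|`, and its derivative at `ε = 0` says that the function `J(h)²`,
in the coordinates of the chart, has vanishing weak derivative. So `|J(h)|` is locally constant,
hence constant since `M` is connected (`exists_abs_jacobian_eq_of_minimal`). Applied to
`f^{0,t}` this gives `|J(f^t)| = Vol(M^t) / Vol M`.

It remains to see that `J(f^t) > 0` (`IsMorph.jacobian_pos`). The Jacobian never vanishes and is
`1` at time `0`, but its sign involves the outer normals of the moving hypersurfaces, so it must be
shown that these vary continuously. Here the separation theorem of Jordan and Brouwer enters: near
each of its points a closed hypersurface has exactly one exterior side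
(`IsClosedHypersurface.exists_mem_exterior_iff`). It follows from the vanishing of the first
cohomology of `ℝⁿ⁺¹` with coefficients in `±1`, which makes the local sides coherent. If `w` is the
outer normal at `f^{t₀}(m)`, then for `t` near `t₀` a short ray from `f^t(m)` in the direction `w`
stays off `M^t` (`exists_eventually_add_smul_ne`), and its end point can be joined to a far away
point by a path that avoids `M^{t₀}`, thus also `M^t`. Hence `w` points to the exterior of `M^t`,
and the sign of the Jacobian is locally constant in `t`.

The Jacobian is tied to the measure by the area formula for `C¹` immersions
(`euclideanHausdorffMeasure_image_eq_lintegral`): in a slice chart `|J(h)|` is the ratio of the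
densities `normDet` of `h ∘ φ` and of the parametrization `φ`.
-/

/-! ### The area formula for immersions -/

/-- The parameter space `ℝⁿ`. -/
abbrev Euc (n : ℕ) : Type := EuclideanSpace ℝ (Fin n)

section AreaFormula

open scoped ENNReal NNReal

/-- An inequality between two set functions, the first countably subadditive and the second
countably superadditive on disjoint measurable sets, can be checked locally. -/
theorem setFunction_le_of_locally_le {X : Type*} [TopologicalSpace X] [SecondCountableTopology X]
    [MeasurableSpace X] [OpensMeasurableSpace X] {V : Set X} {α β : Set X → ℝ≥0∞}
    (hα₀ : α ∅ = 0) (hα : ∀ s : ℕ → Set X, α (⋃ i, s i) ≤ ∑' i, α (s i))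
    (hβ : ∀ s : ℕ → Set X, (∀ i, MeasurableSet (s i)) → (∀ i, s i ⊆ V) →
      Pairwise (Function.onFun Disjoint s) → ∑' i, β (s i) ≤ β (⋃ i, s i))
    (h : ∀ x ∈ V, ∃ U ∈ 𝓝[V] x, ∀ s ⊆ U ∩ V, MeasurableSet s → α s ≤ β s)
    {s : Set X} (hs : MeasurableSet s) (hsV : s ⊆ V) : α s ≤ β s := by
  have h' : ∀ x ∈ V, ∃ O : Set X, IsOpen O ∧ x ∈ O ∧ ∀ s ⊆ O ∩ V, MeasurableSet s → α s ≤ β s := by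
    intro x hx
    obtain ⟨U, hU, hs⟩ := h x hx
    obtain ⟨O, hO, hxO, hOU⟩ := mem_nhdsWithin.1 hU
    exact ⟨O, hO, hxO, fun s hsO hm => hs s (fun y hy => ⟨hOU (hsO hy), (hsO hy).2⟩) hm⟩
  choose! O hO hxO hle using h'
  obtain ⟨t, htV, htc, hcov⟩ := TopologicalSpace.countable_cover_nhdsWithin (s := V) (f := O)
    (fun x hx => mem_nhdsWithin_of_mem_nhds ((hO x hx).mem_nhds (hxO x hx)))
  rcases t.eq_empty_or_nonempty with rfl | hne
  · have : s = ∅ := by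
      apply subset_empty_iff.1
      exact (hsV.trans hcov).trans (by simp)
    simp [this, hα₀]
  · obtain ⟨f, rfl⟩ := htc.exists_eq_range hne
    have hfV : ∀ i, f i ∈ V := fun i => htV (mem_range_self i)
    have hdm : ∀ i, MeasurableSet (s ∩ disjointed (fun i => O (f i)) i) := fun i =>
      hs.inter (MeasurableSet.disjointed (fun j => (hO _ (hfV j)).measurableSet) i)
    have hun : (⋃ i, s ∩ disjointed (fun i => O (f i)) i) = s := by
      rw [← inter_iUnion, iUnion_disjointed, inter_eq_left]
      refine (hsV.trans hcov).trans ?_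
      simp
    calc α s = α (⋃ i, s ∩ disjointed (fun i => O (f i)) i) := by rw [hun]
      _ ≤ ∑' i, α (s ∩ disjointed (fun i => O (f i)) i) := hα _
      _ ≤ ∑' i, β (s ∩ disjointed (fun i => O (f i)) i) := ENNReal.tsum_le_tsum fun i =>
          hle _ (hfV i) _ (fun y hy => ⟨disjointed_subset (fun i => O (f i)) i hy.2, hsV hy.1⟩) (hdm i)
      _ ≤ β (⋃ i, s ∩ disjointed (fun i => O (f i)) i) := hβ _ hdm
          (fun i => inter_subset_left.trans hsV) (fun i j hij =>
            (disjoint_disjointed _ hij).mono inter_subset_right inter_subset_right)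
      _ = β s := by rw [hun]

theorem euclideanHausdorffMeasure_image_le_of_dist_le {X Y Z : Type*} [Nonempty X]
    [MetricSpace Y] [MeasurableSpace Y] [BorelSpace Y] [MetricSpace Z] [MeasurableSpace Z]
    [BorelSpace Z] (n : ℕ) {f : X → Y} {g : X → Z} {s : Set X} {K : ℝ≥0}
    (h : ∀ x ∈ s, ∀ y ∈ s, dist (f x) (f y) ≤ K * dist (g x) (g y)) :
    (Measure.euclideanHausdorffMeasure n) (f '' s) ≤
      (K : ℝ≥0∞) ^ n * (Measure.euclideanHausdorffMeasure n) (g '' s) := by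
  have hinv : ∀ x ∈ s, f (Function.invFunOn g s (g x)) = f x := by
    intro x hx
    have hex : ∃ a ∈ s, g a = g x := ⟨x, hx, rfl⟩
    have := h _ (Function.invFunOn_mem hex) x hx
    rw [Function.invFunOn_eq hex, dist_self, mul_zero] at this
    exact dist_le_zero.1 this
  have hL : LipschitzOnWith K (f ∘ Function.invFunOn g s) (g '' s) := by
    apply LipschitzOnWith.of_dist_le_mul
    rintro _ ⟨x, hx, rfl⟩ _ ⟨y, hy, rfl⟩
    simpa [hinv x hx, hinv y hy] using h x hx y hy
  have himg : (f ∘ Function.invFunOn g s) '' (g '' s) = f '' s := by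
    rw [image_image]
    exact image_congr fun x hx => hinv x hx
  have := hL.hausdorffMeasure_image_le (d := n) (Nat.cast_nonneg n)
  rw [himg, ENNReal.rpow_natCast] at this
  simp only [Measure.euclideanHausdorffMeasure_def, Measure.smul_apply, ENNReal.smul_def,
    smul_eq_mul]
  calc _ ≤ _ := mul_le_mul_right this _
    _ = _ := by ring

/-- Near a point where its derivative `A` is injective, a strictly differentiable map distorts
distances compared with `A` by factors arbitrarily close to one. -/
theorem HasStrictFDerivAt.eventually_dist_le_mul_dist {E F : Type*} [NormedAddCommGroup E]
    [NormedSpace ℝ E] [FiniteDimensional ℝ E] [NormedAddCommGroup F] [NormedSpace ℝ F]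
    {f : E → F} {A : E →L[ℝ] F} {x : E} (hf : HasStrictFDerivAt f A x)
    (hA : Function.Injective A) {c : ℝ} (hc : 1 < c) :
    ∃ U ∈ 𝓝 x, ∀ y ∈ U, ∀ z ∈ U, dist (f y) (f z) ≤ c * dist (A y) (A z) ∧
      dist (A y) (A z) ≤ c * dist (f y) (f z) := by
  obtain ⟨K, hK, hKA⟩ := A.toLinearMap.exists_antilipschitzWith (LinearMap.ker_eq_bot.2 hA)
  have hm : ∀ u, ‖u‖ ≤ K * ‖A u‖ := fun u => by simpa using hKA.le_mul_dist u 0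
  have hc0 : 0 < c := by linarith
  set ε : ℝ := (c - 1) / (c * K) with hε
  have hKpos : (0 : ℝ) < K := hK
  have hεpos : 0 < ε := div_pos (by linarith) (by positivity)
  have hev := hf.isLittleO.def hεpos
  obtain ⟨U, hU, V, hV, hUV⟩ := Filter.mem_prod_iff.1 (by rwa [nhds_prod_eq] at hev)
  refine ⟨U ∩ V, inter_mem hU hV, fun y hy z hz => ?_⟩
  have h1 : ‖f y - f z - A (y - z)‖ ≤ ε * ‖y - z‖ := hUV (mk_mem_prod hy.1 hz.2)
  have h2 := hm (y - z)
  have h3 : ε * ‖y - z‖ ≤ (c - 1) / c * ‖A (y - z)‖ := by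
    calc ε * ‖y - z‖ ≤ ε * (K * ‖A (y - z)‖) := by gcongr
      _ = (c - 1) / c * ‖A (y - z)‖ := by rw [hε]; field_simp
  have h4 : (c - 1) / c ≤ c - 1 := div_le_self (by linarith) hc.le
  have h5 : ‖f y - f z‖ ≤ ‖A (y - z)‖ + ‖f y - f z - A (y - z)‖ := by
    simpa using norm_add_le (A (y - z)) (f y - f z - A (y - z))
  have h6 : ‖A (y - z)‖ ≤ ‖f y - f z‖ + ‖f y - f z - A (y - z)‖ := by
    simpa using norm_sub_le (f y - f z) (f y - f z - A (y - z))
  have h7 := norm_nonneg (A (y - z))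
  rw [dist_eq_norm, dist_eq_norm, ← map_sub]
  constructor
  · nlinarith [mul_le_mul_of_nonneg_right h4 h7]
  · have : (c - 1) / c = 1 - 1 / c := by field_simp
    rw [this] at h3
    have h8 : 1 / c * ‖A (y - z)‖ ≤ ‖f y - f z‖ := by linarith
    rw [one_div, inv_mul_le_iff₀ hc0] at h8
    exact h8

variable {E F : Type*} [NormedAddCommGroup E] [InnerProductSpace ℝ E] [FiniteDimensional ℝ E]
  [NormedAddCommGroup F] [InnerProductSpace ℝ F]

theorem LinearMap.normDet_eq_sqrt_det (A : E →L[ℝ] F) :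
    (A : E →ₗ[ℝ] F).normDet = √(Matrix.det
      (Matrix.of fun i j => inner ℝ (A (stdOrthonormalBasis ℝ E i))
        (A (stdOrthonormalBasis ℝ E j)))) := by
  have := LinearMap.normDet_sq_eq_det_gram (A : E →ₗ[ℝ] F) (stdOrthonormalBasis ℝ E)
  simp only [RCLike.ofReal_real_eq_id, id_eq] at this
  rw [← Real.sqrt_sq (LinearMap.normDet_nonneg (A : E →ₗ[ℝ] F)), this]
  rfl

theorem LinearMap.normDet_pos {A : E →ₗ[ℝ] F} (hA : Function.Injective A) : 0 < A.normDet :=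
  lt_of_le_of_ne A.normDet_nonneg (Ne.symm ((A.normDet_ne_zero_tfae.out 0 4).2 hA))

theorem contDiff_det_gram {k : WithTop ℕ∞} :
    ContDiff ℝ k (fun A : E →L[ℝ] F => Matrix.det
      (Matrix.of fun i j => inner ℝ (A (stdOrthonormalBasis ℝ E i))
        (A (stdOrthonormalBasis ℝ E j)))) := by
  simp only [Matrix.det_apply, Matrix.of_apply]
  refine ContDiff.sum fun σ _ => ContDiff.const_smul _ (contDiff_prod fun i _ => ?_)
  exact ContDiff.inner ℝ (contDiff_id.clm_apply contDiff_const)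
    (contDiff_id.clm_apply contDiff_const)

theorem continuous_normDet : Continuous fun A : E →L[ℝ] F => (A : E →ₗ[ℝ] F).normDet := by
  simp only [LinearMap.normDet_eq_sqrt_det]
  exact Real.continuous_sqrt.comp (contDiff_det_gram (k := 0)).continuous

theorem contDiffAt_normDet {k : WithTop ℕ∞} {A : E →L[ℝ] F} (hA : Function.Injective A) :
    ContDiffAt ℝ k (fun A : E →L[ℝ] F => (A : E →ₗ[ℝ] F).normDet) A := by
  have h := LinearMap.normDet_pos (A := (A : E →ₗ[ℝ] F)) hA
  rw [LinearMap.normDet_eq_sqrt_det, Real.sqrt_pos] at h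
  simp only [LinearMap.normDet_eq_sqrt_det]
  exact contDiff_det_gram.contDiffAt.sqrt h.ne'

variable [MeasurableSpace F] [BorelSpace F]

/-- The area formula for an injective `C¹` immersion of an open subset of `ℝⁿ`. -/
theorem euclideanHausdorffMeasure_image_eq_lintegral {n : ℕ}
    {φ : Euc n → F} {V : Set (Euc n)} (hV : IsOpen V)
    (hφ : ContDiffOn ℝ 1 φ V) (hinj : InjOn φ V)
    (himm : ∀ x ∈ V, Function.Injective (fderiv ℝ φ x))
    {s : Set (Euc n)} (hs : MeasurableSet s) (hsV : s ⊆ V) :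
    (Measure.euclideanHausdorffMeasure n) (φ '' s) =
      ∫⁻ x in s, ENNReal.ofReal
        ((fderiv ℝ φ x : Euc n →ₗ[ℝ] F).normDet) := by
  set ρ : Euc n → ℝ := fun x => (fderiv ℝ φ x : Euc n →ₗ[ℝ] F).normDet with hρ
  have hρc : ContinuousOn ρ V :=
    continuous_normDet.comp_continuousOn (hφ.continuousOn_fderiv_of_isOpen hV le_rfl)
  have hρpos : ∀ x ∈ V, 0 < ρ x := fun x hx => LinearMap.normDet_pos (himm x hx)
  have hmeas : ∀ t : Set (Euc n), MeasurableSet t → t ⊆ V → MeasurableSet (φ '' t) := fun t ht htV =>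
    ht.image_of_continuousOn_injOn (hφ.continuousOn.mono htV) (hinj.mono htV)
  have hlin : ∀ (A : Euc n →L[ℝ] F) (t : Set (Euc n)), (Measure.euclideanHausdorffMeasure n) (A '' t) =
      ENNReal.ofReal (A : Euc n →ₗ[ℝ] F).normDet * volume t := by
    intro A t
    have := LinearMap.euclideanHausdorffMeasure_image_eq_normDet_mul_volume (A : Euc n →ₗ[ℝ] F) t
    rwa [finrank_euclideanSpace_fin] at this
  -- On small sets both sides agree with the linear approximation up to a factor `c ^ (n + 1)`.
  have hloc : ∀ c : ℝ≥0, 1 < c → ∀ x ∈ V, ∃ U ∈ 𝓝[V] x, ∀ t ⊆ U ∩ V, MeasurableSet t →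
      (Measure.euclideanHausdorffMeasure n) (φ '' t) ≤
        (c : ℝ≥0∞) ^ (n + 1) * ∫⁻ x in t, ENNReal.ofReal (ρ x) ∧
      ∫⁻ x in t, ENNReal.ofReal (ρ x) ≤
        (c : ℝ≥0∞) ^ (n + 1) * (Measure.euclideanHausdorffMeasure n) (φ '' t) := by
    intro c hc x hx
    have hc' : (1 : ℝ) < c := by exact_mod_cast hc
    have hstr : HasStrictFDerivAt φ (fderiv ℝ φ x) x :=
      (hφ.contDiffAt (hV.mem_nhds hx)).hasStrictFDerivAt one_ne_zero
    obtain ⟨U, hU, hdist⟩ := hstr.eventually_dist_le_mul_dist (himm x hx) hc'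
    have h1 : ∀ᶠ y in 𝓝[V] x, ρ x < c * ρ y := by
      have : ρ x < c * ρ x := by nlinarith [hρpos x hx]
      exact ((hρc x hx).const_smul (c : ℝ)).eventually (lt_mem_nhds this)
    have h2 : ∀ᶠ y in 𝓝[V] x, ρ y < c * ρ x := by
      have : ρ x < c * ρ x := by nlinarith [hρpos x hx]
      exact (hρc x hx).eventually (gt_mem_nhds this)
    refine ⟨U ∩ {y | ρ x < c * ρ y ∧ ρ y < c * ρ x},
      inter_mem (mem_nhdsWithin_of_mem_nhds hU) (h1.and h2), fun t ht htm => ?_⟩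
    have hcoe : ∀ y, ENNReal.ofReal (c * ρ y) = c * ENNReal.ofReal (ρ y) := fun y => by
      rw [ENNReal.ofReal_mul c.coe_nonneg, ENNReal.ofReal_coe_nnreal]
    have hA := hlin (fderiv ℝ φ x) t
    constructor
    · calc _ ≤ (c : ℝ≥0∞) ^ n * (Measure.euclideanHausdorffMeasure n) (fderiv ℝ φ x '' t) :=
            euclideanHausdorffMeasure_image_le_of_dist_le n fun y hy z hz =>
              (hdist y (ht hy).1.1 z (ht hz).1.1).1
        _ = (c : ℝ≥0∞) ^ n * ∫⁻ y in t, ENNReal.ofReal (ρ x) := by rw [hA, setLIntegral_const]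
        _ ≤ (c : ℝ≥0∞) ^ n * ∫⁻ y in t, c * ENNReal.ofReal (ρ y) := by
            refine mul_le_mul_right (setLIntegral_mono' htm fun y hy => ?_) _
            rw [← hcoe]
            exact ENNReal.ofReal_le_ofReal (ht hy).1.2.1.le
        _ = _ := by rw [lintegral_const_mul' _ _ ENNReal.coe_ne_top]; ring
    · calc _ ≤ ∫⁻ y in t, c * ENNReal.ofReal (ρ x) := by
            refine setLIntegral_mono' htm fun y hy => ?_
            rw [← hcoe]
            exact ENNReal.ofReal_le_ofReal (ht hy).1.2.2.le
        _ = c * (Measure.euclideanHausdorffMeasure n) (fderiv ℝ φ x '' t) := by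
            rw [hA, setLIntegral_const, mul_assoc]
        _ ≤ c * ((c : ℝ≥0∞) ^ n * (Measure.euclideanHausdorffMeasure n) (φ '' t)) :=
            mul_le_mul_right (euclideanHausdorffMeasure_image_le_of_dist_le n fun y hy z hz =>
              (hdist y (ht hy).1.1 z (ht hz).1.1).2) _
        _ = _ := by ring
  have hlim : ∀ a b : ℝ≥0∞, (∀ c : ℝ≥0, 1 < c → a ≤ (c : ℝ≥0∞) ^ (n + 1) * b) → a ≤ b := by
    intro a b hab
    have ht : Tendsto (fun c : ℝ≥0 => (c : ℝ≥0∞) ^ (n + 1) * b) (𝓝[>] 1)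
        (𝓝 ((1 : ℝ≥0∞) ^ (n + 1) * b)) := by
      refine ENNReal.Tendsto.mul_const ?_ (Or.inl (by simp))
      refine ENNReal.Tendsto.pow ?_
      exact (ENNReal.continuous_coe.tendsto' 1 1 (by simp)).mono_left nhdsWithin_le_nhds
    rw [one_pow, one_mul] at ht
    exact ge_of_tendsto ht (eventually_mem_nhdsWithin.mono fun c hc => hab c hc)
  have hsum : ∀ t : ℕ → Set (Euc n), (∀ i, MeasurableSet (t i)) →
      Pairwise (Function.onFun Disjoint t) → ∑' i, ∫⁻ x in t i, ENNReal.ofReal (ρ x) =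
      ∫⁻ x in ⋃ i, t i, ENNReal.ofReal (ρ x) := fun t htm htd =>
    (lintegral_iUnion htm htd _).symm
  refine le_antisymm (hlim _ _ fun c hc => ?_) (hlim _ _ fun c hc => ?_)
  · refine setFunction_le_of_locally_le
      (α := fun t => (Measure.euclideanHausdorffMeasure n) (φ '' t))
      (β := fun t => (c : ℝ≥0∞) ^ (n + 1) * ∫⁻ x in t, ENNReal.ofReal (ρ x))
      (by simp) (fun t => ?_) (fun t htm _ htd => ?_) (fun x hx => ?_) hs hsV
    · simp only [image_iUnion]
      exact measure_iUnion_le _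
    · simp only [ENNReal.tsum_mul_left, hsum t htm htd, le_refl]
    · obtain ⟨U, hU, h⟩ := hloc c hc x hx
      exact ⟨U, hU, fun t ht htm => (h t ht htm).1⟩
  · refine setFunction_le_of_locally_le
      (α := fun t => ∫⁻ x in t, ENNReal.ofReal (ρ x))
      (β := fun t => (c : ℝ≥0∞) ^ (n + 1) * (Measure.euclideanHausdorffMeasure n) (φ '' t))
      (by simp) (fun t => lintegral_iUnion_le _ _) (fun t htm htV htd => ?_) (fun x hx => ?_) hs hsV
    · simp only [ENNReal.tsum_mul_left, image_iUnion]
      rw [measure_iUnion (fun i j hij => ?_) (fun i => hmeas _ (htm i) (htV i))]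
      exact disjoint_iff_inter_eq_empty.2 (by
        rw [← hinj.image_inter (htV i) (htV j), (htd hij).inter_eq, image_empty])
    · obtain ⟨U, hU, h⟩ := hloc c hc x hx
      exact ⟨U, hU, fun t ht htm => (h t ht htm).2⟩

end AreaFormula

/-! ### Locally constant cocycles on a normed space -/

section Cocycle

variable {X G : Type*} [NormedAddCommGroup X] [Group G]

/-- A function `c : X → X → G`, of which only the values `c p q` with `q` near `p` matter, is a
local cocycle if `c p q' = c p q * c q q'` for `q` near `p` and `q'` near `q`. -/
def IsLocalCocycle (c : X → X → G) : Prop :=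
  ∀ p, ∀ᶠ q in 𝓝 p, ∀ᶠ q' in 𝓝 q, c p q' = c p q * c q q'

/-- `ε` splits the cocycle `c` over `C`. -/
def IsSplittingOn (c : X → X → G) (ε : X → G) (C : Set X) : Prop :=
  ∀ p ∈ C, ∀ᶠ q in 𝓝 p, ε q = ε p * c p q

theorem IsSplittingOn.mono {c : X → X → G} {ε : X → G} {C D : Set X} (h : IsSplittingOn c ε D)
    (hCD : C ⊆ D) : IsSplittingOn c ε C := fun p hp => h p (hCD hp)

theorem IsSplittingOn.const_mul {c : X → X → G} {ε : X → G} {C : Set X} (h : IsSplittingOn c ε C)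
    (g : G) : IsSplittingOn c (fun x => g * ε x) C := fun p hp =>
  (h p hp).mono fun q hq => by simp only [hq, mul_assoc]

theorem IsSplittingOn.eqOn {c : X → X → G} {ε ε' : X → G} {C : Set X} (hC : IsPreconnected C)
    (h : IsSplittingOn c ε C) (h' : IsSplittingOn c ε' C) {a : X} (ha : a ∈ C)
    (haa : ε a = ε' a) : EqOn ε ε' C := by
  intro x hx
  refine (hC.induction₂' (fun p q => ε p = ε' p ↔ ε q = ε' q) (fun p hp => ?_)
    (fun p q r _ _ _ h1 h2 => h1.trans h2) ha hx).1 haa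
  filter_upwards [mem_nhdsWithin_of_mem_nhds (h p hp), mem_nhdsWithin_of_mem_nhds (h' p hp)]
    with q hq hq'
  rw [hq, hq', mul_left_inj]
  exact ⟨Iff.rfl, Iff.rfl⟩

theorem IsSplittingOn.exists_union {c : X → X → G} {ε₁ ε₂ : X → G} {C₁ C₂ : Set X}
    (h₁ : IsSplittingOn c ε₁ C₁) (h₂ : IsSplittingOn c ε₂ C₂) (hC₁ : IsOpen C₁) (hC₂ : IsOpen C₂)
    (hC : IsPreconnected (C₁ ∩ C₂)) (hne : (C₁ ∩ C₂).Nonempty) :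
    ∃ ε : X → G, EqOn ε ε₁ C₁ ∧ IsSplittingOn c ε (C₁ ∪ C₂) := by
  classical
  obtain ⟨a, ha⟩ := hne
  set ε' : X → G := fun x => (ε₁ a * (ε₂ a)⁻¹) * ε₂ x
  have h' : IsSplittingOn c ε' C₂ := h₂.const_mul _
  have heq : EqOn ε₁ ε' (C₁ ∩ C₂) := IsSplittingOn.eqOn hC (h₁.mono inter_subset_left)
    (h'.mono inter_subset_right) ha (by simp [ε'])
  have e₁ : EqOn (C₁.piecewise ε₁ ε') ε₁ C₁ := piecewise_eqOn _ _ _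
  have e₂ : EqOn (C₁.piecewise ε₁ ε') ε' C₂ := by
    intro x hx
    by_cases hx1 : x ∈ C₁
    · rw [e₁ hx1, heq ⟨hx1, hx⟩]
    · exact piecewise_eq_of_notMem _ _ _ hx1
  refine ⟨C₁.piecewise ε₁ ε', e₁, ?_⟩
  rintro p (hp | hp)
  · filter_upwards [h₁ p hp, hC₁.mem_nhds hp] with q hq hqC
    rw [e₁ hqC, e₁ hp, hq]
  · filter_upwards [h' p hp, hC₂.mem_nhds hp] with q hq hqC
    rw [e₂ hqC, e₂ hp, hq]

variable [NormedSpace ℝ X]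

theorem IsLocalCocycle.exists_isSplittingOn_thickening {c : X → X → G} (hc : IsLocalCocycle c)
    (x : X) : ∃ δ > 0, ∃ ε : X → G, ε 0 = 1 ∧
      IsSplittingOn c ε (Metric.thickening δ (LinearMap.toSpanSingleton ℝ X x '' Icc 0 1)) := by
  set L := LinearMap.toSpanSingleton ℝ X x with hL
  set P : ℝ → Prop := fun t => ∃ δ > 0, ∃ ε : X → G, ε 0 = 1 ∧
      IsSplittingOn c ε (Metric.thickening δ (L '' Icc 0 t)) with hP
  have hball : ∀ p, ∃ r > 0, IsSplittingOn c (c p) (Metric.ball p r) := by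
    intro p
    obtain ⟨r, hr, h⟩ := Metric.eventually_nhds_iff_ball.1 (hc p)
    exact ⟨r, hr, h⟩
  -- A splitting along an initial segment extends over a ball meeting its end.
  have hglue : ∀ p r, 0 < r → IsSplittingOn c (c p) (Metric.ball p r) → ∀ a b : ℝ,
      0 ≤ a → L a ∈ Metric.ball p (r / 2) → L b ∈ Metric.ball p (r / 2) → P a → P b := by
    rintro p r hr hs a b ha hap hbp ⟨δ, hδ, ε, hε0, hε⟩
    have hcv : Convex ℝ (Metric.thickening δ (L '' Icc 0 a)) :=
      ((convex_Icc 0 a).linear_image L).thickening _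
    have hsub : Metric.ball p (r / 2) ⊆ Metric.ball p r := Metric.ball_subset_ball (by linarith)
    obtain ⟨ε', h1, h2⟩ := hε.exists_union hs Metric.isOpen_thickening Metric.isOpen_ball
      (hcv.inter (convex_ball p r)).isPreconnected
      ⟨L a, Metric.self_subset_thickening hδ _ (mem_image_of_mem L (right_mem_Icc.2 ha)), hsub hap⟩
    refine ⟨min δ (r / 2), lt_min hδ (by linarith), ε', ?_, h2.mono ?_⟩
    · rw [h1 (Metric.self_subset_thickening hδ _ ⟨0, left_mem_Icc.2 ha, by simp⟩), hε0]
    · intro y hy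
      obtain ⟨_, ⟨u, hu, rfl⟩, hyz⟩ := Metric.mem_thickening_iff.1 hy
      rcases le_total u a with h | h
      · exact Or.inl (Metric.mem_thickening_iff.2
          ⟨_, mem_image_of_mem L ⟨hu.1, h⟩, hyz.trans_le (min_le_left _ _)⟩)
      · right
        have hzb : L u ∈ Metric.ball p (r / 2) :=
          (((convex_ball p (r / 2)).linear_preimage L).ordConnected.out hap hbp) ⟨h, hu.2⟩
        calc dist y p ≤ dist y (L u) + dist (L u) p := dist_triangle _ _ _
          _ < r / 2 + r / 2 := add_lt_add (hyz.trans_le (min_le_right _ _)) hzb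
          _ = r := by ring
  have h0 : P 0 := by
    obtain ⟨r, hr, h⟩ := hball 0
    refine ⟨r, hr, fun x => (c 0 0)⁻¹ * c 0 x, by simp, ?_⟩
    have : L '' Icc 0 0 = {0} := by simp
    rw [this, Metric.thickening_singleton]
    exact h.const_mul _
  have hiff : P 0 ↔ P 1 := by
    refine (isPreconnected_Icc (a := (0 : ℝ)) (b := 1)).induction₂' (fun a b => P a ↔ P b)
      (fun t ht => ?_) (fun p q r _ _ _ h1 h2 => h1.trans h2) (left_mem_Icc.2 zero_le_one)
      (right_mem_Icc.2 zero_le_one)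
    obtain ⟨r, hr, hs⟩ := hball (L t)
    have hLc : Continuous L := by
      simp only [hL]
      fun_prop
    have hev : ∀ᶠ u in 𝓝[Icc 0 1] t, L u ∈ Metric.ball (L t) (r / 2) :=
      hLc.continuousWithinAt.eventually (Metric.ball_mem_nhds _ (by linarith))
    filter_upwards [hev, self_mem_nhdsWithin] with u hu hu1
    have ht' : L t ∈ Metric.ball (L t) (r / 2) := Metric.mem_ball_self (by linarith)
    have h1 := hglue _ r hr hs t u ht.1 ht' hu
    have h2 := hglue _ r hr hs u t hu1.1 hu ht'
    exact ⟨⟨h1, h2⟩, ⟨h2, h1⟩⟩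
  exact hiff.1 h0

/-- The first cohomology of a normed space is trivial: every local cocycle splits globally. The
splitting is obtained by continuation along the segments issuing from the origin. -/
theorem IsLocalCocycle.exists_isSplittingOn_univ {c : X → X → G} (hc : IsLocalCocycle c) :
    ∃ ε : X → G, ∀ p, ∀ᶠ q in 𝓝 p, ε q = ε p * c p q := by
  choose δ hδ ε hε0 hε using hc.exists_isSplittingOn_thickening
  set C : X → Set X := fun x =>
    Metric.thickening (δ x) (LinearMap.toSpanSingleton ℝ X x '' Icc 0 1)
  have hC : ∀ x, Convex ℝ (C x) := fun x =>
    ((convex_Icc 0 1).linear_image _).thickening _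
  have h0 : ∀ x, (0 : X) ∈ C x := fun x => Metric.self_subset_thickening (hδ x) _
    ⟨0, left_mem_Icc.2 zero_le_one, by simp⟩
  have h1 : ∀ x, x ∈ C x := fun x => Metric.self_subset_thickening (hδ x) _
    ⟨1, right_mem_Icc.2 zero_le_one, by simp⟩
  refine ⟨fun x => ε x x, fun p => ?_⟩
  filter_upwards [Metric.isOpen_thickening.mem_nhds (h1 p), hε p p (h1 p)] with q hq hq'
  have heq := IsSplittingOn.eqOn ((hC p).inter (hC q)).isPreconnected
    ((hε p).mono inter_subset_left) ((hε q).mono inter_subset_right) ⟨h0 p, h0 q⟩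
    (by rw [hε0, hε0])
  rw [← heq ⟨hq, h1 q⟩, hq']

end Cocycle

/-! ### The Jordan–Brouwer separation theorem for hypersurfaces -/

/-- `e` is a smooth chart of `ℝⁿ⁺¹` straightening `M` to the slice `ℝⁿ × {0}`. -/
structure IsSliceChart {n : ℕ} (M : Set (Amb n))
    (e : OpenPartialHomeomorph (Amb n) (Euc n × ℝ)) : Prop where
  contDiffOn : ContDiffOn ℝ ∞ e e.source
  contDiffOn_symm : ContDiffOn ℝ ∞ e.symm e.target
  mem_iff : ∀ x ∈ e.source, x ∈ M ↔ (e x).2 = 0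

theorem IsClosedHypersurface.exists_isSliceChart {n : ℕ} {M : Set (Amb n)}
    (hM : IsClosedHypersurface n M) {p : Amb n} (hp : p ∈ M) :
    ∃ e : OpenPartialHomeomorph (Amb n) (Euc n × ℝ), IsSliceChart M e ∧ p ∈ e.source := by
  obtain ⟨e, he, h1, h2, h3⟩ := hM.exists_slice_chart p hp
  exact ⟨e, ⟨h1, h2, h3⟩, he⟩

section Sides

variable {n : ℕ} {M : Set (Amb n)} {e : OpenPartialHomeomorph (Amb n) (Euc n × ℝ)}

/-- Small neighbourhoods on which both sides of the hypersurface are connected: balls in a slice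
chart. Taking `c = 1` or `c = -1` selects the side. -/
theorem IsSliceChart.exists_nhds_isPreconnected {p : Amb n} (hp : p ∈ e.source)
    {O : Set (Amb n)} (hO : O ∈ 𝓝 p) : ∃ B ∈ 𝓝 p, B ⊆ O ∧ B ⊆ e.source ∧
      ∀ c : ℝ, IsPreconnected {x | x ∈ B ∧ 0 < c * (e x).2} := by
  have hT : e.target ∩ e.symm ⁻¹' O ∈ 𝓝 (e p) := by
    refine inter_mem (e.open_target.mem_nhds (e.map_source hp)) ?_
    apply (e.continuousAt_symm (e.map_source hp)).preimage_mem_nhds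
    rwa [e.left_inv hp]
  obtain ⟨r, hr, hrT⟩ := Metric.mem_nhds_iff.1 hT
  refine ⟨e.source ∩ e ⁻¹' Metric.ball (e p) r, ?_, ?_, inter_subset_left, fun c => ?_⟩
  · exact inter_mem (e.open_source.mem_nhds hp)
      ((e.continuousAt hp).preimage_mem_nhds (Metric.ball_mem_nhds _ hr))
  · rintro x ⟨hx, hxr⟩
    have := (hrT hxr).2
    rwa [mem_preimage, e.left_inv hx] at this
  · have : {x | x ∈ e.source ∩ e ⁻¹' Metric.ball (e p) r ∧ 0 < c * (e x).2} =
        e.symm '' (Metric.ball (e p) r ∩ {z | 0 < c * z.2}) := by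
      ext x
      constructor
      · rintro ⟨⟨hx, hxr⟩, hc⟩
        exact ⟨e x, ⟨hxr, hc⟩, e.left_inv hx⟩
      · rintro ⟨z, ⟨hz, hc⟩, rfl⟩
        have hzt := (hrT hz).1
        refine ⟨⟨e.map_target hzt, ?_⟩, ?_⟩
        · rwa [mem_preimage, e.right_inv hzt]
        · rwa [e.right_inv hzt]
    rw [this]
    have hcv : Convex ℝ {z : Euc n × ℝ | 0 < c * z.2} := by
      have := (convex_Ioi (0 : ℝ)).linear_preimage (c • LinearMap.snd ℝ (Euc n) ℝ)
      simpa [preimage] using this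
    exact ((convex_ball _ _).inter hcv).isPreconnected.image _
      (e.continuousOn_symm.mono (inter_subset_left.trans (hrT.trans inter_subset_left)))

/-- Points of a hypersurface are limits of points on either side of it. -/
theorem IsSliceChart.frequently_side (he : IsSliceChart M e) {p : Amb n} (hp : p ∈ e.source)
    (hpM : p ∈ M) {c : ℝ} (hc : c ≠ 0) : ∃ᶠ x in 𝓝 p, x ∈ e.source ∧ 0 < c * (e x).2 := by
  have h0 : (e p).2 = 0 := (he.mem_iff p hp).1 hpM
  have hpt := e.map_source hp
  have hcont : ContinuousAt (fun t : ℝ => e.symm ((e p).1, c * t)) 0 := by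
    have h1 : ContinuousAt e.symm ((fun t : ℝ => ((e p).1, c * t)) 0) := by
      have : ((fun t : ℝ => ((e p).1, c * t)) 0) = e p := by simp [Prod.ext_iff, h0]
      rw [this]
      exact e.continuousAt_symm hpt
    exact ContinuousAt.comp (f := fun t : ℝ => ((e p).1, c * t)) h1 (by fun_prop)
  have hlim : Tendsto (fun t : ℝ => e.symm ((e p).1, c * t)) (𝓝[>] 0) (𝓝 p) := by
    have : e.symm ((e p).1, c * 0) = p := by
      rw [mul_zero, ← h0, Prod.mk.eta, e.left_inv hp]
    exact (this ▸ hcont.tendsto).mono_left nhdsWithin_le_nhds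
  have htar : ∀ᶠ t in 𝓝[>] (0 : ℝ), ((e p).1, c * t) ∈ e.target := by
    have h2 : Tendsto (fun t : ℝ => ((e p).1, c * t)) (𝓝[>] 0) (𝓝 (e p)) := by
      have : ContinuousAt (fun t : ℝ => ((e p).1, c * t)) 0 := by fun_prop
      have h3 := this.tendsto
      simp only [mul_zero] at h3
      rw [show ((e p).1, (0 : ℝ)) = e p by rw [← h0]] at h3
      exact h3.mono_left nhdsWithin_le_nhds
    exact h2.eventually (e.open_target.mem_nhds hpt)
  refine hlim.frequently (Eventually.frequently ?_)
  filter_upwards [htar, self_mem_nhdsWithin] with t ht htpos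
  refine ⟨e.map_target ht, ?_⟩
  rw [e.right_inv ht]
  have : 0 < t := htpos
  have : 0 < c * c := mul_self_pos.2 hc
  nlinarith

/-- The side of the slice `ℝⁿ × {0}` on which a point with last coordinate `y ≠ 0` lies. -/
noncomputable def sideSign (y : ℝ) : ℤˣ := if 0 < y then 1 else -1

theorem sideSign_mul_pos {y : ℝ} (hy : y ≠ 0) : 0 < ((sideSign y : ℤ) : ℝ) * y := by
  rcases hy.lt_or_gt with h | h
  · have : ¬ 0 < y := h.le.not_gt
    simp [sideSign, this, h]
  · simp [sideSign, h]

/-- Near a point of the hypersurface the sides defined by two slice charts agree up to a sign. -/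
theorem IsSliceChart.exists_sideSign_eq (he : IsSliceChart M e)
    {e' : OpenPartialHomeomorph (Amb n) (Euc n × ℝ)} (he' : IsSliceChart M e') {p : Amb n}
    (hp : p ∈ e.source) (hp' : p ∈ e'.source) (hpM : p ∈ M) :
    ∃ u : ℤˣ, ∀ᶠ x in 𝓝 p, x ∉ M → sideSign (e' x).2 = u * sideSign (e x).2 := by
  obtain ⟨B, hB, hBe', hBe, hconn⟩ :=
    IsSliceChart.exists_nhds_isPreconnected hp (e'.open_source.mem_nhds hp')
  have hne : ∀ x ∈ B, x ∉ M → (e' x).2 ≠ 0 := fun x hx hxM h =>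
    hxM ((he'.mem_iff x (hBe' hx)).2 h)
  have hside : ∀ (c : ℝ), ∀ x ∈ B, 0 < c * (e x).2 → x ∉ M := fun c x hx hc hxM => by
    rw [(he.mem_iff x (hBe hx)).1 hxM, mul_zero] at hc
    exact hc.false
  have hconst : ∀ c : ℝ, ∀ x ∈ B, ∀ y ∈ B, 0 < c * (e x).2 → 0 < c * (e y).2 →
      sideSign (e' x).2 = sideSign (e' y).2 := by
    intro c x hx y hy hcx hcy
    have hcont : ContinuousOn (fun x => (e' x).2) {x | x ∈ B ∧ 0 < c * (e x).2} :=
      continuous_snd.comp_continuousOn (e'.continuousOn.mono fun z hz => hBe' hz.1)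
    have h0 : ∀ z ∈ {x | x ∈ B ∧ 0 < c * (e x).2}, (e' z).2 ≠ 0 := fun z hz =>
      hne z hz.1 (hside c z hz.1 hz.2)
    have hoc := ((hconn c).image _ hcont).ordConnected
    have hx' := mem_image_of_mem (fun x => (e' x).2)
      (show x ∈ {x | x ∈ B ∧ 0 < c * (e x).2} from ⟨hx, hcx⟩)
    have hy' := mem_image_of_mem (fun x => (e' x).2)
      (show y ∈ {x | x ∈ B ∧ 0 < c * (e x).2} from ⟨hy, hcy⟩)
    have key : ∀ a b, a ∈ (fun x => (e' x).2) '' {x | x ∈ B ∧ 0 < c * (e x).2} →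
        b ∈ (fun x => (e' x).2) '' {x | x ∈ B ∧ 0 < c * (e x).2} → 0 < a → 0 < b := by
      intro a b ha hb hpos
      by_contra hb'
      obtain ⟨z, hz, hz0⟩ := hoc.out hb ha ⟨not_lt.1 hb', hpos.le⟩
      exact h0 z hz hz0
    have : 0 < (e' x).2 ↔ 0 < (e' y).2 := ⟨key _ _ hx' hy', key _ _ hy' hx'⟩
    simp only [sideSign, this]
  -- Both signs of `e'` occur near `p`, so the signs on the two sides for `e` differ.
  have hex : ∀ c : ℝ, c ≠ 0 → ∃ x ∈ B, 0 < c * (e x).2 := fun c hc => by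
    obtain ⟨x, ⟨_, hx⟩, hxB⟩ := ((he.frequently_side hp hpM hc).and_eventually hB).exists
    exact ⟨x, hxB, hx⟩
  have hex' : ∀ c : ℝ, c ≠ 0 → ∃ x ∈ B, 0 < c * (e' x).2 := fun c hc => by
    obtain ⟨x, ⟨_, hx⟩, hxB⟩ := ((he'.frequently_side hp' hpM hc).and_eventually hB).exists
    exact ⟨x, hxB, hx⟩
  obtain ⟨a, haB, ha⟩ := hex 1 one_ne_zero
  obtain ⟨b, hbB, hb⟩ := hex (-1) (by norm_num)
  have hab : sideSign (e' b).2 = -sideSign (e' a).2 := by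
    have hsplit : ∀ z ∈ B, z ∉ M →
        sideSign (e' z).2 = sideSign (e' a).2 ∨ sideSign (e' z).2 = sideSign (e' b).2 := by
      intro z hz hzM
      rcases lt_or_gt_of_ne (fun h => hzM ((he.mem_iff z (hBe hz)).2 h)) with h | h
      · exact Or.inr (hconst (-1) z hz b hbB (by linarith) hb)
      · exact Or.inl (hconst 1 z hz a haB (by linarith) ha)
    obtain ⟨x, hxB, hx⟩ := hex' 1 one_ne_zero
    obtain ⟨y, hyB, hy⟩ := hex' (-1) (by norm_num)
    have hM' : ∀ c : ℝ, ∀ z ∈ B, 0 < c * (e' z).2 → z ∉ M := fun c z hz hc hzM => by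
      rw [(he'.mem_iff z (hBe' hz)).1 hzM, mul_zero] at hc
      exact hc.false
    have hx1 : sideSign (e' x).2 = 1 := by simp [sideSign, show 0 < (e' x).2 by linarith]
    have hy1 : sideSign (e' y).2 = -1 := by simp [sideSign, show ¬ 0 < (e' y).2 by linarith]
    rcases hsplit x hxB (hM' _ x hxB hx) with h1 | h1 <;>
      rcases hsplit y hyB (hM' _ y hyB hy) with h2 | h2 <;> rw [hx1] at h1 <;> rw [hy1] at h2
    · exact absurd (h1.trans h2.symm) (by decide)
    · rw [← h1, ← h2]
    · rw [← h1, ← h2, neg_neg]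
    · exact absurd (h1.trans h2.symm) (by decide)
  refine ⟨sideSign (e' a).2, ?_⟩
  filter_upwards [hB] with z hz hzM
  rcases lt_or_gt_of_ne (fun h => hzM ((he.mem_iff z (hBe hz)).2 h)) with h | h
  · rw [hconst (-1) z hz b hbB (by linarith) hb, hab]
    simp [sideSign, h.le.not_gt]
  · rw [hconst 1 z hz a haB (by linarith) ha]
    simp [sideSign, h]

end Sides

section Separation

variable {n : ℕ} {M : Set (Amb n)}

theorem eventually_sideSign_eq {X : Type*} [TopologicalSpace X] {f : X → ℝ} {x : X}
    (hf : ContinuousAt f x) (hx : f x ≠ 0) : ∀ᶠ y in 𝓝 x, sideSign (f y) = sideSign (f x) := by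
  rcases hx.lt_or_gt with h | h
  · filter_upwards [hf.eventually (gt_mem_nhds h)] with y hy
    simp [sideSign, h.le.not_gt, hy.le.not_gt]
  · filter_upwards [hf.eventually (lt_mem_nhds h)] with y hy
    simp [sideSign, h, hy]

theorem IsClosedHypersurface.frequently_notMem (hM : IsClosedHypersurface n M) (p : Amb n) :
    ∃ᶠ x in 𝓝 p, x ∉ M := by
  by_cases hp : p ∈ M
  · obtain ⟨e, he, hpe⟩ := hM.exists_isSliceChart hp
    refine (he.frequently_side hpe hp one_ne_zero).mono fun x hx hxM => ?_
    rw [(he.mem_iff x hx.1).1 hxM, mul_zero] at hx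
    exact hx.2.false
  · exact Eventually.frequently (hM.isCompact.isClosed.isOpen_compl.mem_nhds hp)

/-- The Jordan–Brouwer separation theorem for hypersurfaces: there is a locally constant function
with values `±1` on the complement of `M` that takes different values on the two sides of `M`.
The local side functions define a cocycle with values in `ℤˣ`, which splits. -/
theorem IsClosedHypersurface.exists_global_side (hM : IsClosedHypersurface n M) :
    ∃ s : Amb n → ℤˣ, (∀ p ∉ M, ∀ᶠ q in 𝓝 p, s q = s p) ∧
      ∀ e, IsSliceChart M e → ∀ p ∈ M, p ∈ e.source →
        ∃ u : ℤˣ, ∀ᶠ x in 𝓝 p, x ∉ M → s x = u * sideSign (e x).2 := by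
  classical
  have : Nonempty (OpenPartialHomeomorph (Amb n) (Euc n × ℝ)) := by
    obtain ⟨p, hp⟩ := hM.isConnected.nonempty
    exact ⟨(hM.exists_isSliceChart hp).choose⟩
  choose! E hE hpE using fun p => hM.exists_isSliceChart (p := p)
  have hopen : IsOpen Mᶜ := hM.isCompact.isClosed.isOpen_compl
  set side : Amb n → Amb n → ℤˣ := fun p x => if p ∈ M then sideSign (E p x).2 else 1 with hside
  have side_of_mem : ∀ p ∈ M, ∀ x, side p x = sideSign (E p x).2 := fun p hp x => by
    simp [hside, hp]
  have side_of_notMem : ∀ p ∉ M, ∀ x, side p x = 1 := fun p hp x => by simp [hside, hp]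
  set good : Amb n → Amb n → ℤˣ → Prop := fun p q u =>
    ∀ᶠ x in 𝓝 q, x ∉ M → side p x = u * side q x with hgood
  have hex : ∀ p, ∀ᶠ q in 𝓝 p, ∃ u, good p q u := by
    intro p
    by_cases hp : p ∈ M
    · filter_upwards [(E p).open_source.mem_nhds (hpE p hp)] with q hq
      by_cases hqM : q ∈ M
      · obtain ⟨u, hu⟩ := (hE q hqM).exists_sideSign_eq (hE p hp) (hpE q hqM) hq hqM
        exact ⟨u, by simpa only [hgood, side_of_mem p hp, side_of_mem q hqM] using hu⟩
      · have hne : (E p q).2 ≠ 0 := fun h => hqM (((hE p hp).mem_iff q hq).2 h)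
        refine ⟨sideSign (E p q).2, ?_⟩
        have hc : ContinuousAt (fun x => (E p x).2) q :=
          continuous_snd.continuousAt.comp ((E p).continuousAt hq)
        filter_upwards [eventually_sideSign_eq hc hne] with x hx _
        rw [side_of_mem p hp, side_of_notMem q hqM, hx, mul_one]
    · filter_upwards [hopen.mem_nhds hp] with q hq
      exact ⟨1, Eventually.of_forall fun x _ => by
        rw [side_of_notMem p hp, side_of_notMem q hq, mul_one]⟩
  set c : Amb n → Amb n → ℤˣ := fun p q => if h : ∃ u, good p q u then h.choose else 1 with hc
  have hcg : ∀ p q, (∃ u, good p q u) → good p q (c p q) := fun p q h => by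
    simp only [hc, h, dite_true]
    exact h.choose_spec
  have hcoc : IsLocalCocycle c := by
    intro p
    filter_upwards [hex p, eventually_eventually_nhds.2 (hex p)] with q hq hq'
    filter_upwards [hq', hex q, eventually_eventually_nhds.2 (hcg p q hq)] with q' h1 h2 h3
    obtain ⟨x, hxM, hx1, hx2, hx3⟩ := ((hM.frequently_notMem q').and_eventually
      ((hcg p q' h1).and ((hcg q q' h2).and h3))).exists
    have := hx1 hxM
    rw [hx3 hxM, hx2 hxM, ← mul_assoc] at this
    exact (mul_right_cancel this).symm
  obtain ⟨ε, hε⟩ := hcoc.exists_isSplittingOn_univ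
  have hεside : ∀ p, ∀ᶠ x in 𝓝 p, x ∉ M → ε x = ε p * side p x := by
    intro p
    filter_upwards [hε p, hex p] with x hx hx' hxM
    rw [hx, (hcg p x hx').self_of_nhds hxM, side_of_notMem x hxM, mul_one]
  refine ⟨ε, fun p hp => ?_, fun e he p hp hpe => ?_⟩
  · filter_upwards [hεside p, hopen.mem_nhds hp] with x hx hxM
    rw [hx hxM, side_of_notMem p hp, mul_one]
  · obtain ⟨u, hu⟩ := he.exists_sideSign_eq (hE p hp) hpe (hpE p hp) hp
    refine ⟨ε p * u, ?_⟩
    filter_upwards [hu, hεside p] with x hx hx' hxM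
    rw [hx' hxM, side_of_mem p hp, hx hxM, mul_assoc]

theorem isPreconnected_norm_gt (hn : 1 ≤ n) {R : ℝ} (hR : 0 ≤ R) :
    IsPreconnected {x : Amb n | R < ‖x‖} := by
  have hrank : 1 < Module.rank ℝ (Amb n) := by
    rw [← Module.finrank_eq_rank, finrank_euclideanSpace_fin]
    exact_mod_cast (by omega : 1 < n + 1)
  have h1 := (isPreconnected_Ioi (a := R)).prod (isPreconnected_sphere hrank (0 : Amb n) 1)
  have h2 := h1.image (fun z : ℝ × Amb n => z.1 • z.2) (by fun_prop)
  convert h2 using 1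
  ext x
  simp only [mem_ofPred_eq, mem_image, mem_prod, mem_Ioi, mem_sphere_zero_iff_norm, Prod.exists]
  constructor
  · intro hx
    have hx0 : ‖x‖ ≠ 0 := (hR.trans_lt hx).ne'
    exact ⟨‖x‖, ‖x‖⁻¹ • x, ⟨hx, by rw [norm_smul]; simp [hx0]⟩, by simp [smul_smul, hx0]⟩
  · rintro ⟨a, b, ⟨ha, hb⟩, rfl⟩
    rw [norm_smul, hb, mul_one, Real.norm_eq_abs]
    exact ha.trans_le (le_abs_self a)

/-- The points off `M` lying in an unbounded component of the complement of `M`. -/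
def exterior (M : Set (Amb n)) : Set (Amb n) :=
  {x | ¬ Bornology.IsBounded (connectedComponentIn Mᶜ x)}

theorem exterior_subset_compl : exterior M ⊆ Mᶜ := by
  intro x hx hxM
  apply hx
  rw [connectedComponentIn_eq_empty (by simpa using hxM)]
  exact Bornology.isBounded_empty

theorem mem_exterior_of_isPreconnected {C : Set (Amb n)} (hC : IsPreconnected C) (hCM : C ⊆ Mᶜ)
    {x y : Amb n} (hx : x ∈ C) (hy : y ∈ C) (hxe : x ∈ exterior M) : y ∈ exterior M := by
  have hy' : y ∈ connectedComponentIn Mᶜ x := hC.subset_connectedComponentIn hx hCM hy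
  simpa only [exterior, mem_ofPred_eq, connectedComponentIn_eq hy'] using hxe

/-- Everything far away lies in the exterior. -/
theorem mem_exterior_of_norm_gt (hn : 1 ≤ n) {R : ℝ} (hR : 0 ≤ R) (hMR : ∀ x ∈ M, ‖x‖ ≤ R)
    {x : Amb n} (hx : R < ‖x‖) : x ∈ exterior M := by
  intro hb
  have hsub : {x : Amb n | R < ‖x‖} ⊆ connectedComponentIn Mᶜ x :=
    (isPreconnected_norm_gt hn hR).subset_connectedComponentIn hx
      fun y hy hyM => (hMR y hyM).not_gt hy
  obtain ⟨C, hC⟩ := (hb.subset hsub).exists_norm_le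
  have : (‖x‖ * (max C R + 1)) • (‖x‖⁻¹ • x) = (max C R + 1) • x := by
    have : ‖x‖ ≠ 0 := (hR.trans_lt hx).ne'
    rw [smul_smul]
    congr 1
    field_simp
  have hx0 : 0 < ‖x‖ := hR.trans_lt hx
  have h1 : ‖(max C R + 1) • (‖x‖⁻¹ • x)‖ = max C R + 1 := by
    have : 0 ≤ max C R + 1 := by linarith [le_max_right C R]
    rw [norm_smul, norm_smul, norm_inv, norm_norm, inv_mul_cancel₀ hx0.ne', mul_one,
      Real.norm_of_nonneg this]
  have h2 := hC ((max C R + 1) • (‖x‖⁻¹ • x)) (by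
    rw [mem_ofPred_eq, h1]
    linarith [le_max_right C R])
  linarith [le_max_left C R]

theorem IsClosedHypersurface.exists_norm_le (hM : IsClosedHypersurface n M) :
    ∃ R, 0 ≤ R ∧ ∀ x ∈ M, ‖x‖ ≤ R := by
  obtain ⟨R, hR⟩ := hM.isCompact.isBounded.exists_norm_le
  obtain ⟨p, hp⟩ := hM.isConnected.nonempty
  exact ⟨R, (norm_nonneg p).trans (hR p hp), hR⟩

theorem isOpen_exterior (hM : IsClosedHypersurface n M) : IsOpen (exterior M) := by
  rw [isOpen_iff_mem_nhds]
  intro x hx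
  have hxM := exterior_subset_compl hx
  have hop : IsOpen (connectedComponentIn Mᶜ x) :=
    hM.isCompact.isClosed.isOpen_compl.connectedComponentIn
  refine mem_of_superset (hop.mem_nhds (mem_connectedComponentIn hxM)) fun y hy => ?_
  exact mem_exterior_of_isPreconnected isPreconnected_connectedComponentIn
    (connectedComponentIn_subset _ _) (mem_connectedComponentIn hxM) hy hx

theorem exists_norm_gt (R : ℝ) : ∃ x : Amb n, R < ‖x‖ := by
  obtain ⟨x, hx⟩ := NormedSpace.exists_lt_norm ℝ (Amb n) R
  exact ⟨x, hx⟩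

/-- Near each point of a hypersurface, exactly one of the two sides belongs to the exterior. -/
theorem IsClosedHypersurface.exists_mem_exterior_iff (hn : 1 ≤ n) (hM : IsClosedHypersurface n M)
    {e : OpenPartialHomeomorph (Amb n) (Euc n × ℝ)} (he : IsSliceChart M e) {p : Amb n}
    (hp : p ∈ M) (hpe : p ∈ e.source) :
    ∃ c : ℝ, c ≠ 0 ∧ ∀ᶠ x in 𝓝 p, x ∈ exterior M ↔ 0 < c * (e x).2 := by
  obtain ⟨R, hR, hMR⟩ := hM.exists_norm_le
  obtain ⟨s, hs, hside⟩ := hM.exists_global_side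
  obtain ⟨w, hw⟩ := exists_norm_gt (n := n) R
  -- The global side function is constant on the exterior.
  have hsU : ∀ x ∈ exterior M, s x = s w := by
    intro x hx
    have hxM := exterior_subset_compl hx
    have hy : ∃ y ∈ connectedComponentIn Mᶜ x, R < ‖y‖ := by
      by_contra! h
      exact hx ((Metric.isBounded_closedBall (x := (0 : Amb n)) (r := R)).subset
        fun y hy => by simpa using h y hy)
    have hloc : ∀ C ⊆ Mᶜ, IsPreconnected C → ∀ a ∈ C, ∀ b ∈ C, s a = s b := by
      intro C hCM hC a ha b hb
      refine hC.induction₂ (fun a b => s a = s b) (fun z hz => ?_)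
        (fun _ _ _ _ _ _ h1 h2 => h1.trans h2) (fun _ _ _ _ h => h.symm) ha hb
      exact mem_nhdsWithin_of_mem_nhds ((hs z (hCM hz)).mono fun y hy => hy.symm)
    obtain ⟨y, hyC, hyR⟩ := hy
    rw [hloc _ (connectedComponentIn_subset _ _) isPreconnected_connectedComponentIn x
      (mem_connectedComponentIn hxM) y hyC]
    exact hloc {x | R < ‖x‖} (fun z hz hzM => (hMR z hzM).not_gt hz)
      (isPreconnected_norm_gt hn hR) y hyR w hw
  -- At a limit point of the exterior, one side belongs to it.
  have hloc : ∀ q ∈ M, q ∈ closure (exterior M) → ∀ e, IsSliceChart M e → q ∈ e.source →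
      ∃ c : ℝ, c ≠ 0 ∧ ∀ᶠ x in 𝓝 q, x ∈ exterior M ↔ 0 < c * (e x).2 := by
    intro q hq hqcl e he hqe
    obtain ⟨u, hu⟩ := hside e he q hq hqe
    obtain ⟨B, hB, hBO, hBe, hconn⟩ := IsSliceChart.exists_nhds_isPreconnected hqe hu
    have hc : (((s w * u : ℤˣ) : ℤ) : ℝ) ≠ 0 := by simp
    have hfw : ∀ x ∈ B, x ∈ exterior M → 0 < (((s w * u : ℤˣ) : ℤ) : ℝ) * (e x).2 := by
      intro x hx hxe
      have hxM := exterior_subset_compl hxe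
      have h1 : s x = u * sideSign (e x).2 := hBO hx hxM
      rw [hsU x hxe] at h1
      have h2 : s w * u = sideSign (e x).2 := by
        rw [h1, mul_comm, ← mul_assoc, Int.units_mul_self, one_mul]
      rw [h2]
      exact sideSign_mul_pos fun h => hxM ((he.mem_iff x (hBe hx)).2 h)
    refine ⟨_, hc, ?_⟩
    filter_upwards [hB] with x hx
    refine ⟨hfw x hx, fun hpos => ?_⟩
    obtain ⟨y, hyB, hye⟩ := mem_closure_iff_nhds.1 hqcl B hB
    refine mem_exterior_of_isPreconnected (hconn _) ?_ ⟨hyB, hfw y hyB hye⟩ ⟨hx, hpos⟩ hye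
    rintro z ⟨hzB, hz⟩ hzM
    rw [(he.mem_iff z (hBe hzB)).1 hzM, mul_zero] at hz
    exact hz.false
  -- The set of limit points of the exterior on `M` is open, closed and nonempty.
  have hiff : ∀ q ∈ M, ∀ᶠ q' in 𝓝[M] q, q ∈ closure (exterior M) → q' ∈ closure (exterior M) := by
    intro q hq
    by_cases hqcl : q ∈ closure (exterior M)
    · obtain ⟨e, he, hqe⟩ := hM.exists_isSliceChart hq
      obtain ⟨c, hc, hev⟩ := hloc q hq hqcl e he hqe
      filter_upwards [self_mem_nhdsWithin,
        mem_nhdsWithin_of_mem_nhds (eventually_eventually_nhds.2 hev),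
        mem_nhdsWithin_of_mem_nhds (e.open_source.mem_nhds hqe)] with q' hq' hev' hq'e _
      rw [mem_closure_iff_frequently]
      exact ((he.frequently_side hq'e hq' hc).and_eventually hev').mono
        fun x hx => hx.2.2 hx.1.2
    · exact Eventually.of_forall fun q' h => absurd h hqcl
  have hiff' : ∀ q ∈ M, ∀ᶠ q' in 𝓝[M] q, q' ∈ closure (exterior M) → q ∈ closure (exterior M) := by
    intro q hq
    by_cases hqcl : q ∈ closure (exterior M)
    · exact Eventually.of_forall fun q' _ => hqcl
    · filter_upwards [mem_nhdsWithin_of_mem_nhds (isClosed_closure.isOpen_compl.mem_nhds hqcl)]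
        with q' hq' h
      exact absurd h hq'
  have hne : ∃ q ∈ M, q ∈ closure (exterior M) := by
    by_contra! h
    have hcl : IsClosed (exterior M) := by
      refine isClosed_of_closure_subset fun x hx => ?_
      have hxM : x ∈ Mᶜ := fun hxM => h x hxM hx
      have hop : IsOpen (connectedComponentIn Mᶜ x) :=
        hM.isCompact.isClosed.isOpen_compl.connectedComponentIn
      obtain ⟨y, hyC, hye⟩ := mem_closure_iff.1 hx _ hop (mem_connectedComponentIn hxM)
      exact mem_exterior_of_isPreconnected isPreconnected_connectedComponentIn
        (connectedComponentIn_subset _ _) hyC (mem_connectedComponentIn hxM) hye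
    obtain ⟨q, hq⟩ := hM.isConnected.nonempty
    have huniv := IsClopen.eq_univ ⟨hcl, isOpen_exterior hM⟩
      ⟨w, mem_exterior_of_norm_gt hn hR hMR hw⟩
    exact exterior_subset_compl (huniv.symm ▸ mem_univ q) hq
  obtain ⟨q, hq, hqcl⟩ := hne
  refine hloc p hp ?_ e he hpe
  refine hM.isConnected.isPreconnected.induction₂'
    (fun a b => a ∈ closure (exterior M) → b ∈ closure (exterior M))
    (fun z hz => (hiff z hz).and (hiff' z hz)) (fun _ _ _ _ _ _ h1 h2 h => h2 (h1 h)) hq hp hqcl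

end Separation

/-! ### Slice parametrizations, tangent spaces and normals -/

section SliceParam

variable {n : ℕ} {M : Set (Amb n)} {e : OpenPartialHomeomorph (Amb n) (Euc n × ℝ)}

/-- The parametrization of a hypersurface by an open subset of `ℝⁿ` inverse to a slice chart. -/
def sliceParam (e : OpenPartialHomeomorph (Amb n) (Euc n × ℝ)) (x : Euc n) : Amb n :=
  e.symm (x, 0)

/-- The domain of the parametrization inverse to a slice chart. -/
def sliceDom (e : OpenPartialHomeomorph (Amb n) (Euc n × ℝ)) : Set (Euc n) :=
  {x | ((x, 0) : Euc n × ℝ) ∈ e.target}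

theorem isOpen_sliceDom : IsOpen (sliceDom e) :=
  e.open_target.preimage (f := fun x : Euc n => ((x, 0) : Euc n × ℝ)) (by fun_prop)

theorem sliceParam_mem_source {x : Euc n} (hx : x ∈ sliceDom e) : sliceParam e x ∈ e.source :=
  e.map_target hx

theorem apply_sliceParam {x : Euc n} (hx : x ∈ sliceDom e) : e (sliceParam e x) = (x, 0) :=
  e.right_inv hx

theorem injOn_sliceParam : InjOn (sliceParam e) (sliceDom e) := fun x hx y hy h => by
  have := congrArg e h
  rw [apply_sliceParam hx, apply_sliceParam hy] at this
  exact (Prod.ext_iff.1 this).1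

namespace IsSliceChart

theorem contDiffOn_sliceParam (he : IsSliceChart M e) :
    ContDiffOn ℝ ∞ (sliceParam e) (sliceDom e) :=
  he.contDiffOn_symm.comp (t := e.target) (f := fun x : Euc n => ((x, 0) : Euc n × ℝ))
    (by fun_prop) fun _ hx => hx

theorem sliceParam_mem (he : IsSliceChart M e) {x : Euc n} (hx : x ∈ sliceDom e) :
    sliceParam e x ∈ M :=
  (he.mem_iff _ (sliceParam_mem_source hx)).2 (by rw [apply_sliceParam hx])

theorem fst_mem_sliceDom (he : IsSliceChart M e) {p : Amb n} (hp : p ∈ M) (hpe : p ∈ e.source) :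
    (e p).1 ∈ sliceDom e := by
  have : ((e p).1, (0 : ℝ)) = e p := by rw [← (he.mem_iff p hpe).1 hp]
  rw [sliceDom, mem_ofPred_eq, this]
  exact e.map_source hpe

theorem sliceParam_fst (he : IsSliceChart M e) {p : Amb n} (hp : p ∈ M) (hpe : p ∈ e.source) :
    sliceParam e (e p).1 = p := by
  have : ((e p).1, (0 : ℝ)) = e p := by rw [← (he.mem_iff p hpe).1 hp]
  rw [sliceParam, this, e.left_inv hpe]

theorem image_sliceParam (he : IsSliceChart M e) : sliceParam e '' sliceDom e = M ∩ e.source := by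
  ext p
  constructor
  · rintro ⟨x, hx, rfl⟩
    exact ⟨he.sliceParam_mem hx, sliceParam_mem_source hx⟩
  · rintro ⟨hp, hpe⟩
    exact ⟨(e p).1, he.fst_mem_sliceDom hp hpe, he.sliceParam_fst hp hpe⟩

theorem contDiffAt_sliceParam (he : IsSliceChart M e) {x : Euc n} (hx : x ∈ sliceDom e) :
    ContDiffAt ℝ ∞ (sliceParam e) x :=
  he.contDiffOn_sliceParam.contDiffAt (isOpen_sliceDom.mem_nhds hx)

theorem hasFDerivAt_sliceParam (he : IsSliceChart M e) {x : Euc n} (hx : x ∈ sliceDom e) :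
    HasFDerivAt (sliceParam e) (fderiv ℝ (sliceParam e) x) x :=
  ((he.contDiffAt_sliceParam hx).differentiableAt (by simp)).hasFDerivAt

theorem contDiffAt (he : IsSliceChart M e) {p : Amb n} (hp : p ∈ e.source) : ContDiffAt ℝ ∞ e p :=
  he.contDiffOn.contDiffAt (e.open_source.mem_nhds hp)

theorem hasFDerivAt (he : IsSliceChart M e) {p : Amb n} (hp : p ∈ e.source) :
    HasFDerivAt e (fderiv ℝ e p) p :=
  ((he.contDiffAt hp).differentiableAt (by simp)).hasFDerivAt

theorem fderiv_comp_fderiv_sliceParam (he : IsSliceChart M e) {x : Euc n} (hx : x ∈ sliceDom e)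
    (v : Euc n) : fderiv ℝ e (sliceParam e x) (fderiv ℝ (sliceParam e) x v) = (v, 0) := by
  have h1 := (he.hasFDerivAt (sliceParam_mem_source hx)).comp x (he.hasFDerivAt_sliceParam hx)
  have h2 : HasFDerivAt (fun x : Euc n => ((x, 0) : Euc n × ℝ))
      (ContinuousLinearMap.inl ℝ (Euc n) ℝ) x := (ContinuousLinearMap.inl ℝ (Euc n) ℝ).hasFDerivAt
  have h3 := h1.unique (h2.congr_of_eventuallyEq (by
    filter_upwards [isOpen_sliceDom.mem_nhds hx] with y hy
    exact apply_sliceParam hy))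
  exact DFunLike.congr_fun h3 v

theorem injective_fderiv_sliceParam (he : IsSliceChart M e) {x : Euc n} (hx : x ∈ sliceDom e) :
    Function.Injective (fderiv ℝ (sliceParam e) x) := fun v w h => by
  have := congrArg (fderiv ℝ e (sliceParam e x)) h
  rw [he.fderiv_comp_fderiv_sliceParam hx, he.fderiv_comp_fderiv_sliceParam hx] at this
  exact (Prod.ext_iff.1 this).1

theorem fderiv_sliceParam_of_snd_eq_zero (he : IsSliceChart M e) {x : Euc n}
    (hx : x ∈ sliceDom e) {v : Amb n} (hv : (fderiv ℝ e (sliceParam e x) v).2 = 0) :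
    fderiv ℝ (sliceParam e) x (fderiv ℝ e (sliceParam e x) v).1 = v := by
  have hs : HasFDerivAt e.symm (fderiv ℝ e.symm (x, 0)) (x, 0) :=
    ((he.contDiffOn_symm.contDiffAt (e.open_target.mem_nhds hx)).differentiableAt
      (by simp)).hasFDerivAt
  have hp : HasFDerivAt (sliceParam e)
      (fderiv ℝ e.symm (x, 0) ∘L ContinuousLinearMap.inl ℝ (Euc n) ℝ) x :=
    HasFDerivAt.comp x (f := fun x : Euc n => ((x, 0) : Euc n × ℝ)) hs
      (ContinuousLinearMap.inl ℝ (Euc n) ℝ).hasFDerivAt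
  have h1 := HasFDerivAt.comp (sliceParam e x) (g := e.symm)
    (by rw [apply_sliceParam hx]; exact hs) (he.hasFDerivAt (sliceParam_mem_source hx))
  have h2 := h1.unique ((hasFDerivAt_id _).congr_of_eventuallyEq (by
    filter_upwards [e.open_source.mem_nhds (sliceParam_mem_source hx)] with y hy
    exact e.left_inv hy))
  rw [hp.fderiv]
  have h3 := DFunLike.congr_fun h2 v
  simp only [ContinuousLinearMap.comp_apply, ContinuousLinearMap.id_apply] at h3 ⊢
  conv_rhs => rw [← h3]
  congr 1
  exact Prod.ext rfl hv.symm

/-- The tangent space of a hypersurface is the kernel of the differential of the defining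
function. -/
theorem mem_tangentAt_iff_snd (he : IsSliceChart M e) {x : Euc n} (hx : x ∈ sliceDom e)
    (v : Amb n) : v ∈ tangentAt M (sliceParam e x) ↔ (fderiv ℝ e (sliceParam e x) v).2 = 0 := by
  set p := sliceParam e x with hp
  have hpe : p ∈ e.source := sliceParam_mem_source hx
  constructor
  · intro hv
    set ℓ : Amb n →L[ℝ] ℝ := ContinuousLinearMap.snd ℝ (Euc n) ℝ ∘L fderiv ℝ e p
    have h1 : HasFDerivWithinAt (fun y => (e y).2) ℓ (M ∩ e.source) p :=
      ((ContinuousLinearMap.snd ℝ (Euc n) ℝ).hasFDerivAt.comp p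
        (he.hasFDerivAt hpe)).hasFDerivWithinAt
    have h2 : HasFDerivWithinAt (fun y => (e y).2) (0 : Amb n →L[ℝ] ℝ) (M ∩ e.source) p :=
      (hasFDerivWithinAt_const (0 : ℝ) p _).congr (fun y hy => (he.mem_iff y hy.2).1 hy.1)
        ((he.mem_iff p hpe).1 (he.sliceParam_mem hx))
    have hle : tangentAt M p ≤ LinearMap.ker (ℓ : Amb n →ₗ[ℝ] ℝ) := by
      refine Submodule.span_le.2 fun w hw => ?_
      have hw' : w ∈ tangentConeAt ℝ (M ∩ e.source) p :=
        tangentConeAt_mono_nhds (by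
          rw [inter_comm, nhdsWithin_inter_of_mem (mem_nhdsWithin_of_mem_nhds (e.open_source.mem_nhds hpe))]) hw
      exact h1.unique_on h2 hw'
    exact hle hv
  · intro hv
    rw [← he.fderiv_sliceParam_of_snd_eq_zero hx hv]
    refine Submodule.subset_span ?_
    have h1 := (he.hasFDerivAt_sliceParam hx).hasFDerivWithinAt.mapsTo_tangent_cone
      (s := sliceDom e)
    rw [tangentConeAt_of_mem_nhds (isOpen_sliceDom.mem_nhds hx), he.image_sliceParam] at h1
    exact tangentConeAt_mono inter_subset_left (h1 (mem_univ _))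

theorem fderiv_sliceParam_mem_tangentAt (he : IsSliceChart M e) {x : Euc n} (hx : x ∈ sliceDom e)
    (v : Euc n) : fderiv ℝ (sliceParam e) x v ∈ tangentAt M (sliceParam e x) := by
  rw [he.mem_tangentAt_iff_snd hx, he.fderiv_comp_fderiv_sliceParam hx]

end IsSliceChart

/-- At each point of a hypersurface there is a normal vector `g` such that the directions `w` with
`⟪g, w⟫ > 0` lead into the exterior, those with `⟪g, w⟫ < 0` away from it. -/
theorem IsClosedHypersurface.exists_exterior_direction (hn : 1 ≤ n)
    (hM : IsClosedHypersurface n M) {p : Amb n} (hp : p ∈ M) :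
    ∃ g : Amb n, g ≠ 0 ∧ (∀ v, v ∈ tangentAt M p ↔ inner ℝ g v = 0) ∧
      (∀ w, 0 < inner ℝ g w → ∀ᶠ s : ℝ in 𝓝[>] 0, p + s • w ∈ exterior M) ∧
      ∀ w, inner ℝ g w < 0 → ∀ᶠ s : ℝ in 𝓝[>] 0, p + s • w ∉ exterior M := by
  obtain ⟨e, he, hpe⟩ := hM.exists_isSliceChart hp
  obtain ⟨c, hc, hiff⟩ := hM.exists_mem_exterior_iff hn he hp hpe
  have hx := he.fst_mem_sliceDom hp hpe
  have hpx := he.sliceParam_fst hp hpe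
  set ℓ : Amb n →L[ℝ] ℝ := c • (ContinuousLinearMap.snd ℝ (Euc n) ℝ ∘L fderiv ℝ e p) with hℓ
  set g := (InnerProductSpace.toDual ℝ (Amb n)).symm ℓ with hg
  have hgw : ∀ w, inner ℝ g w = ℓ w := fun w => InnerProductSpace.toDual_symm_apply
  have hℓw : ∀ w, ℓ w = c * (fderiv ℝ e p w).2 := fun w => rfl
  have hT : ∀ v, v ∈ tangentAt M p ↔ inner ℝ g v = 0 := by
    intro v
    have := he.mem_tangentAt_iff_snd hx v
    rw [hpx] at this
    rw [this, hgw, hℓw, mul_eq_zero, or_iff_right hc]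
  have hp0 : (e p).2 = 0 := (he.mem_iff p hpe).1 hp
  have hline : ∀ w : Amb n, Tendsto (fun s : ℝ => p + s • w) (𝓝[>] 0) (𝓝 p) := fun w => by
    have : ContinuousAt (fun s : ℝ => p + s • w) 0 := by fun_prop
    have := this.tendsto
    simp only [zero_smul, add_zero] at this
    exact this.mono_left nhdsWithin_le_nhds
  have hder : ∀ w, HasDerivAt (fun s : ℝ => c * (e (p + s • w)).2) (ℓ w) 0 := by
    intro w
    have h1 : HasDerivAt (fun s : ℝ => p + s • w) w 0 := by
      simpa using ((hasDerivAt_id (0 : ℝ)).smul_const w).const_add p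
    have h2 : HasFDerivAt (fun y => c * (e y).2) ℓ (p + (0 : ℝ) • w) := by
      rw [zero_smul, add_zero]
      exact ((ContinuousLinearMap.snd ℝ (Euc n) ℝ).hasFDerivAt.comp p
        (he.hasFDerivAt hpe)).const_mul c
    exact h2.comp_hasDerivAt (0 : ℝ) h1
  have hslope : ∀ w, Tendsto (fun s : ℝ => s⁻¹ * (c * (e (p + s • w)).2)) (𝓝[>] 0) (𝓝 (ℓ w)) := by
    intro w
    have h1 := (hder w).tendsto_slope_zero_right
    simpa [hp0] using h1
  refine ⟨g, ?_, hT, fun w hw => ?_, fun w hw => ?_⟩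
  · intro h0
    -- Otherwise every vector would be tangent, but the chart has a direction across the slice.
    have htan : ∀ v, (fderiv ℝ e p v).2 = 0 := by
      intro v
      have h2 := hgw v
      rw [h0, inner_zero_left, hℓw] at h2
      exact (mul_eq_zero.1 h2.symm).resolve_left hc
    have hinj : Function.Injective (fderiv ℝ e p) := by
      intro v w hvw
      have h1 := he.fderiv_sliceParam_of_snd_eq_zero hx (v := v) (by rw [hpx]; exact htan v)
      have h2 := he.fderiv_sliceParam_of_snd_eq_zero hx (v := w) (by rw [hpx]; exact htan w)
      rw [hpx] at h1 h2
      rw [← h1, ← h2, hvw]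
    have hinj' : Function.Injective (fun v => (fderiv ℝ e p v).1) := fun v w hvw =>
      hinj (Prod.ext hvw ((htan v).trans (htan w).symm))
    have := LinearMap.finrank_le_finrank_of_injective
      (f := (ContinuousLinearMap.fst ℝ (Euc n) ℝ ∘L fderiv ℝ e p : Amb n →L[ℝ] Euc n).toLinearMap)
      hinj'
    simp at this
  · rw [hgw] at hw
    filter_upwards [(hslope w).eventually (lt_mem_nhds hw), self_mem_nhdsWithin,
      (hline w).eventually hiff] with s hs hs0 hse
    have hs0' : (0 : ℝ) < s := hs0
    exact hse.2 ((mul_pos_iff_of_pos_left (inv_pos.2 hs0')).1 hs)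
  · rw [hgw] at hw
    filter_upwards [(hslope w).eventually (gt_mem_nhds hw), self_mem_nhdsWithin,
      (hline w).eventually hiff] with s hs hs0 hse hext
    have hs0' : (0 : ℝ) < s := hs0
    have := mul_pos (inv_pos.2 hs0') (hse.1 hext)
    linarith

theorem IsClosedHypersurface.isOuterUnitNormal_outerNormal (hn : 1 ≤ n)
    (hM : IsClosedHypersurface n M) {p : Amb n} (hp : p ∈ M) :
    IsOuterUnitNormal M p (outerNormal M p) := by
  obtain ⟨g, hg, hT, hpos, -⟩ := hM.exists_exterior_direction hn hp
  refine Classical.epsilon_spec (p := IsOuterUnitNormal M p) ⟨‖g‖⁻¹ • g, ?_, fun v hv => ?_, ?_⟩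
  · rw [norm_smul, norm_inv, norm_norm, inv_mul_cancel₀ (norm_ne_zero_iff.2 hg)]
  · rw [inner_smul_left, (hT v).1 hv, mul_zero]
  · refine hpos _ ?_
    rw [inner_smul_right, real_inner_self_eq_norm_sq]
    have := norm_pos_iff.2 hg
    positivity

/-- A direction leading into the exterior is on the side of the outer normal. -/
theorem IsClosedHypersurface.inner_outerNormal_pos (hn : 1 ≤ n) (hM : IsClosedHypersurface n M)
    {p : Amb n} (hp : p ∈ M) {w : Amb n} (hw : ∀ᶠ s : ℝ in 𝓝[>] 0, p + s • w ∈ exterior M)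
    (hne : inner ℝ (outerNormal M p) w ≠ 0) : 0 < inner ℝ (outerNormal M p) w := by
  obtain ⟨g, hg, hT, hpos, hneg⟩ := hM.exists_exterior_direction hn hp
  obtain ⟨h1, h2, h3⟩ := hM.isOuterUnitNormal_outerNormal hn hp
  set η := outerNormal M p
  have hgg : inner ℝ g g ≠ 0 := inner_self_ne_zero.2 hg
  -- The outer normal is a positive multiple of `g`.
  obtain ⟨a, ha⟩ : ∃ a : ℝ, η = a • g := by
    set a := inner ℝ g η / inner ℝ g g
    have hperp : inner ℝ g (η - a • g) = 0 := by
      rw [inner_sub_right, inner_smul_right, div_mul_cancel₀ _ hgg, sub_self]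
    have h4 := h2 _ ((hT _).2 hperp)
    refine ⟨a, sub_eq_zero.1 (inner_self_eq_zero (𝕜 := ℝ).1 ?_)⟩
    rw [inner_sub_left, h4, inner_smul_left, hperp, mul_zero, sub_zero]
  have side : ∀ v : Amb n, (∀ᶠ s : ℝ in 𝓝[>] 0, p + s • v ∈ exterior M) → 0 ≤ inner ℝ g v := by
    intro v hv
    by_contra! h
    obtain ⟨s, hs1, hs2⟩ := (hv.and (hneg v h)).exists
    exact hs2 hs1
  have ha0 : 0 ≤ a := by
    have := side η h3
    rw [ha, inner_smul_right, real_inner_self_eq_norm_sq] at this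
    have hgn : 0 < ‖g‖ ^ 2 := by
      have := norm_pos_iff.2 hg
      positivity
    exact nonneg_of_mul_nonneg_left this hgn
  refine lt_of_le_of_ne ?_ hne.symm
  rw [ha, inner_smul_left]
  exact mul_nonneg ha0 (side w hw)

end SliceParam

/-! ### The Jacobian -/

section Jacobian

variable {n : ℕ}

theorem stdVolForm_sq (w : Fin (n + 1) → Amb n) :
    stdVolForm n w ^ 2 = (Matrix.of fun i j => inner ℝ (w i) (w j)).det := by
  have h : (Matrix.of fun i j => inner ℝ (w i) (w j)) =
      ((EuclideanSpace.basisFun (Fin (n + 1)) ℝ).toBasis.toMatrix w).transpose *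
        (EuclideanSpace.basisFun (Fin (n + 1)) ℝ).toBasis.toMatrix w := by
    ext i j
    simp [Matrix.mul_apply, Module.Basis.toMatrix_apply, PiLp.inner_apply, mul_comm]
  rw [h, Matrix.det_mul, Matrix.det_transpose, stdVolForm, Module.Basis.det_apply, sq]

/-- For a unit normal `η` of the range of `A`, the form `i_η Ω` measures the volume distortion of
`A`. -/
theorem abs_stdVolForm_vecCons {A : Euc n →L[ℝ] Amb n} {η : Amb n} (hη : ‖η‖ = 1)
    (hA : ∀ v, inner ℝ η (A v) = 0) :
    |stdVolForm n (Matrix.vecCons η fun i => A (EuclideanSpace.basisFun (Fin n) ℝ i))| =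
      (A : Euc n →ₗ[ℝ] Amb n).normDet := by
  rw [← abs_of_nonneg (LinearMap.normDet_nonneg (A : Euc n →ₗ[ℝ] Amb n)), ← sq_eq_sq_iff_abs_eq_abs,
    stdVolForm_sq]
  have h2 := LinearMap.normDet_sq_eq_det_gram (A : Euc n →ₗ[ℝ] Amb n)
    (EuclideanSpace.basisFun (Fin n) ℝ)
  simp only [RCLike.ofReal_real_eq_id, id_eq] at h2
  rw [h2, Matrix.det_succ_row_zero, Fin.sum_univ_succ]
  have h0 : ∀ i : Fin n, inner ℝ η (Matrix.vecCons η
      (fun i => A (EuclideanSpace.basisFun (Fin n) ℝ i)) i.succ) = (0 : ℝ) := fun i => by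
    simpa using hA _
  simp only [Matrix.of_apply, Matrix.cons_val_zero, h0, mul_zero, zero_mul, Finset.sum_const_zero,
    add_zero, real_inner_self_eq_norm_sq, hη]
  simp only [Fin.val_zero, pow_zero, one_pow, one_mul]
  congr 1

variable {M N : Set (Amb n)} {e : OpenPartialHomeomorph (Amb n) (Euc n × ℝ)} {h : Amb n → Amb n}

theorem fderivWithin_apply_eq_of_mem_tangentAt {F : Type*} [NormedAddCommGroup F] [NormedSpace ℝ F]
    {f : Amb n → F} {A B : Amb n →L[ℝ] F} {p : Amb n} (hA : HasFDerivWithinAt f A M p)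
    (hB : HasFDerivWithinAt f B M p) {v : Amb n} (hv : v ∈ tangentAt M p) : A v = B v := by
  have hle : tangentAt M p ≤ LinearMap.ker ((A - B : Amb n →L[ℝ] F) : Amb n →ₗ[ℝ] F) :=
    Submodule.span_le.2 fun w hw => by
      simpa [sub_eq_zero] using hA.unique_on hB hw
  simpa [sub_eq_zero] using hle hv

theorem map_mem_tangentAt {A : Amb n →L[ℝ] Amb n} {p : Amb n} (hA : HasFDerivWithinAt h A M p)
    (hm : MapsTo h M N) {v : Amb n} (hv : v ∈ tangentAt M p) : A v ∈ tangentAt N (h p) := by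
  have hle : tangentAt M p ≤ (tangentAt N (h p)).comap (A : Amb n →ₗ[ℝ] Amb n) :=
    Submodule.span_le.2 fun w hw => Submodule.subset_span
      (tangentConeAt_mono (image_subset_iff.2 hm) (hA.mapsTo_tangent_cone hw))
  exact hle hv

theorem IsSliceChart.stdVolForm_ne_zero (he : IsSliceChart M e) {x : Euc n} (hx : x ∈ sliceDom e)
    {η : Amb n} (hη : IsOuterUnitNormal M (sliceParam e x) η) :
    stdVolForm n (Matrix.vecCons η
      fun i => fderiv ℝ (sliceParam e) x (EuclideanSpace.basisFun (Fin n) ℝ i)) ≠ 0 := by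
  rw [← abs_ne_zero, abs_stdVolForm_vecCons hη.1 fun v =>
    hη.2.1 _ (he.fderiv_sliceParam_mem_tangentAt hx v)]
  exact (LinearMap.normDet_pos (he.injective_fderiv_sliceParam hx)).ne'

/-- The Jacobian has its defining property, the space of alternating forms of top degree on the
tangent space being one-dimensional. -/
theorem pullbackVolForm_eq_jacobian_smul (hn : 1 ≤ n) (hM : IsClosedHypersurface n M)
    {p : Amb n} (hp : p ∈ M) :
    pullbackVolForm M N h p = jacobian M N h p • volForm M p := by
  obtain ⟨e, he, hpe⟩ := hM.exists_isSliceChart hp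
  have hx := he.fst_mem_sliceDom hp hpe
  have hpx := he.sliceParam_fst hp hpe
  set x := (e p).1
  rw [← hpx] at hp ⊢
  have hη := hM.isOuterUnitNormal_outerNormal hn hp
  clear hpx hpe
  set p := sliceParam e x with hp'
  set A := fderiv ℝ (sliceParam e) x with hA
  let L : Euc n ≃ₗ[ℝ] tangentAt M p := LinearEquiv.ofBijective
    ((A : Euc n →ₗ[ℝ] Amb n).codRestrict (tangentAt M p)
      fun v => he.fderiv_sliceParam_mem_tangentAt hx v) (by
    constructor
    · intro v w hvw
      exact he.injective_fderiv_sliceParam hx (congrArg Subtype.val hvw)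
    · intro v
      exact ⟨(fderiv ℝ e p v).1, Subtype.ext (he.fderiv_sliceParam_of_snd_eq_zero hx
        ((he.mem_tangentAt_iff_snd hx _).1 v.2))⟩)
  have hL : ∀ v, (L v : Amb n) = A v := fun v => rfl
  let b : Module.Basis (Fin n) ℝ (tangentAt M p) :=
    (EuclideanSpace.basisFun (Fin n) ℝ).toBasis.map L
  have hb : ∀ i, (b i : Amb n) = A (EuclideanSpace.basisFun (Fin n) ℝ i) := fun i => by
    rw [← hL]
    simp [b]
  have hvol : volForm M p b = stdVolForm n (Matrix.vecCons (outerNormal M p)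
      fun i => A (EuclideanSpace.basisFun (Fin n) ℝ i)) := by
    rw [volForm, AlternatingMap.compLinearMap_apply, AlternatingMap.curryLeft_apply_apply]
    simp only [Submodule.subtype_apply, hb]
  have hne : volForm M p b ≠ 0 := by
    rw [hvol]
    exact he.stdVolForm_ne_zero hx hη
  have hex : ∃ c : ℝ, pullbackVolForm M N h p = c • volForm M p := by
    refine ⟨pullbackVolForm M N h p b / volForm M p b, ?_⟩
    rw [(volForm M p).eq_smul_basis_det b, (pullbackVolForm M N h p).eq_smul_basis_det b]
    simp only [AlternatingMap.smul_apply, Module.Basis.det_self, smul_eq_mul, mul_one, smul_smul]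
    rw [div_mul_cancel₀ _ hne]
  exact Classical.epsilon_spec (p := fun c : ℝ => pullbackVolForm M N h p = c • volForm M p) hex

/-- The Jacobian compares both volume forms on the tangent vectors of a slice parametrization. -/
theorem IsSliceChart.jacobian_mul (hn : 1 ≤ n) (hM : IsClosedHypersurface n M)
    (he : IsSliceChart M e) {x : Euc n} (hx : x ∈ sliceDom e) :
    jacobian M N h (sliceParam e x) *
        stdVolForm n (Matrix.vecCons (outerNormal M (sliceParam e x))
          fun i => fderiv ℝ (sliceParam e) x (EuclideanSpace.basisFun (Fin n) ℝ i)) =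
      stdVolForm n (Matrix.vecCons (outerNormal N (h (sliceParam e x)))
          fun i => fderivWithin ℝ h M (sliceParam e x)
            (fderiv ℝ (sliceParam e) x (EuclideanSpace.basisFun (Fin n) ℝ i))) := by
  have h3 := DFunLike.congr_fun
    (pullbackVolForm_eq_jacobian_smul (N := N) (h := h) hn hM (he.sliceParam_mem hx))
    fun i => ⟨fderiv ℝ (sliceParam e) x (EuclideanSpace.basisFun (Fin n) ℝ i),
      he.fderiv_sliceParam_mem_tangentAt hx _⟩
  rw [pullbackVolForm, AlternatingMap.compLinearMap_apply, AlternatingMap.curryLeft_apply_apply,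
    AlternatingMap.smul_apply, volForm, AlternatingMap.compLinearMap_apply,
    AlternatingMap.curryLeft_apply_apply, smul_eq_mul] at h3
  exact h3.symm

theorem IsSliceChart.hasFDerivAt_comp_sliceParam {F : Type*} [NormedAddCommGroup F]
    [NormedSpace ℝ F] {f : Amb n → F} (he : IsSliceChart M e) {x : Euc n} (hx : x ∈ sliceDom e)
    (hf : DifferentiableWithinAt ℝ f M (sliceParam e x)) :
    HasFDerivAt (f ∘ sliceParam e)
      (fderivWithin ℝ f M (sliceParam e x) ∘L fderiv ℝ (sliceParam e) x) x := by
  have h1 := hf.hasFDerivWithinAt.comp x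
    (he.hasFDerivAt_sliceParam hx).hasFDerivWithinAt (s := sliceDom e)
    (fun y hy => he.sliceParam_mem hy)
  exact h1.hasFDerivAt (isOpen_sliceDom.mem_nhds hx)

/-- The Jacobian in a parametrization: the quotient of the volume densities. -/
theorem IsSliceChart.abs_jacobian_mul_normDet (hn : 1 ≤ n) (hM : IsClosedHypersurface n M)
    (hN : IsClosedHypersurface n N) (he : IsSliceChart M e) {x : Euc n} (hx : x ∈ sliceDom e)
    (hm : MapsTo h M N) (hd : DifferentiableWithinAt ℝ h M (sliceParam e x)) :
    |jacobian M N h (sliceParam e x)| *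
      (fderiv ℝ (sliceParam e) x : Euc n →ₗ[ℝ] Amb n).normDet =
    (fderiv ℝ (h ∘ sliceParam e) x : Euc n →ₗ[ℝ] Amb n).normDet := by
  have hp := he.sliceParam_mem hx
  have hη := hM.isOuterUnitNormal_outerNormal hn hp
  have hη' := hN.isOuterUnitNormal_outerNormal hn (hm hp)
  have key := congrArg abs (he.jacobian_mul (N := N) (h := h) hn hM hx)
  rw [abs_mul, abs_stdVolForm_vecCons hη.1 fun v =>
      hη.2.1 _ (he.fderiv_sliceParam_mem_tangentAt hx v)] at key
  rw [key, (he.hasFDerivAt_comp_sliceParam hx hd).fderiv, ← abs_stdVolForm_vecCons hη'.1]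
  · rfl
  · exact fun v => hη'.2.1 _ (map_mem_tangentAt hd.hasFDerivWithinAt hm
      (he.fderiv_sliceParam_mem_tangentAt hx v))

theorem jacobian_congr {h' : Amb n → Amb n} (hh : EqOn h h' M) {p : Amb n} (hp : p ∈ M) :
    jacobian M N h p = jacobian M N h' p := by
  have : pullbackVolForm M N h p = pullbackVolForm M N h' p := by
    rw [pullbackVolForm, pullbackVolForm, fderivWithin_congr hh (hh hp), hh hp]
  rw [jacobian, jacobian, this]

/-- The chain rule for Jacobians. -/
theorem jacobian_comp (hn : 1 ≤ n) (hM : IsClosedHypersurface n M)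
    (hN : IsClosedHypersurface n N) {P : Set (Amb n)} {k : Amb n → Amb n}
    (hm : MapsTo h M N) {p : Amb n} (hp : p ∈ M) (hh : DifferentiableWithinAt ℝ h M p)
    (hk : DifferentiableWithinAt ℝ k N (h p)) :
    jacobian M P (k ∘ h) p = jacobian N P k (h p) * jacobian M N h p := by
  obtain ⟨e, he, hpe⟩ := hM.exists_isSliceChart hp
  have hx := he.fst_mem_sliceDom hp hpe
  have hpx := he.sliceParam_fst hp hpe
  set x := (e p).1
  rw [← hpx] at hp hh hk ⊢
  have hη := hM.isOuterUnitNormal_outerNormal hn hp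
  have h1 := he.jacobian_mul (N := P) (h := k ∘ h) hn hM hx
  have h2 := he.jacobian_mul (N := N) (h := h) hn hM hx
  have h3 := DFunLike.congr_fun (pullbackVolForm_eq_jacobian_smul (N := P) (h := k) hn hN (hm hp))
    fun i => ⟨fderivWithin ℝ h M (sliceParam e x)
      (fderiv ℝ (sliceParam e) x (EuclideanSpace.basisFun (Fin n) ℝ i)),
      map_mem_tangentAt hh.hasFDerivWithinAt hm (he.fderiv_sliceParam_mem_tangentAt hx _)⟩
  rw [pullbackVolForm, AlternatingMap.compLinearMap_apply, AlternatingMap.curryLeft_apply_apply,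
    AlternatingMap.smul_apply, volForm, AlternatingMap.compLinearMap_apply,
    AlternatingMap.curryLeft_apply_apply, smul_eq_mul] at h3
  simp only [Submodule.subtype_apply] at h3
  rw [← h2, ← mul_assoc] at h3
  have hcomp := hk.hasFDerivWithinAt.comp _ hh.hasFDerivWithinAt hm
  refine mul_right_cancel₀ (he.stdVolForm_ne_zero hx hη) (h1.trans (Eq.trans ?_ h3))
  congr 2
  ext1 i
  exact fderivWithin_apply_eq_of_mem_tangentAt hcomp.differentiableWithinAt.hasFDerivWithinAt hcomp
    (he.fderiv_sliceParam_mem_tangentAt hx _)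

end Jacobian

/-! ### Change of variables on hypersurfaces -/

section ChangeOfVariables

open scoped ENNReal NNReal

section Abstract

variable {X Y : Type*} [MeasurableSpace X] [MeasurableSpace Y] {μ : Measure X} {ν : Measure Y}
  {S : Set X} {h : X → Y} {d : X → ℝ}

/-- If a map on `S` multiplies the measure of subsets by the density `d`, it transports `d μ` on `S`
to the measure `ν` on its image. -/
theorem map_withDensity_eq_restrict_image (hS : MeasurableSet S)
    (he : MeasurableEmbedding (S.domRestrict h))
    (H : ∀ E ⊆ S, MeasurableSet E → ν (h '' E) = ∫⁻ x in E, ENNReal.ofReal (d x) ∂μ) :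
    Measure.map (S.domRestrict h)
      (Measure.comap (↑) (μ.withDensity fun x => ENNReal.ofReal (d x))) =
      ν.restrict (h '' S) := by
  ext E hE
  have hm : MeasurableSet (Subtype.val '' (S.domRestrict h ⁻¹' E) : Set X) :=
    (MeasurableEmbedding.subtype_coe hS).measurableSet_image.2 (he.measurable hE)
  have hi : h '' (Subtype.val '' (S.domRestrict h ⁻¹' E)) = E ∩ h '' S := by
    ext y
    constructor
    · rintro ⟨_, ⟨x, hx, rfl⟩, rfl⟩
      exact ⟨hx, x, x.2, rfl⟩
    · rintro ⟨hy, x, hx, rfl⟩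
      exact ⟨x, ⟨⟨x, hx⟩, hy, rfl⟩, rfl⟩
  rw [he.map_apply, (MeasurableEmbedding.subtype_coe hS).comap_apply, withDensity_apply _ hm,
    ← H _ (by simp) hm, hi, Measure.restrict_apply hE]

theorem lintegral_image_eq_of_measure_image (hS : MeasurableSet S)
    (he : MeasurableEmbedding (S.domRestrict h)) (hd : AEMeasurable d (μ.restrict S))
    (H : ∀ E ⊆ S, MeasurableSet E → ν (h '' E) = ∫⁻ x in E, ENNReal.ofReal (d x) ∂μ)
    (g : Y → ℝ≥0∞) :
    ∫⁻ y in h '' S, g y ∂ν = ∫⁻ x in S, ENNReal.ofReal (d x) * g (h x) ∂μ := by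
  rw [← map_withDensity_eq_restrict_image hS he H, he.lintegral_map]
  simp only [Set.domRestrict_apply, ← Function.comp_apply (f := g)]
  rw [← (MeasurableEmbedding.subtype_coe hS).lintegral_map, map_comap_subtype_coe hS,
    setLIntegral_withDensity_eq_setLIntegral_mul_non_measurable₀ _ _ _ hS]
  · simp only [Pi.mul_apply, Function.comp_apply]
  · simp
  · exact hd.ennreal_ofReal

theorem integral_image_eq_of_measure_image (hS : MeasurableSet S)
    (he : MeasurableEmbedding (S.domRestrict h)) (hd : AEMeasurable d (μ.restrict S))
    (hd₀ : ∀ x ∈ S, 0 ≤ d x)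
    (H : ∀ E ⊆ S, MeasurableSet E → ν (h '' E) = ∫⁻ x in E, ENNReal.ofReal (d x) ∂μ) (g : Y → ℝ) :
    ∫ y in h '' S, g y ∂ν = ∫ x in S, d x * g (h x) ∂μ := by
  rw [← map_withDensity_eq_restrict_image hS he H, he.integral_map]
  simp only [Set.domRestrict_apply, ← Function.comp_apply (f := g), ENNReal.ofReal]
  rw [← (MeasurableEmbedding.subtype_coe hS).integral_map, map_comap_subtype_coe hS,
    setIntegral_withDensity_eq_setIntegral_smul₀ hd.real_toNNReal _ hS]
  refine setIntegral_congr_fun hS fun x hx => ?_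
  simp [NNReal.smul_def, Real.coe_toNNReal _ (hd₀ x hx)]

end Abstract

variable {n : ℕ} {M N : Set (Amb n)} {e : OpenPartialHomeomorph (Amb n) (Euc n × ℝ)}
  {h : Amb n → Amb n} {r : ℕ∞}

/-- The density of the volume in a slice parametrization. -/
noncomputable def sliceDensity (e : OpenPartialHomeomorph (Amb n) (Euc n × ℝ)) (x : Euc n) : ℝ :=
  (fderiv ℝ (sliceParam e) x : Euc n →ₗ[ℝ] Amb n).normDet

namespace IsSliceChart

theorem sliceDensity_pos (he : IsSliceChart M e) {x : Euc n} (hx : x ∈ sliceDom e) :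
    0 < sliceDensity e x :=
  LinearMap.normDet_pos (he.injective_fderiv_sliceParam hx)

theorem contDiffOn_sliceDensity (he : IsSliceChart M e) :
    ContDiffOn ℝ ∞ (sliceDensity e) (sliceDom e) := by
  intro x hx
  have h1 : ContDiffAt ℝ ∞ (fderiv ℝ (sliceParam e)) x :=
    (he.contDiffAt_sliceParam hx).fderiv_right (m := ∞) (by simp)
  exact ((contDiffAt_normDet (he.injective_fderiv_sliceParam hx)).comp x h1).contDiffWithinAt

theorem measure_image_sliceParam (he : IsSliceChart M e) {s : Set (Euc n)} (hs : s ⊆ sliceDom e)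
    (hsm : MeasurableSet s) : (Measure.euclideanHausdorffMeasure n) (sliceParam e '' s) =
      ∫⁻ x in s, ENNReal.ofReal (sliceDensity e x) :=
  euclideanHausdorffMeasure_image_eq_lintegral isOpen_sliceDom
    (he.contDiffOn_sliceParam.of_le (by exact_mod_cast le_top)) injOn_sliceParam
    (fun _ hx => he.injective_fderiv_sliceParam hx) hsm hs

theorem measurableEmbedding_sliceParam (he : IsSliceChart M e) {s : Set (Euc n)}
    (hs : s ⊆ sliceDom e) (hsm : MeasurableSet s) :
    MeasurableEmbedding (s.domRestrict (sliceParam e)) :=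
  (he.contDiffOn_sliceParam.continuousOn.mono hs).measurableEmbedding hsm (injOn_sliceParam.mono hs)

theorem aemeasurable_sliceDensity (he : IsSliceChart M e) {s : Set (Euc n)}
    (hs : s ⊆ sliceDom e) (hsm : MeasurableSet s) :
    AEMeasurable (sliceDensity e) (volume.restrict s) :=
  (he.contDiffOn_sliceDensity.continuousOn.mono hs).aemeasurable hsm

theorem lintegral_image_sliceParam (he : IsSliceChart M e) {s : Set (Euc n)}
    (hs : s ⊆ sliceDom e) (hsm : MeasurableSet s) (g : Amb n → ℝ≥0∞) :
    ∫⁻ y in sliceParam e '' s, g y ∂(Measure.euclideanHausdorffMeasure n) =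
      ∫⁻ x in s, ENNReal.ofReal (sliceDensity e x) * g (sliceParam e x) :=
  lintegral_image_eq_of_measure_image hsm (he.measurableEmbedding_sliceParam hs hsm)
    (he.aemeasurable_sliceDensity hs hsm)
    (fun _ hE hEm => he.measure_image_sliceParam (hE.trans hs) hEm) g

theorem integral_image_sliceParam (he : IsSliceChart M e) {s : Set (Euc n)}
    (hs : s ⊆ sliceDom e) (hsm : MeasurableSet s) (g : Amb n → ℝ) :
    ∫ y in sliceParam e '' s, g y ∂(Measure.euclideanHausdorffMeasure n) =
      ∫ x in s, sliceDensity e x * g (sliceParam e x) :=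
  integral_image_eq_of_measure_image hsm (he.measurableEmbedding_sliceParam hs hsm)
    (he.aemeasurable_sliceDensity hs hsm) (fun _ hx => (he.sliceDensity_pos (hs hx)).le)
    (fun _ hE hEm => he.measure_image_sliceParam (hE.trans hs) hEm) g

end IsSliceChart

theorem IsClosedHypersurface.measure_lt_top (hM : IsClosedHypersurface n M) :
    (Measure.euclideanHausdorffMeasure n) M < ⊤ := by
  refine hM.isCompact.measure_lt_top_of_nhdsWithin fun p hp => ?_
  obtain ⟨e, he, hpe⟩ := hM.exists_isSliceChart hp
  have hx := he.fst_mem_sliceDom hp hpe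
  obtain ⟨ε, hε, hball⟩ := Metric.nhds_basis_closedBall.mem_iff.1 (isOpen_sliceDom.mem_nhds hx)
  refine ⟨sliceParam e '' Metric.closedBall (e p).1 ε, ?_, ?_⟩
  · have : ∀ᶠ q in 𝓝 p, q ∈ e.source ∧ (e q).1 ∈ Metric.closedBall (e p).1 ε :=
      Filter.Eventually.and (e.open_source.mem_nhds hpe)
        ((continuous_fst.continuousAt.comp (e.continuousAt hpe)).preimage_mem_nhds
          (Metric.closedBall_mem_nhds _ hε))
    filter_upwards [self_mem_nhdsWithin, mem_nhdsWithin_of_mem_nhds this] with q hq hq'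
    exact ⟨(e q).1, hq'.2, he.sliceParam_fst hq hq'.1⟩
  · rw [he.measure_image_sliceParam hball Metric.isClosed_closedBall.measurableSet]
    exact ((he.contDiffOn_sliceDensity.continuousOn.mono hball).integrableOn_compact
      (isCompact_closedBall _ _)).lintegral_lt_top

theorem IsClosedHypersurface.measure_pos (hM : IsClosedHypersurface n M) :
    0 < (Measure.euclideanHausdorffMeasure n) M := by
  obtain ⟨p, hp⟩ := hM.isConnected.nonempty
  obtain ⟨e, he, hpe⟩ := hM.exists_isSliceChart hp
  have hx := he.fst_mem_sliceDom hp hpe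
  refine lt_of_lt_of_le ?_ (measure_mono (he.image_sliceParam.trans_subset inter_subset_left))
  rw [he.measure_image_sliceParam le_rfl isOpen_sliceDom.measurableSet, pos_iff_ne_zero]
  intro h0
  rw [lintegral_eq_zero_iff' (he.aemeasurable_sliceDensity le_rfl
    isOpen_sliceDom.measurableSet).ennreal_ofReal, EventuallyEq,
    ae_restrict_iff' isOpen_sliceDom.measurableSet] at h0
  refine (isOpen_sliceDom.measure_pos volume ⟨_, hx⟩).ne' (measure_mono_null ?_ (ae_iff.1 h0))
  exact fun y hy h => (ENNReal.ofReal_pos.2 (he.sliceDensity_pos hy)).ne' (h hy)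

theorem IsClosedHypersurface.isFiniteMeasure (hM : IsClosedHypersurface n M) :
    IsFiniteMeasure (volMeasure M) :=
  ⟨by rw [volMeasure, Measure.restrict_apply_univ]; exact hM.measure_lt_top⟩

theorem IsClosedHypersurface.Vol_pos (hM : IsClosedHypersurface n M) : 0 < Vol M := by
  rw [Vol, Measure.real, volMeasure, Measure.restrict_apply_univ]
  exact ENNReal.toReal_pos hM.measure_pos.ne' hM.measure_lt_top.ne

theorem IsClosedHypersurface.integrable (hM : IsClosedHypersurface n M) {f : Amb n → ℝ}
    (hf : ContinuousOn f M) : Integrable f (volMeasure M) := by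
  have := hM.isFiniteMeasure
  have h := hf.integrableOn_compact (μ := volMeasure M) hM.isCompact
  rwa [IntegrableOn, volMeasure, Measure.restrict_restrict hM.isCompact.measurableSet,
    inter_self] at h

namespace IsDiffeo

theorem contDiffOn_one (hr : 1 ≤ r) (hh : IsDiffeo r M N h) : ContDiffOn ℝ 1 h M :=
  hh.contDiffOn.of_le (by exact_mod_cast hr)

theorem differentiableOn (hr : 1 ≤ r) (hh : IsDiffeo r M N h) : DifferentiableOn ℝ h M :=
  (hh.contDiffOn_one hr).differentiableOn one_ne_zero

theorem invFunOn_apply (hh : IsDiffeo r M N h) {p : Amb n} (hp : p ∈ M) :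
    Function.invFunOn h M (h p) = p :=
  hh.bijOn.injOn.leftInvOn_invFunOn hp

theorem contDiffOn_comp_sliceParam (hr : 1 ≤ r) (hh : IsDiffeo r M N h) (he : IsSliceChart M e) :
    ContDiffOn ℝ 1 (h ∘ sliceParam e) (sliceDom e) :=
  (hh.contDiffOn_one hr).comp (he.contDiffOn_sliceParam.of_le (by exact_mod_cast le_top))
    fun _ hx => he.sliceParam_mem hx

theorem injective_fderiv_comp_sliceParam (hr : 1 ≤ r) (hh : IsDiffeo r M N h)
    (he : IsSliceChart M e) {x : Euc n} (hx : x ∈ sliceDom e) :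
    Function.Injective (fderiv ℝ (h ∘ sliceParam e) x) := by
  have hp := he.sliceParam_mem hx
  have hd : HasFDerivAt (h ∘ sliceParam e) (fderiv ℝ (h ∘ sliceParam e) x) x :=
    (((hh.contDiffOn_comp_sliceParam hr he).contDiffAt
      (isOpen_sliceDom.mem_nhds hx)).differentiableAt one_ne_zero).hasFDerivAt
  have hg : DifferentiableWithinAt ℝ (Function.invFunOn h M) N (h (sliceParam e x)) :=
    (hh.contDiffOn_inv.of_le (by exact_mod_cast hr : (1 : WithTop ℕ∞) ≤ r)).differentiableOn
      one_ne_zero _ (hh.bijOn.mapsTo hp)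
  have h1 := (HasFDerivWithinAt.comp (g := Function.invFunOn h M) x hg.hasFDerivWithinAt
    (hd.hasFDerivWithinAt (s := sliceDom e))
    (fun y hy => hh.bijOn.mapsTo (he.sliceParam_mem hy))).hasFDerivAt (isOpen_sliceDom.mem_nhds hx)
  have h2 := h1.unique ((he.hasFDerivAt_sliceParam hx).congr_of_eventuallyEq (by
    filter_upwards [isOpen_sliceDom.mem_nhds hx] with y hy
    exact hh.invFunOn_apply (he.sliceParam_mem hy)))
  have h3 := he.injective_fderiv_sliceParam hx
  rw [← h2] at h3
  exact Function.Injective.of_comp h3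

variable (hn : 1 ≤ n) (hM : IsClosedHypersurface n M) (hN : IsClosedHypersurface n N) (hr : 1 ≤ r)
include hn hM hN hr

theorem jacobian_ne_zero (hh : IsDiffeo r M N h) {p : Amb n} (hp : p ∈ M) :
    jacobian M N h p ≠ 0 := by
  obtain ⟨e, he, hpe⟩ := hM.exists_isSliceChart hp
  have hx := he.fst_mem_sliceDom hp hpe
  have key := he.abs_jacobian_mul_normDet hn hM hN hx hh.bijOn.mapsTo
    (hh.differentiableOn hr _ (he.sliceParam_mem hx))
  have hpos := LinearMap.normDet_pos (hh.injective_fderiv_comp_sliceParam hr he hx)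
  rw [he.sliceParam_fst hp hpe] at key
  intro h0
  rw [h0, abs_zero, zero_mul] at key
  exact hpos.ne key

theorem continuousOn_abs_jacobian (hh : IsDiffeo r M N h) :
    ContinuousOn (fun p => |jacobian M N h p|) M := by
  intro p hp
  obtain ⟨e, he, hpe⟩ := hM.exists_isSliceChart hp
  have hx := he.fst_mem_sliceDom hp hpe
  set J : Euc n → ℝ := fun x =>
    (fderiv ℝ (h ∘ sliceParam e) x : Euc n →ₗ[ℝ] Amb n).normDet / sliceDensity e x
  have hJ : ContinuousAt J (e p).1 := by
    refine ContinuousAt.div ?_ ?_ (he.sliceDensity_pos hx).ne'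
    · exact continuous_normDet.continuousAt.comp
        ((((hh.contDiffOn_comp_sliceParam hr he).continuousOn_fderiv_of_isOpen isOpen_sliceDom
          le_rfl).continuousAt (isOpen_sliceDom.mem_nhds hx)))
    · exact he.contDiffOn_sliceDensity.continuousOn.continuousAt (isOpen_sliceDom.mem_nhds hx)
  have heq : ∀ q ∈ M, q ∈ e.source → |jacobian M N h q| = J (e q).1 := by
    intro q hq hqe
    have hy := he.fst_mem_sliceDom hq hqe
    have key := he.abs_jacobian_mul_normDet hn hM hN hy hh.bijOn.mapsTo
      (hh.differentiableOn hr _ (he.sliceParam_mem hy))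
    rw [he.sliceParam_fst hq hqe] at key
    exact (eq_div_iff (he.sliceDensity_pos hy).ne').2 key
  have hc : ContinuousWithinAt (fun q => J (e q).1) M p :=
    (ContinuousAt.comp (f := fun q => (e q).1) hJ
      (continuous_fst.continuousAt.comp (e.continuousAt hpe))).continuousWithinAt
  refine hc.congr_of_eventuallyEq ?_ (heq p hp hpe)
  filter_upwards [self_mem_nhdsWithin, mem_nhdsWithin_of_mem_nhds (e.open_source.mem_nhds hpe)]
    with q hq hqe using heq q hq hqe

theorem aemeasurable_abs_jacobian (hh : IsDiffeo r M N h) :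
    AEMeasurable (fun p => |jacobian M N h p|)
      ((Measure.euclideanHausdorffMeasure n).restrict M) :=
  (hh.continuousOn_abs_jacobian hn hM hN hr).aemeasurable hM.isCompact.measurableSet

/-- The area formula for a diffeomorphism of hypersurfaces, by comparing locally the area formulas
for a slice parametrization and for its composition with the diffeomorphism. -/
theorem measure_image (hh : IsDiffeo r M N h) {E : Set (Amb n)} (hE : E ⊆ M)
    (hEm : MeasurableSet E) : (Measure.euclideanHausdorffMeasure n) (h '' E) =
      ∫⁻ p in E, ENNReal.ofReal |jacobian M N h p| ∂(Measure.euclideanHausdorffMeasure n) := by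
  have hcont : ContinuousOn h M := hh.contDiffOn.continuousOn
  have hinj := hh.bijOn.injOn
  have hloc : ∀ p ∈ M, ∃ U ∈ 𝓝[M] p, ∀ E ⊆ U ∩ M, MeasurableSet E →
      (Measure.euclideanHausdorffMeasure n) (h '' E) =
      ∫⁻ p in E, ENNReal.ofReal |jacobian M N h p| ∂(Measure.euclideanHausdorffMeasure n) := by
    intro p hp
    obtain ⟨e, he, hpe⟩ := hM.exists_isSliceChart hp
    refine ⟨e.source, mem_nhdsWithin_of_mem_nhds (e.open_source.mem_nhds hpe), fun E hE hEm => ?_⟩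
    set s : Set (Euc n) := Subtype.val '' ((sliceDom e).domRestrict (sliceParam e) ⁻¹' E) with hs
    have hsD : s ⊆ sliceDom e := by simp [hs]
    have hsm : MeasurableSet s :=
      (MeasurableEmbedding.subtype_coe isOpen_sliceDom.measurableSet).measurableSet_image.2
        ((he.measurableEmbedding_sliceParam le_rfl isOpen_sliceDom.measurableSet).measurable hEm)
    have himg : sliceParam e '' s = E := by
      ext q
      constructor
      · rintro ⟨_, ⟨x, hx, rfl⟩, rfl⟩
        exact hx
      · intro hq
        have hx := he.fst_mem_sliceDom (hE hq).2 (hE hq).1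
        have hxq := he.sliceParam_fst (hE hq).2 (hE hq).1
        exact ⟨(e q).1, ⟨⟨_, hx⟩, by simpa [hxq] using hq, rfl⟩, hxq⟩
    rw [← himg, he.lintegral_image_sliceParam hsD hsm, ← image_comp,
      euclideanHausdorffMeasure_image_eq_lintegral isOpen_sliceDom
        (hh.contDiffOn_comp_sliceParam hr he)
        (hinj.comp injOn_sliceParam fun x hx => he.sliceParam_mem hx)
        (fun x hx => hh.injective_fderiv_comp_sliceParam hr he hx) hsm hsD]
    refine setLIntegral_congr_fun hsm fun x hx => ?_
    have key := he.abs_jacobian_mul_normDet hn hM hN (hsD hx) hh.bijOn.mapsTo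
      (hh.differentiableOn hr _ (he.sliceParam_mem (hsD hx)))
    rw [← key, mul_comm, ENNReal.ofReal_mul (LinearMap.normDet_nonneg _)]
    rfl
  refine le_antisymm ?_ ?_
  · refine setFunction_le_of_locally_le
      (α := fun t => (Measure.euclideanHausdorffMeasure n) (h '' t))
      (β := fun t => ∫⁻ p in t, ENNReal.ofReal |jacobian M N h p|
        ∂(Measure.euclideanHausdorffMeasure n))
      (by simp) (fun t => ?_) (fun t htm _ htd => (lintegral_iUnion htm htd _).ge)
      (fun x hx => ?_) hEm hE
    · simp only [image_iUnion]
      exact measure_iUnion_le _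
    · obtain ⟨U, hU, h⟩ := hloc x hx
      exact ⟨U, hU, fun t ht htm => (h t ht htm).le⟩
  · refine setFunction_le_of_locally_le
      (α := fun t => ∫⁻ p in t, ENNReal.ofReal |jacobian M N h p|
        ∂(Measure.euclideanHausdorffMeasure n))
      (β := fun t => (Measure.euclideanHausdorffMeasure n) (h '' t))
      (by simp) (fun t => lintegral_iUnion_le _ _) (fun t htm htV htd => ?_) (fun x hx => ?_) hEm hE
    · simp only [image_iUnion]
      rw [measure_iUnion (fun i j hij => ?_)
        (fun i => (htm i).image_of_continuousOn_injOn (hcont.mono (htV i)) (hinj.mono (htV i)))]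
      exact disjoint_iff_inter_eq_empty.2 (by
        rw [← hinj.image_inter (htV i) (htV j), (htd hij).inter_eq, image_empty])
    · obtain ⟨U, hU, h⟩ := hloc x hx
      exact ⟨U, hU, fun t ht htm => (h t ht htm).ge⟩

/-- Change of variables under a diffeomorphism of hypersurfaces. -/
theorem integral_comp (hh : IsDiffeo r M N h) (g : Amb n → ℝ) :
    ∫ y, g y ∂(volMeasure N) = ∫ x, |jacobian M N h x| * g (h x) ∂(volMeasure M) := by
  have key := integral_image_eq_of_measure_image (ν := Measure.euclideanHausdorffMeasure n)
    hM.isCompact.measurableSet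
    (hh.contDiffOn.continuousOn.measurableEmbedding hM.isCompact.measurableSet hh.bijOn.injOn)
    (hh.aemeasurable_abs_jacobian hn hM hN hr) (fun _ _ => abs_nonneg _)
    (fun E hE hEm => hh.measure_image hn hM hN hr hE hEm) g
  rwa [hh.bijOn.image_eq] at key

theorem integral_abs_jacobian (hh : IsDiffeo r M N h) :
    ∫ x, |jacobian M N h x| ∂(volMeasure M) = Vol N := by
  have := hh.integral_comp hn hM hN hr fun _ => 1
  simp only [integral_const, smul_eq_mul, mul_one] at this
  rw [← this, Vol]

end IsDiffeo

end ChangeOfVariables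

/-! ### Composition of diffeomorphisms and the distortion functional -/

section Distortion

variable {n : ℕ} {M N P : Set (Amb n)} {h k : Amb n → Amb n} {r : ℕ∞}

theorem invFunOn_eqOn_of_rightInvOn {α β : Type*} [Nonempty α] {f : α → β} {g : β → α} {s : Set α}
    {t : Set β} (hf : BijOn f s t) (hg : MapsTo g t s) (hfg : ∀ y ∈ t, f (g y) = y) :
    EqOn (Function.invFunOn f s) g t := fun y hy => by
  have hex : ∃ a ∈ s, f a = y := ⟨g y, hg hy, hfg y hy⟩
  exact hf.injOn (Function.invFunOn_mem hex) (hg hy)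
    ((Function.invFunOn_eq hex).trans (hfg y hy).symm)

namespace IsDiffeo

theorem of_rightInvOn {g : Amb n → Amb n} (hh : BijOn h M N) (hg : MapsTo g N M)
    (hhg : ∀ y ∈ N, h (g y) = y) (hhc : ContDiffOn ℝ r h M) (hgc : ContDiffOn ℝ r g N) :
    IsDiffeo r M N h :=
  ⟨hh, hhc, hgc.congr (invFunOn_eqOn_of_rightInvOn hh hg hhg)⟩

theorem apply_invFunOn (hh : IsDiffeo r M N h) {y : Amb n} (hy : y ∈ N) :
    h (Function.invFunOn h M y) = y :=
  Function.invFunOn_eq (hh.bijOn.surjOn hy)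

theorem invFunOn_mem (hh : IsDiffeo r M N h) {y : Amb n} (hy : y ∈ N) :
    Function.invFunOn h M y ∈ M :=
  Function.invFunOn_mem (hh.bijOn.surjOn hy)

theorem symm (hh : IsDiffeo r M N h) : IsDiffeo r N M (Function.invFunOn h M) := by
  refine of_rightInvOn ⟨fun y hy => hh.invFunOn_mem hy, fun y hy z hz hyz => ?_, fun x hx => ?_⟩
    hh.bijOn.mapsTo (fun x hx => hh.invFunOn_apply hx) hh.contDiffOn_inv hh.contDiffOn
  · rw [← hh.apply_invFunOn hy, hyz, hh.apply_invFunOn hz]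
  · exact ⟨h x, hh.bijOn.mapsTo hx, hh.invFunOn_apply hx⟩

theorem comp (hk : IsDiffeo r N P k) (hh : IsDiffeo r M N h) : IsDiffeo r M P (k ∘ h) :=
  of_rightInvOn (g := Function.invFunOn h M ∘ Function.invFunOn k N) (hk.bijOn.comp hh.bijOn)
    (fun _ hy => hh.invFunOn_mem (hk.invFunOn_mem hy))
    (fun y hy => by
      simp only [Function.comp_apply]
      rw [hh.apply_invFunOn (hk.invFunOn_mem hy), hk.apply_invFunOn hy])
    (hk.contDiffOn.comp hh.contDiffOn hh.bijOn.mapsTo)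
    (hh.contDiffOn_inv.comp hk.contDiffOn_inv fun _ hy => hk.invFunOn_mem hy)

variable (hn : 1 ≤ n) (hM : IsClosedHypersurface n M) (hN : IsClosedHypersurface n N) (hr : 1 ≤ r)
include hn hM hN hr

theorem integrable_sq_jacobian (hh : IsDiffeo r M N h) :
    Integrable (fun p => jacobian M N h p ^ 2) (volMeasure M) := by
  simp only [← sq_abs (jacobian M N h _)]
  exact hM.integrable ((hh.continuousOn_abs_jacobian hn hM hN hr).pow 2)

theorem integral_sq_sub (hh : IsDiffeo r M N h) (c : ℝ) :
    ∫ p, (|jacobian M N h p| - c) ^ 2 ∂(volMeasure M) =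
      ∫ p, jacobian M N h p ^ 2 ∂(volMeasure M) - 2 * c * Vol N + c ^ 2 * Vol M := by
  have := hM.isFiniteMeasure
  have h1 := hM.integrable (hh.continuousOn_abs_jacobian hn hM hN hr)
  have h2 := hh.integrable_sq_jacobian hn hM hN hr
  have h3 : ∀ p, (|jacobian M N h p| - c) ^ 2 =
      jacobian M N h p ^ 2 - 2 * c * |jacobian M N h p| + c ^ 2 := fun p => by
    rw [← sq_abs (jacobian M N h p)]
    ring
  have h4 : Integrable (fun p => jacobian M N h p ^ 2 - 2 * c * |jacobian M N h p|)
      (volMeasure M) := h2.sub (h1.const_mul _)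
  simp only [h3]
  rw [integral_add h4 (integrable_const _),
    integral_sub h2 (h1.const_mul _), integral_const_mul, integral_const,
    hh.integral_abs_jacobian hn hM hN hr, smul_eq_mul, mul_comm (Measure.real _ _)]
  rfl

theorem Phi1_eq (hh : IsDiffeo r M N h) :
    Phi1 M N h = ∫ p, jacobian M N h p ^ 2 ∂(volMeasure M) - 2 * Vol N + Vol M := by
  have := hh.integral_sq_sub hn hM hN hr 1
  rw [Phi1, this]
  ring

/-- Among diffeomorphisms the sum of squares of the Jacobian is at least the value for a constant
Jacobian. -/
theorem div_le_integral_sq_jacobian (hh : IsDiffeo r M N h) :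
    Vol N ^ 2 / Vol M ≤ ∫ p, jacobian M N h p ^ 2 ∂(volMeasure M) := by
  have h1 := hh.integral_sq_sub hn hM hN hr (Vol N / Vol M)
  have h2 : 0 ≤ ∫ p, (|jacobian M N h p| - Vol N / Vol M) ^ 2 ∂(volMeasure M) :=
    integral_nonneg fun p => sq_nonneg _
  have hV := hM.Vol_pos
  have h3 : 2 * (Vol N / Vol M) * Vol N - (Vol N / Vol M) ^ 2 * Vol M = Vol N ^ 2 / Vol M := by
    field_simp
    ring
  linarith

theorem integral_sq_jacobian_of_const (hh : IsDiffeo r M N h) {c : ℝ}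
    (hc : ∀ p ∈ M, |jacobian M N h p| = c) :
    c = Vol N / Vol M ∧ ∫ p, jacobian M N h p ^ 2 ∂(volMeasure M) = Vol N ^ 2 / Vol M := by
  have hV := hM.Vol_pos
  have h1 : ∫ p, |jacobian M N h p| ∂(volMeasure M) = c * Vol M := by
    rw [volMeasure, setIntegral_congr_fun hM.isCompact.measurableSet fun p hp => hc p hp,
      integral_const, smul_eq_mul, mul_comm]
    rfl
  have h2 : ∫ p, jacobian M N h p ^ 2 ∂(volMeasure M) = c ^ 2 * Vol M := by
    simp only [← sq_abs (jacobian M N h _)]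
    rw [volMeasure, setIntegral_congr_fun (g := fun _ => c ^ 2) hM.isCompact.measurableSet
      fun p hp => by simp only [hc p hp], integral_const, smul_eq_mul, mul_comm]
    rfl
  rw [hh.integral_abs_jacobian hn hM hN hr] at h1
  refine ⟨by rw [h1, mul_div_cancel_right₀ _ hV.ne'], ?_⟩
  rw [h2, h1]
  field_simp

end IsDiffeo

/-- A diffeomorphism with constant Jacobian minimizes the distortion. -/
theorem Phi1_le_of_abs_jacobian_const (hn : 1 ≤ n) (hM : IsClosedHypersurface n M)
    (hN : IsClosedHypersurface n N) (hr : 1 ≤ r) (hh : IsDiffeo r M N h) (hk : IsDiffeo r M N k)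
    {c : ℝ} (hc : ∀ p ∈ M, |jacobian M N h p| = c) : Phi1 M N h ≤ Phi1 M N k := by
  rw [hh.Phi1_eq hn hM hN hr, hk.Phi1_eq hn hM hN hr,
    (hh.integral_sq_jacobian_of_const hn hM hN hr hc).2]
  linarith [hk.div_le_integral_sq_jacobian hn hM hN hr]

theorem IsMorph.isDiffeo_transition {F : ℝ → Amb n → Amb n} (hF : IsMorph r M N F) {s t : ℝ}
    (hs : s ∈ Icc (0 : ℝ) 1) (ht : t ∈ Icc (0 : ℝ) 1) :
    IsDiffeo r (F s '' M) (F t '' M) (transition M F s t) :=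
  (hF.isDiffeo t ht).comp (hF.isDiffeo s hs).symm

theorem IsMorph.jacobian_transition (hn : 1 ≤ n) (hM : IsClosedHypersurface n M) (hr : 1 ≤ r)
    {F : ℝ → Amb n → Amb n} (hF : IsMorph r M N F) {s t : ℝ}
    (hs : s ∈ Icc (0 : ℝ) 1) (ht : t ∈ Icc (0 : ℝ) 1) {m : Amb n} (hm : m ∈ M) :
    jacobian M (F t '' M) (F t) m =
      jacobian (F s '' M) (F t '' M) (transition M F s t) (F s m) *
        jacobian M (F s '' M) (F s) m := by
  have hds := hF.isDiffeo s hs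
  have hT := hF.isDiffeo_transition hs ht
  rw [← jacobian_comp hn hM (hF.isClosedHypersurface s hs) hds.bijOn.mapsTo hm
    (hds.differentiableOn hr m hm) (hT.differentiableOn hr _ (mem_image_of_mem _ hm))]
  refine jacobian_congr (fun x hx => ?_) hm
  simp only [Function.comp_apply, transition]
  rw [hds.invFunOn_apply hx]

end Distortion

/-! ### Perturbations of the identity supported in a chart -/

section Perturbation

open scoped NNReal

variable {E : Type*} [NormedAddCommGroup E] [NormedSpace ℝ E]

theorem hasFDerivAt_add_smul_bump {ζ : E → ℝ} (hζ : ContDiff ℝ ∞ ζ) (v : E) (ε : ℝ) (x : E) :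
    HasFDerivAt (fun x => x + ε • ζ x • v)
      (ContinuousLinearMap.id ℝ E + ε • (fderiv ℝ ζ x).smulRight v) x :=
  (hasFDerivAt_id x).add
    (((hζ.differentiable (by simp) x).hasFDerivAt.smul_const v).const_smul ε)

variable [FiniteDimensional ℝ E]

theorem det_id_add_smulRight (ℓ : E →L[ℝ] ℝ) (v : E) (ε : ℝ) :
    (ContinuousLinearMap.id ℝ E + ε • ℓ.smulRight v).det = 1 + ε * ℓ v := by
  have h := LinearMap.transvection.det (ℓ : E →ₗ[ℝ] ℝ) (ε • v)
  have h2 : ((ContinuousLinearMap.id ℝ E + ε • ℓ.smulRight v : E →L[ℝ] E) : E →ₗ[ℝ] E) =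
      LinearMap.transvection (ℓ : E →ₗ[ℝ] ℝ) (ε • v) := by
    ext x
    simp [LinearMap.transvection.apply, smul_comm ε]
  rw [ContinuousLinearMap.det, h2, h]
  simp

/-- Moving points by a small multiple of `ζ v` in a fixed direction `v` is a diffeomorphism. -/
theorem exists_homeomorph_add_smul_bump {ζ : E → ℝ} (hζ : ContDiff ℝ ∞ ζ)
    (hc : HasCompactSupport ζ) (v : E) :
    ∃ ε₀ > 0, ∀ ε : ℝ, |ε| < ε₀ → ∃ θ : E ≃ₜ E, (∀ x, θ x = x + ε • ζ x • v) ∧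
      ContDiff ℝ ∞ θ ∧ ContDiff ℝ ∞ θ.symm ∧ ∀ x, 0 < 1 + ε * fderiv ℝ ζ x v := by
  have : CompleteSpace E := FiniteDimensional.complete ℝ E
  obtain ⟨C, hC⟩ := hζ.lipschitzWith_of_hasCompactSupport hc (by simp)
  refine ⟨(C * ‖v‖ + 1)⁻¹, by positivity, fun ε hε => ?_⟩
  have hsmall : |ε| * (C * ‖v‖) < 1 := by
    have h1 : |ε| * (C * ‖v‖ + 1) < 1 := by
      rwa [← lt_div_iff₀ (by positivity), one_div]
    have h2 : 0 ≤ |ε| := abs_nonneg ε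
    linarith
  have hpos : ∀ x, 0 < 1 + ε * fderiv ℝ ζ x v := by
    intro x
    have h1 : |ε * fderiv ℝ ζ x v| ≤ |ε| * (C * ‖v‖) := by
      rw [abs_mul]
      refine mul_le_mul_of_nonneg_left ?_ (abs_nonneg ε)
      rw [← Real.norm_eq_abs]
      exact ((fderiv ℝ ζ x).le_opNorm v).trans (by
        gcongr
        exact norm_fderiv_le_of_lipschitz ℝ hC)
    linarith [neg_abs_le (ε * fderiv ℝ ζ x v)]
  set c : ℝ≥0 := ‖ε‖₊ * (C * ‖v‖₊) with hcdef
  have happ : ApproximatesLinearOn (fun x => x + ε • ζ x • v)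
      ((ContinuousLinearEquiv.refl ℝ E : E ≃L[ℝ] E) : E →L[ℝ] E) univ c := by
    intro x _ y _
    have : x + ε • ζ x • v - (y + ε • ζ y • v) -
        ((ContinuousLinearEquiv.refl ℝ E : E ≃L[ℝ] E) : E →L[ℝ] E) (x - y) =
        ε • (ζ x - ζ y) • v := by
      simp only [ContinuousLinearEquiv.coe_coe, ContinuousLinearEquiv.refl_apply, sub_smul,
        smul_sub]
      abel
    rw [this, norm_smul, norm_smul]
    have h1 := hC.norm_sub_le x y
    have : (c : ℝ) * ‖x - y‖ = ‖ε‖ * ((C * ‖x - y‖) * ‖v‖) := by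
      simp only [hcdef, NNReal.coe_mul, coe_nnnorm]
      ring
    rw [this]
    gcongr
  have hcN : Subsingleton E ∨ c < ‖((ContinuousLinearEquiv.refl ℝ E).symm : E →L[ℝ] E)‖₊⁻¹ := by
    rcases subsingleton_or_nontrivial E with h | h
    · exact Or.inl h
    · right
      have h1 : ‖((ContinuousLinearEquiv.refl ℝ E).symm : E →L[ℝ] E)‖₊ = 1 := by
        ext
        exact ContinuousLinearMap.norm_id
      rw [h1, inv_one, ← NNReal.coe_lt_coe]
      simpa [hcdef] using hsmall
  set θ : E ≃ₜ E := happ.toHomeomorph _ hcN with hθ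
  have hθx : ∀ x, θ x = x + ε • ζ x • v := fun x => rfl
  have hθc : ContDiff ℝ ∞ θ := by
    have : ContDiff ℝ ∞ fun x => x + ε • ζ x • v := by fun_prop
    exact this
  have hdet : ∀ x, (ContinuousLinearMap.id ℝ E + ε • (fderiv ℝ ζ x).smulRight v).det ≠ 0 := by
    intro x
    rw [det_id_add_smulRight]
    exact (hpos x).ne'
  refine ⟨θ, hθx, hθc, ?_, hpos⟩
  refine θ.contDiff_symm
    (f₀' := fun x => ContinuousLinearMap.toContinuousLinearEquivOfDetNeZero _ (hdet x))
    (fun x => ?_) hθc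
  rw [ContinuousLinearMap.coe_toContinuousLinearEquivOfDetNeZero]
  exact hasFDerivAt_add_smul_bump hζ v ε x

end Perturbation

section Lift

variable {n : ℕ} {M N : Set (Amb n)} {e : OpenPartialHomeomorph (Amb n) (Euc n × ℝ)} {r : ℕ∞}

open Classical in
/-- The self-map of a hypersurface given in a slice chart by `θ`, and by the identity outside of the
domain of the chart. -/
noncomputable def chartLift (e : OpenPartialHomeomorph (Amb n) (Euc n × ℝ)) (θ : Euc n → Euc n)
    (p : Amb n) : Amb n :=
  if p ∈ e.source then sliceParam e (θ (e p).1) else p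

theorem chartLift_of_mem {θ : Euc n → Euc n} {p : Amb n} (hp : p ∈ e.source) :
    chartLift e θ p = sliceParam e (θ (e p).1) := by simp [chartLift, hp]

theorem chartLift_of_notMem {θ : Euc n → Euc n} {p : Amb n} (hp : p ∉ e.source) :
    chartLift e θ p = p := by simp [chartLift, hp]

theorem chartLift_sliceParam {θ : Euc n → Euc n} {x : Euc n} (hx : x ∈ sliceDom e) :
    chartLift e θ (sliceParam e x) = sliceParam e (θ x) := by
  rw [chartLift_of_mem (sliceParam_mem_source hx), apply_sliceParam hx]

namespace IsSliceChart

theorem mapsTo_chartLift (he : IsSliceChart M e) {θ : Euc n → Euc n}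
    (hθ : MapsTo θ (sliceDom e) (sliceDom e)) : MapsTo (chartLift e θ) M M := by
  intro p hp
  by_cases hpe : p ∈ e.source
  · rw [chartLift_of_mem hpe]
    exact he.sliceParam_mem (hθ (he.fst_mem_sliceDom hp hpe))
  · rwa [chartLift_of_notMem hpe]

theorem chartLift_chartLift (he : IsSliceChart M e) {θ θ' : Euc n → Euc n}
    (hθ' : MapsTo θ' (sliceDom e) (sliceDom e)) (h : ∀ x, θ (θ' x) = x) {p : Amb n} (hp : p ∈ M) :
    chartLift e θ (chartLift e θ' p) = p := by
  by_cases hpe : p ∈ e.source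
  · have hx := he.fst_mem_sliceDom hp hpe
    rw [chartLift_of_mem hpe, chartLift_sliceParam (hθ' hx), h, he.sliceParam_fst hp hpe]
  · rw [chartLift_of_notMem hpe, chartLift_of_notMem hpe]

theorem chartLift_eventuallyEq_id (he : IsSliceChart M e) {θ : Euc n → Euc n} {K : Set (Euc n)}
    (hK : IsCompact K) (hKD : K ⊆ sliceDom e) (hθK : ∀ x ∉ K, θ x = x) {p : Amb n}
    (hpK : p ∉ sliceParam e '' K) : chartLift e θ =ᶠ[𝓝[M] p] id := by
  have hcl : IsClosed (sliceParam e '' K) :=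
    (hK.image_of_continuousOn (he.contDiffOn_sliceParam.continuousOn.mono hKD)).isClosed
  filter_upwards [self_mem_nhdsWithin, mem_nhdsWithin_of_mem_nhds (hcl.isOpen_compl.mem_nhds hpK)]
    with q hq hqK
  by_cases hqe : q ∈ e.source
  · have hx := he.sliceParam_fst hq hqe
    rw [chartLift_of_mem hqe, hθK _ fun h => hqK ⟨_, h, hx⟩, hx, id]
  · rw [chartLift_of_notMem hqe, id]

theorem contDiffOn_chartLift (he : IsSliceChart M e) {θ : Euc n → Euc n} (hθ : ContDiff ℝ ∞ θ)
    (hθD : MapsTo θ (sliceDom e) (sliceDom e)) {K : Set (Euc n)} (hK : IsCompact K)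
    (hKD : K ⊆ sliceDom e) (hθK : ∀ x ∉ K, θ x = x) : ContDiffOn ℝ ∞ (chartLift e θ) M := by
  intro p hp
  by_cases hpe : p ∈ e.source
  · have h1 : ContDiffAt ℝ ∞ (fun q => sliceParam e (θ (e q).1)) p :=
      ContDiffAt.comp (f := fun q => θ (e q).1) p
        (he.contDiffAt_sliceParam (hθD (he.fst_mem_sliceDom hp hpe)))
        (hθ.contDiffAt.comp p (contDiff_fst.contDiffAt.comp p (he.contDiffAt hpe)))
    refine (h1.congr_of_eventuallyEq ?_).contDiffWithinAt
    filter_upwards [e.open_source.mem_nhds hpe] with q hq using chartLift_of_mem hq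
  · have hpK : p ∉ sliceParam e '' K := by
      rintro ⟨x, hx, rfl⟩
      exact hpe (sliceParam_mem_source (hKD hx))
    exact contDiffWithinAt_id.congr_of_eventuallyEq
      (he.chartLift_eventuallyEq_id hK hKD hθK hpK) (chartLift_of_notMem hpe)

theorem isDiffeo_chartLift (he : IsSliceChart M e) {θ : Euc n ≃ₜ Euc n} (hθ : ContDiff ℝ ∞ θ)
    (hθ' : ContDiff ℝ ∞ θ.symm) {K : Set (Euc n)} (hK : IsCompact K) (hKD : K ⊆ sliceDom e)
    (hθK : ∀ x ∉ K, θ x = x) : IsDiffeo r M M (chartLift e θ) := by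
  have hθK' : ∀ x ∉ K, θ.symm x = x := fun x hx => by
    rw [θ.symm_apply_eq, hθK x hx]
  have key : ∀ θ : Euc n ≃ₜ Euc n, (∀ x ∉ K, θ x = x) → MapsTo θ (sliceDom e) (sliceDom e) := by
    intro θ hθK x hx
    by_contra h
    have h1 : θ (θ x) = θ x := hθK _ fun hK' => h (hKD hK')
    rw [θ.injective h1] at h
    exact h hx
  have hD := key θ hθK
  have hD' := key θ.symm hθK'
  have h1 := fun p (hp : p ∈ M) => he.chartLift_chartLift (θ := θ) hD' θ.apply_symm_apply hp
  have h2 := fun p (hp : p ∈ M) => he.chartLift_chartLift (θ := θ.symm) hD θ.symm_apply_apply hp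
  refine IsDiffeo.of_rightInvOn (g := chartLift e θ.symm) ⟨he.mapsTo_chartLift hD, ?_, ?_⟩
    (he.mapsTo_chartLift hD') h1 ((he.contDiffOn_chartLift hθ hD hK hKD hθK).of_le ?_)
    ((he.contDiffOn_chartLift hθ' hD' hK hKD hθK').of_le ?_)
  · exact LeftInvOn.injOn h2
  · exact fun p hp => ⟨_, he.mapsTo_chartLift hD' hp, h1 p hp⟩
  · exact_mod_cast le_top
  · exact_mod_cast le_top

end IsSliceChart

/-- The chain rule makes the Jacobian of the identity idempotent, and it is nonzero. -/
theorem jacobian_id (hn : 1 ≤ n) (hM : IsClosedHypersurface n M) {p : Amb n} (hp : p ∈ M) :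
    jacobian M M id p = 1 := by
  have hid : IsDiffeo 1 M M id := IsDiffeo.of_rightInvOn (g := id) (bijOn_id M) (mapsTo_id M)
    (fun _ _ => rfl) contDiffOn_id contDiffOn_id
  have h0 := hid.jacobian_ne_zero hn hM hM le_rfl hp
  have h1 := jacobian_comp (P := M) (k := id) hn hM hM (mapsTo_id M) hp differentiableWithinAt_id
    differentiableWithinAt_id
  exact (mul_left_cancel₀ h0 (by simpa using h1)).symm

theorem jacobian_eq_one_of_eventuallyEq_id (hn : 1 ≤ n) (hM : IsClosedHypersurface n M)
    {h : Amb n → Amb n} {p : Amb n} (hp : p ∈ M) (hh : h =ᶠ[𝓝[M] p] id) :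
    jacobian M M h p = 1 := by
  have hpp : h p = id p := hh.eq_of_nhdsWithin hp
  have : pullbackVolForm M M h p = pullbackVolForm M M id p := by
    rw [pullbackVolForm, pullbackVolForm, hh.fderivWithin_eq hpp, hpp]
  rw [← jacobian_id hn hM hp, jacobian, jacobian, this]

theorem IsSliceChart.abs_jacobian_chartLift (hn : 1 ≤ n) (hM : IsClosedHypersurface n M)
    (he : IsSliceChart M e) {θ : Euc n → Euc n} (hθ : ContDiff ℝ ∞ θ)
    (hθD : MapsTo θ (sliceDom e) (sliceDom e))
    (hd : IsDiffeo 1 M M (chartLift e θ)) {x : Euc n} (hx : x ∈ sliceDom e) :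
    |jacobian M M (chartLift e θ) (sliceParam e x)| =
      sliceDensity e (θ x) * |(fderiv ℝ θ x).det| / sliceDensity e x := by
  have key := he.abs_jacobian_mul_normDet hn hM hM hx hd.bijOn.mapsTo
    (hd.differentiableOn le_rfl _ (he.sliceParam_mem hx))
  rw [eq_div_iff (he.sliceDensity_pos hx).ne']
  have h1 : HasFDerivAt (chartLift e θ ∘ sliceParam e)
      (fderiv ℝ (sliceParam e) (θ x) ∘L fderiv ℝ θ x) x := by
    refine ((he.hasFDerivAt_sliceParam (hθD hx)).comp x
      (hθ.differentiable (by simp) x).hasFDerivAt).congr_of_eventuallyEq ?_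
    filter_upwards [isOpen_sliceDom.mem_nhds hx] with y hy using chartLift_sliceParam hy
  have h2 : ((fderiv ℝ (sliceParam e) (θ x) ∘L fderiv ℝ θ x : Euc n →L[ℝ] Amb n) :
      Euc n →ₗ[ℝ] Amb n) = (fderiv ℝ (sliceParam e) (θ x) : Euc n →ₗ[ℝ] Amb n) ∘ₗ
        (fderiv ℝ θ x : Euc n →ₗ[ℝ] Euc n) := rfl
  rw [h1.fderiv, h2, LinearMap.normDet_comp_of_finrank_eq _ _ rfl,
    LinearMap.normDet_eq_abs_det] at key
  exact key

end Lift

/-! ### Continuous functions with vanishing weak derivative -/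

section WeakDerivative

/-- Differentiation under the integral over a compact set, for a family that is `C¹` in the
parameter near that set. -/
theorem hasDerivAt_integral_of_isCompact {E : Type*} [NormedAddCommGroup E] [MeasurableSpace E]
    [BorelSpace E] [SecondCountableTopology E] {μ : Measure E} [IsFiniteMeasureOnCompacts μ]
    {K : Set E} (hK : IsCompact K) {G : E → ℝ} (hG : ContinuousOn G K) {f f' : ℝ → E → ℝ} {s₀ : ℝ}
    {O : Set (ℝ × E)} (hO : IsOpen O) (hKO : ∀ x ∈ K, (s₀, x) ∈ O)
    (hf : ContinuousOn (fun z : ℝ × E => f z.1 z.2) O)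
    (hf' : ContinuousOn (fun z : ℝ × E => f' z.1 z.2) O)
    (hd : ∀ z ∈ O, HasDerivAt (fun s => f s z.2) (f' z.1 z.2) z.1) :
    HasDerivAt (fun s => ∫ x in K, f s x * G x ∂μ) (∫ x in K, f' s₀ x * G x ∂μ) s₀ := by
  obtain ⟨u, v, hu, -, hsu, hKv, huv⟩ := generalized_tube_lemma (isCompact_singleton (x := s₀)) hK hO
    (by rintro ⟨s, x⟩ ⟨rfl, hx⟩; exact hKO x hx)
  obtain ⟨δ, hδ, hδu⟩ := Metric.nhds_basis_closedBall.mem_iff.1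
    (hu.mem_nhds (hsu rfl))
  have hsub : Metric.closedBall s₀ δ ×ˢ K ⊆ O :=
    (prod_mono hδu hKv).trans huv
  obtain ⟨C, hC⟩ := ((isCompact_closedBall s₀ δ).prod hK).exists_bound_of_continuousOn
    (hf'.mono hsub)
  obtain ⟨C', hC'⟩ := hK.exists_bound_of_continuousOn hG
  have hcont : ∀ {g : ℝ → E → ℝ}, ContinuousOn (fun z : ℝ × E => g z.1 z.2) O →
      ∀ s ∈ Metric.closedBall s₀ δ, ContinuousOn (fun x => g s x * G x) K := by
    intro g hg s hs
    refine ContinuousOn.mul ?_ hG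
    exact hg.comp (f := fun x => (s, x)) (by fun_prop) fun x hx => hsub ⟨hs, hx⟩
  have hs₀ : s₀ ∈ Metric.closedBall s₀ δ := Metric.mem_closedBall_self hδ.le
  refine (hasDerivAt_integral_of_dominated_loc_of_deriv_le (F := fun s x => f s x * G x)
    (F' := fun s x => f' s x * G x) (bound := fun _ => C * C') (Metric.closedBall_mem_nhds s₀ hδ)
    ?_ ?_ ?_ ?_ ?_ ?_).2
  · filter_upwards [Metric.closedBall_mem_nhds s₀ hδ] with s hs
    exact (hcont hf s hs).aestronglyMeasurable hK.measurableSet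
  · exact (hcont hf s₀ hs₀).integrableOn_compact hK
  · exact (hcont hf' s₀ hs₀).aestronglyMeasurable hK.measurableSet
  · refine (ae_restrict_mem hK.measurableSet).mono fun x hx s hs => ?_
    have h1 : ‖f' s x‖ ≤ C := hC (s, x) ⟨hs, hx⟩
    rw [norm_mul]
    exact mul_le_mul h1 (hC' x hx) (norm_nonneg _) ((norm_nonneg _).trans h1)
  · exact continuousOn_const.integrableOn_compact hK
  · exact (ae_restrict_mem hK.measurableSet).mono fun x hx s hs =>
      (hd (s, x) (hsub ⟨hs, hx⟩)).mul_const (G x)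

/-- A continuous function on an open set whose weak derivative vanishes is locally constant: its
averages against a mollifier do not change when the mollifier is translated. -/
theorem eventually_eq_of_integral_fderiv_mul_eq_zero {E : Type*} [NormedAddCommGroup E]
    [NormedSpace ℝ E] [FiniteDimensional ℝ E] [MeasurableSpace E] [BorelSpace E] {μ : Measure E}
    [μ.IsAddHaarMeasure] {D : Set E} (hD : IsOpen D) {G : E → ℝ}
    (hG : ContinuousOn G D)
    (h : ∀ K ⊆ D, IsCompact K → ∀ ξ : E → ℝ, ContDiff ℝ ∞ ξ → tsupport ξ ⊆ K → ∀ v,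
      ∫ x in K, fderiv ℝ ξ x v * G x ∂μ = 0) {x₀ : E} (hx₀ : x₀ ∈ D) :
    ∀ᶠ y in 𝓝 x₀, G y = G x₀ := by
  have : ProperSpace E := FiniteDimensional.proper ℝ E
  have : SecondCountableTopology E := secondCountable_of_proper
  obtain ⟨R', hR', hball⟩ := Metric.nhds_basis_closedBall.mem_iff.1 (hD.mem_nhds hx₀)
  obtain ⟨R, hR, rfl⟩ : ∃ R > 0, R' = 2 * R := ⟨R' / 2, by linarith, by ring⟩
  set K := Metric.closedBall x₀ (2 * R)
  have hK : IsCompact K := isCompact_closedBall _ _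
  have hGK : ContinuousOn G K := hG.mono hball
  filter_upwards [Metric.ball_mem_nhds x₀ hR] with y hy
  have hx₀R : x₀ ∈ Metric.ball x₀ R := Metric.mem_ball_self hR
  have hcv := convex_ball x₀ R
  refine eq_of_forall_dist_le fun ε hε => ?_
  have hnear : ∀ z ∈ Metric.ball x₀ R, ∃ δ > 0, ∀ x, dist x z < δ → dist (G x) (G z) ≤ ε / 2 := by
    intro z hz
    have hzD : z ∈ D := hball ((Metric.ball_subset_closedBall.trans
      (Metric.closedBall_subset_closedBall (by linarith))) hz)
    obtain ⟨δ, hδ, h⟩ := Metric.continuousAt_iff.1 (hG.continuousAt (hD.mem_nhds hzD)) (ε / 2)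
      (by linarith)
    exact ⟨δ, hδ, fun x hx => (h hx).le⟩
  obtain ⟨δ₁, hδ₁, h₁⟩ := hnear y hy
  obtain ⟨δ₂, hδ₂, h₂⟩ := hnear x₀ hx₀R
  set δ := min R (min δ₁ δ₂)
  have hδ : 0 < δ := lt_min hR (lt_min hδ₁ hδ₂)
  let b : ContDiffBump (0 : E) := ⟨δ / 2, δ, by linarith, by linarith⟩
  set β : E → ℝ := b.normed μ with hβ
  have hβc : ContDiff ℝ ∞ β := b.contDiff_normed
  have hβ0 : ∀ x, δ ≤ ‖x‖ → β x = 0 := by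
    intro x hx
    have : x ∉ Function.support β := by
      rw [hβ, b.support_normed_eq]
      simpa [b] using hx
    simpa using this
  have hβK : ∀ z ∈ Metric.ball x₀ R, ∀ x ∉ K, β (x - z) = 0 := by
    intro z hz x hx
    apply hβ0
    have h3 : 2 * R < dist x x₀ := by simpa [K] using hx
    have h4 : dist z x₀ < R := hz
    have := dist_triangle x z x₀
    rw [← dist_eq_norm]
    linarith [min_le_left R (min δ₁ δ₂)]
  set A : E → ℝ := fun z => ∫ x in K, β (x - z) * G x ∂μ
  -- The averages are close to the values.
  have hA : ∀ z ∈ Metric.ball x₀ R, (∀ x, dist x z < δ → dist (G x) (G z) ≤ ε / 2) →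
      dist (A z) (G z) ≤ ε / 2 := by
    intro z hz hzδ
    have hcβ : ContinuousOn (fun x => β (x - z)) K :=
      (hβc.continuous.comp (continuous_id.sub continuous_const)).continuousOn
    have hone : ∫ x in K, β (x - z) ∂μ = 1 := by
      rw [setIntegral_eq_integral_of_forall_compl_eq_zero (hβK z hz),
        integral_sub_right_eq_self (μ := μ) β z]
      exact b.integral_normed
    have hdiff : A z - G z = ∫ x in K, β (x - z) * (G x - G z) ∂μ := by
      have h3 : ∫ x in K, β (x - z) * (G x - G z) ∂μ =
          ∫ x in K, β (x - z) * G x ∂μ - ∫ x in K, β (x - z) * G z ∂μ := by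
        have h4 : IntegrableOn (fun x => β (x - z) * G x) K μ :=
          (hcβ.mul hGK).integrableOn_compact hK
        have h5 : IntegrableOn (fun x => β (x - z) * G z) K μ :=
          (hcβ.mul continuousOn_const).integrableOn_compact hK
        rw [← integral_sub h4 h5]
        simp only [mul_sub]
      rw [h3, integral_mul_const, hone, one_mul]
    rw [dist_eq_norm, hdiff]
    calc ‖∫ x in K, β (x - z) * (G x - G z) ∂μ‖ ≤ ∫ x in K, β (x - z) * (ε / 2) ∂μ := by
          refine norm_integral_le_of_norm_le
            ((hcβ.mul continuousOn_const).integrableOn_compact hK) (Eventually.of_forall fun x => ?_)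
          have hnn : 0 ≤ β (x - z) := b.nonneg_normed _
          rw [norm_mul, Real.norm_of_nonneg hnn]
          rcases lt_or_ge (dist x z) δ with hxz | hxz
          · exact mul_le_mul_of_nonneg_left (hzδ x hxz) hnn
          · rw [hβ0 _ (by rwa [← dist_eq_norm]), zero_mul, zero_mul]
      _ = ε / 2 := by rw [integral_mul_const, hone, one_mul]
  -- The averages are constant along the segment from `x₀` to `y`.
  have hder : ∀ s ∈ Icc (0 : ℝ) 1,
      HasDerivAt (fun s : ℝ => A (x₀ + s • (y - x₀))) 0 s := by
    intro s hs
    have hz : x₀ + s • (y - x₀) ∈ Metric.ball x₀ R :=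
      hcv.add_smul_sub_mem hx₀R hy hs
    have hd : ∀ z ∈ (univ : Set (ℝ × E)), HasDerivAt (fun s => β (z.2 - (x₀ + s • (y - x₀))))
        (fderiv ℝ β (z.2 - (x₀ + z.1 • (y - x₀))) (-(y - x₀))) z.1 := by
      rintro ⟨s, x⟩ -
      have h3 : HasDerivAt (fun s : ℝ => x - (x₀ + s • (y - x₀))) (-(y - x₀)) s := by
        simpa using (((hasDerivAt_id s).smul_const (y - x₀)).const_add x₀).const_sub x
      exact ((hβc.differentiable (by simp) _).hasFDerivAt).comp_hasDerivAt s h3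
    have h4 := hasDerivAt_integral_of_isCompact (μ := μ) (s₀ := s)
      (f := fun s x => β (x - (x₀ + s • (y - x₀))))
      (f' := fun s x => fderiv ℝ β (x - (x₀ + s • (y - x₀))) (-(y - x₀))) hK hGK isOpen_univ
      (fun _ _ => mem_univ _) (hβc.continuous.comp (by fun_prop)).continuousOn
      (((hβc.continuous_fderiv (by simp)).comp (by fun_prop)).clm_apply
        continuous_const).continuousOn hd
    convert h4 using 1
    set z := x₀ + s • (y - x₀)
    have hts : tsupport (fun x => β (x - z)) ⊆ K := by
      refine closure_minimal (fun x hx => ?_) Metric.isClosed_closedBall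
      by_contra hxK
      exact hx (hβK z hz x hxK)
    have h5 := h K hball hK (fun x => β (x - z)) (hβc.comp (contDiff_id.sub contDiff_const)) hts
      (-(y - x₀))
    rw [← h5]
    refine setIntegral_congr_fun hK.measurableSet fun x _ => ?_
    simp only [fderiv_comp_sub]
  have hconst := constant_of_has_deriv_right_zero
    (fun s hs => (hder s hs).continuousAt.continuousWithinAt)
    (fun s hs => (hder s (Ico_subset_Icc_self hs)).hasDerivWithinAt) 1
    (right_mem_Icc.2 zero_le_one)
  simp only [one_smul, zero_smul, add_zero, add_sub_cancel] at hconst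
  have e1 := hA y hy fun x hx =>
    h₁ x (hx.trans_le ((min_le_right _ _).trans (min_le_left _ _)))
  have e2 := hA x₀ hx₀R fun x hx =>
    h₂ x (hx.trans_le ((min_le_right _ _).trans (min_le_right _ _)))
  rw [hconst] at e1
  calc dist (G y) (G x₀) ≤ dist (G y) (A x₀) + dist (A x₀) (G x₀) := dist_triangle _ _ _
    _ ≤ ε / 2 + ε / 2 := by rw [dist_comm (G y)]; exact add_le_add e1 e2
    _ = ε := by ring

end WeakDerivative

/-! ### Minimizers of the distortion have constant Jacobian -/

section Variation

variable {n : ℕ} {M N : Set (Amb n)} {e : OpenPartialHomeomorph (Amb n) (Euc n × ℝ)}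
  {h : Amb n → Amb n} {r : ℕ∞}

/-- Comparison of a minimizer with its composition with the inverse of a self-diffeomorphism. -/
theorem integral_sq_jacobian_le (hn : 1 ≤ n) (hM : IsClosedHypersurface n M)
    (hN : IsClosedHypersurface n N) (hr : 1 ≤ r) (hh : IsDiffeo r M N h)
    (hmin : ∀ k, IsDiffeo r M N k → Phi1 M N h ≤ Phi1 M N k) {ψ : Amb n → Amb n}
    (hψ : IsDiffeo r M M ψ) :
    ∫ p in M, jacobian M N h p ^ 2 ∂(Measure.euclideanHausdorffMeasure n) ≤
      ∫ p in M, jacobian M N h p ^ 2 / |jacobian M M ψ p|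
        ∂(Measure.euclideanHausdorffMeasure n) := by
  have hk := hh.comp hψ.symm
  set k := h ∘ Function.invFunOn ψ M
  have h1 := hmin k hk
  rw [hh.Phi1_eq hn hM hN hr, hk.Phi1_eq hn hM hN hr,
    hψ.integral_comp hn hM hM hr fun p => jacobian M N k p ^ 2] at h1
  have h2 : ∫ p in M, |jacobian M M ψ p| * jacobian M N k (ψ p) ^ 2
      ∂(Measure.euclideanHausdorffMeasure n) =
      ∫ p in M, jacobian M N h p ^ 2 / |jacobian M M ψ p|
        ∂(Measure.euclideanHausdorffMeasure n) := by
    refine setIntegral_congr_fun hM.isCompact.measurableSet fun p hp => ?_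
    have h3 := jacobian_comp (P := N) hn hM hM hψ.bijOn.mapsTo hp (hψ.differentiableOn hr p hp)
      (hk.differentiableOn hr _ (hψ.bijOn.mapsTo hp))
    have h4 : jacobian M N (k ∘ ψ) p = jacobian M N h p :=
      jacobian_congr (fun q hq => by simp only [k, Function.comp_apply, hψ.invFunOn_apply hq]) hp
    have h5 : |jacobian M M ψ p| ≠ 0 := abs_ne_zero.2 (hψ.jacobian_ne_zero hn hM hM hr hp)
    rw [← h4, h3, eq_div_iff h5, mul_pow, ← sq_abs (jacobian M M ψ p)]
    ring
  rw [volMeasure] at h1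
  linarith

/-- The comparison for a self-diffeomorphism supported in a slice chart, in coordinates. -/
theorem IsSliceChart.integral_le_of_minimal (hn : 1 ≤ n) (hM : IsClosedHypersurface n M)
    (hN : IsClosedHypersurface n N) (hr : 1 ≤ r) (hh : IsDiffeo r M N h)
    (hmin : ∀ k, IsDiffeo r M N k → Phi1 M N h ≤ Phi1 M N k) (he : IsSliceChart M e)
    {θ : Euc n ≃ₜ Euc n} (hθ : ContDiff ℝ ∞ θ) (hθ' : ContDiff ℝ ∞ θ.symm) {K : Set (Euc n)}
    (hK : IsCompact K) (hKD : K ⊆ sliceDom e) (hθK : ∀ x ∉ K, θ x = x) :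
    ∫ x in K, sliceDensity e x * jacobian M N h (sliceParam e x) ^ 2 ≤
      ∫ x in K, sliceDensity e x ^ 2 / (sliceDensity e (θ x) * |(fderiv ℝ θ x).det|) *
        jacobian M N h (sliceParam e x) ^ 2 := by
  have hψ : IsDiffeo r M M (chartLift e θ) := he.isDiffeo_chartLift hθ hθ' hK hKD hθK
  have hψ1 : IsDiffeo 1 M M (chartLift e θ) := he.isDiffeo_chartLift hθ hθ' hK hKD hθK
  have hD : MapsTo θ (sliceDom e) (sliceDom e) := by
    intro x hx
    by_contra h
    have h1 : θ (θ x) = θ x := hθK _ fun hK' => h (hKD hK')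
    rw [θ.injective h1] at h
    exact h hx
  set μ : Measure (Amb n) := Measure.euclideanHausdorffMeasure n with hμ
  set S := sliceParam e '' K with hS
  have hSM : S ⊆ M := by
    rintro _ ⟨x, hx, rfl⟩
    exact he.sliceParam_mem (hKD hx)
  have hSm : MeasurableSet S := (hK.image_of_continuousOn
    (he.contDiffOn_sliceParam.continuousOn.mono hKD)).measurableSet
  have hi1 : IntegrableOn (fun p => jacobian M N h p ^ 2) M μ :=
    hh.integrable_sq_jacobian hn hM hN hr
  have hi2 : IntegrableOn (fun p => jacobian M N h p ^ 2 / |jacobian M M (chartLift e θ) p|) M μ := by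
    simp only [← sq_abs (jacobian M N h _)]
    exact hM.integrable (((hh.continuousOn_abs_jacobian hn hM hN hr).pow 2).div
      (hψ.continuousOn_abs_jacobian hn hM hM hr)
      fun p hp => abs_ne_zero.2 (hψ.jacobian_ne_zero hn hM hM hr hp))
  have hle := integral_sq_jacobian_le hn hM hN hr hh hmin hψ
  have hsplit : ∀ f : Amb n → ℝ, IntegrableOn f M μ →
      ∫ p in M, f p ∂μ = ∫ p in S, f p ∂μ + ∫ p in M \ S, f p ∂μ := fun f hf => by
    rw [← setIntegral_union disjoint_sdiff_right (hM.isCompact.measurableSet.diff hSm)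
      (hf.mono_set hSM) (hf.mono_set sdiff_subset), union_sdiff_cancel hSM]
  rw [hsplit _ hi1, hsplit _ hi2] at hle
  have hout : ∫ p in M \ S, jacobian M N h p ^ 2 / |jacobian M M (chartLift e θ) p| ∂μ =
      ∫ p in M \ S, jacobian M N h p ^ 2 ∂μ := by
    refine setIntegral_congr_fun (hM.isCompact.measurableSet.diff hSm) fun p hp => ?_
    rw [jacobian_eq_one_of_eventuallyEq_id hn hM hp.1
      (he.chartLift_eventuallyEq_id hK hKD hθK hp.2), abs_one, div_one]
  have hle' := le_of_add_le_add_right (hout ▸ hle)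
  rw [hS, he.integral_image_sliceParam hKD hK.measurableSet,
    he.integral_image_sliceParam hKD hK.measurableSet] at hle'
  refine hle'.trans_eq (setIntegral_congr_fun hK.measurableSet fun x hx => ?_)
  rw [he.abs_jacobian_chartLift hn hM hθ hD hψ1 (hKD hx), div_div_eq_mul_div]
  ring

/-- The first variation of the distortion at a minimizer vanishes. The perturbation moves points by
`ε (ξ / ρ) v`, where `ρ` is the volume density of the chart, so that the volume form is distorted by
`1 + ε (∂_v ξ) / ρ` up to second order. -/
theorem IsSliceChart.integral_fderiv_mul_eq_zero (hn : 1 ≤ n) (hM : IsClosedHypersurface n M)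
    (hN : IsClosedHypersurface n N) (hr : 1 ≤ r) (hh : IsDiffeo r M N h)
    (hmin : ∀ k, IsDiffeo r M N k → Phi1 M N h ≤ Phi1 M N k) (he : IsSliceChart M e)
    {K : Set (Euc n)} (hKD : K ⊆ sliceDom e) (hK : IsCompact K) {ξ : Euc n → ℝ}
    (hξ : ContDiff ℝ ∞ ξ) (hξK : tsupport ξ ⊆ K) (v : Euc n) :
    ∫ x in K, fderiv ℝ ξ x v * jacobian M N h (sliceParam e x) ^ 2 = 0 := by
  set D := sliceDom e with hDdef
  have hD : IsOpen D := isOpen_sliceDom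
  set ρ := sliceDensity e with hρ
  have hρc : ContDiffOn ℝ ∞ ρ D := he.contDiffOn_sliceDensity
  have hρpos : ∀ x ∈ D, 0 < ρ x := fun x hx => he.sliceDensity_pos hx
  have hρd : ∀ x ∈ D, HasFDerivAt ρ (fderiv ℝ ρ x) x := fun x hx =>
    ((hρc.contDiffAt (hD.mem_nhds hx)).differentiableAt (by simp)).hasFDerivAt
  set ζ : Euc n → ℝ := fun x => ξ x / ρ x with hζdef
  have hζ0 : ∀ x ∉ K, ζ x = 0 := fun x hx => by
    simp [hζdef, image_eq_zero_of_notMem_tsupport fun h => hx (hξK h)]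
  have hζ : ContDiff ℝ ∞ ζ := by
    rw [contDiff_iff_contDiffAt]
    intro x
    by_cases hx : x ∈ tsupport ξ
    · have hxD := hKD (hξK hx)
      exact hξ.contDiffAt.div (hρc.contDiffAt (hD.mem_nhds hxD)) (hρpos x hxD).ne'
    · refine (contDiffAt_const (c := (0 : ℝ))).congr_of_eventuallyEq ?_
      filter_upwards [(isClosed_tsupport ξ).isOpen_compl.mem_nhds hx] with y hy
      simp [hζdef, image_eq_zero_of_notMem_tsupport hy]
  have hζc : HasCompactSupport ζ := HasCompactSupport.intro hK hζ0
  set G : Euc n → ℝ := fun x => jacobian M N h (sliceParam e x) ^ 2 with hGdef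
  have hG : ContinuousOn G K := by
    have h1 := ((hh.continuousOn_abs_jacobian hn hM hN hr).pow 2).comp
      (he.contDiffOn_sliceParam.continuousOn.mono hKD) fun x hx => he.sliceParam_mem (hKD hx)
    refine h1.congr fun x _ => ?_
    simp [hGdef]
  -- The volume density pulled back by the perturbation with parameter `ε`, and its derivative.
  set a : ℝ → Euc n → ℝ := fun ε x => ρ (x + ε • ζ x • v) * (1 + ε * fderiv ℝ ζ x v) with ha
  set a' : ℝ → Euc n → ℝ := fun ε x =>
    fderiv ℝ ρ (x + ε • ζ x • v) (ζ x • v) * (1 + ε * fderiv ℝ ζ x v) +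
      ρ (x + ε • ζ x • v) * fderiv ℝ ζ x v with ha'
  set O : Set (ℝ × Euc n) :=
    {z | z.2 + z.1 • ζ z.2 • v ∈ D} ∩ ({z | 0 < 1 + z.1 * fderiv ℝ ζ z.2 v} ∩ {z | z.2 ∈ D})
    with hOdef
  have hζ' : Continuous (fderiv ℝ ζ) := hζ.continuous_fderiv (by simp)
  have hθcont : Continuous fun z : ℝ × Euc n => z.2 + z.1 • ζ z.2 • v := by
    have := hζ.continuous
    fun_prop
  have hdetcont : Continuous fun z : ℝ × Euc n => 1 + z.1 * fderiv ℝ ζ z.2 v :=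
    continuous_const.add (continuous_fst.mul
      ((hζ'.comp continuous_snd).clm_apply continuous_const))
  have hO : IsOpen O := (hD.preimage hθcont).inter
    ((isOpen_lt continuous_const hdetcont).inter (hD.preimage continuous_snd))
  have hapos : ∀ z ∈ O, 0 < a z.1 z.2 := fun z hz => mul_pos (hρpos _ hz.1) hz.2.1
  have hacont : ContinuousOn (fun z : ℝ × Euc n => a z.1 z.2) O :=
    (hρc.continuousOn.comp hθcont.continuousOn fun z hz => hz.1).mul hdetcont.continuousOn
  have hρ'c : ContinuousOn (fderiv ℝ ρ) D := hρc.continuousOn_fderiv_of_isOpen hD (by simp)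
  have ha'cont : ContinuousOn (fun z : ℝ × Euc n => a' z.1 z.2) O := by
    have h1 : Continuous fun z : ℝ × Euc n => fderiv ℝ ζ z.2 v :=
      (hζ'.comp continuous_snd).clm_apply continuous_const
    have h2 : Continuous fun z : ℝ × Euc n => ζ z.2 • v := by
      have := hζ.continuous
      fun_prop
    exact (((hρ'c.comp hθcont.continuousOn fun z hz => hz.1).clm_apply h2.continuousOn).mul
      hdetcont.continuousOn).add
      ((hρc.continuousOn.comp hθcont.continuousOn fun z hz => hz.1).mul h1.continuousOn)
  have hρ2 : ContinuousOn (fun z : ℝ × Euc n => ρ z.2 ^ 2) O :=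
    (hρc.continuousOn.comp continuous_snd.continuousOn fun z hz => hz.2.2).pow 2
  have hda : ∀ z ∈ O, HasDerivAt (fun ε => a ε z.2) (a' z.1 z.2) z.1 := by
    rintro ⟨ε, x⟩ hz
    have h1 : HasDerivAt (fun ε : ℝ => x + ε • ζ x • v) (ζ x • v) ε := by
      simpa using ((hasDerivAt_id ε).smul_const (ζ x • v)).const_add x
    have h2 : HasDerivAt (fun ε : ℝ => 1 + ε * fderiv ℝ ζ x v) (fderiv ℝ ζ x v) ε := by
      simpa using ((hasDerivAt_id ε).mul_const (fderiv ℝ ζ x v)).const_add 1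
    exact ((hρd _ hz.1).comp_hasDerivAt ε h1).mul h2
  have hKO : ∀ x ∈ K, ((0 : ℝ), x) ∈ O := fun x hx => by
    simp [hOdef, hKD hx]
  have hder := hasDerivAt_integral_of_isCompact (μ := volume) hK hG (s₀ := 0)
    (f := fun ε x => ρ x ^ 2 / a ε x) (f' := fun ε x => -(ρ x ^ 2 * a' ε x) / a ε x ^ 2) hO hKO
    (hρ2.div hacont fun z hz => (hapos z hz).ne')
    ((hρ2.mul ha'cont).neg.div (hacont.pow 2) fun z hz => (pow_pos (hapos z hz) 2).ne')
    (fun z hz => by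
      have := (hasDerivAt_const z.1 (ρ z.2 ^ 2)).div (hda z hz) (hapos z hz).ne'
      simp only [zero_mul, zero_sub] at this
      exact this)
  obtain ⟨ε₀, hε₀, hθ⟩ := exists_homeomorph_add_smul_bump hζ hζc v
  have hlocmin : IsLocalMin (fun ε => ∫ x in K, ρ x ^ 2 / a ε x * G x) 0 := by
    have hev : ∀ᶠ ε : ℝ in 𝓝 0, |ε| < ε₀ := by
      filter_upwards [Metric.ball_mem_nhds (0 : ℝ) hε₀] with ε hε
      simpa using hε
    filter_upwards [hev] with ε hε
    obtain ⟨θ, hθx, hθc, hθc', hpos⟩ := hθ ε hε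
    have key := he.integral_le_of_minimal hn hM hN hr hh hmin hθc hθc' hK hKD fun x hx => by
      rw [hθx, hζ0 x hx, zero_smul, smul_zero, add_zero]
    have e1 : ∫ x in K, ρ x ^ 2 / a 0 x * G x =
        ∫ x in K, sliceDensity e x * jacobian M N h (sliceParam e x) ^ 2 := by
      refine setIntegral_congr_fun hK.measurableSet fun x hx => ?_
      have := (hρpos x (hKD hx)).ne'
      simp only [ha, zero_smul, add_zero, zero_mul, mul_one, hGdef, ← hρ]
      rw [sq, mul_div_cancel_right₀ _ this]
    have e2 : ∫ x in K, ρ x ^ 2 / a ε x * G x =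
        ∫ x in K, sliceDensity e x ^ 2 / (sliceDensity e (θ x) * |(fderiv ℝ θ x).det|) *
        jacobian M N h (sliceParam e x) ^ 2 := by
      refine setIntegral_congr_fun hK.measurableSet fun x _ => ?_
      have hfd : fderiv ℝ θ x =
          ContinuousLinearMap.id ℝ (Euc n) + ε • (fderiv ℝ ζ x).smulRight v := by
        rw [← (hasFDerivAt_add_smul_bump hζ v ε x).fderiv]
        congr 1
        exact funext hθx
      simp only [hfd, det_id_add_smulRight, abs_of_pos (hpos x), hθx]
      rfl
    rw [e1, e2]
    exact key
  have hzero := hlocmin.hasDerivAt_eq_zero hder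
  rw [← neg_eq_zero, ← integral_neg, ← hzero]
  refine setIntegral_congr_fun hK.measurableSet fun x hx => ?_
  have hxD := hKD hx
  have hρx := (hρpos x hxD).ne'
  -- At parameter zero the derivative is that of the product `ζ ρ = ξ`.
  have hprod : fderiv ℝ ξ x v = ζ x * fderiv ℝ ρ x v + ρ x * fderiv ℝ ζ x v := by
    have h1 := ((hζ.differentiable (by simp) x).hasFDerivAt).mul (hρd x hxD)
    have h2 : HasFDerivAt ξ (ζ x • fderiv ℝ ρ x + ρ x • fderiv ℝ ζ x) x := by
      refine h1.congr_of_eventuallyEq ?_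
      filter_upwards [hD.mem_nhds hxD] with y hy
      simp [hζdef, div_mul_cancel₀ _ (hρpos y hy).ne']
    rw [h2.fderiv]
    rfl
  have ha0 : a 0 x = ρ x := by simp [ha]
  have ha'0 : a' 0 x = fderiv ℝ ξ x v := by
    rw [hprod]
    simp [ha']
  simp only [ha0, ha'0]
  field_simp
  simp only [hGdef]

/-- A minimizer of the distortion has constant Jacobian up to sign. -/
theorem exists_abs_jacobian_eq_of_minimal (hn : 1 ≤ n) (hM : IsClosedHypersurface n M)
    (hN : IsClosedHypersurface n N) (hr : 1 ≤ r) (hh : IsDiffeo r M N h)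
    (hmin : ∀ k, IsDiffeo r M N k → Phi1 M N h ≤ Phi1 M N k) :
    ∃ c, ∀ p ∈ M, |jacobian M N h p| = c := by
  -- Being locally constant suffices since `M` is connected.
  obtain ⟨p₀, hp₀⟩ := hM.isConnected.nonempty
  refine ⟨|jacobian M N h p₀|, fun p hp => ?_⟩
  refine hM.isConnected.isPreconnected.induction₂
    (fun p q => |jacobian M N h p| = |jacobian M N h q|) (fun q hq => ?_)
    (fun _ _ _ _ _ _ h1 h2 => h1.trans h2) (fun _ _ _ _ h => h.symm) hp hp₀
  obtain ⟨e, he, hqe⟩ := hM.exists_isSliceChart hq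
  have hx := he.fst_mem_sliceDom hq hqe
  have hG : ContinuousOn (fun x => jacobian M N h (sliceParam e x) ^ 2) (sliceDom e) := by
    have h1 := ((hh.continuousOn_abs_jacobian hn hM hN hr).pow 2).comp
      he.contDiffOn_sliceParam.continuousOn fun x hx => he.sliceParam_mem hx
    refine h1.congr fun x _ => ?_
    simp
  have hev := eventually_eq_of_integral_fderiv_mul_eq_zero (μ := volume) isOpen_sliceDom hG
    (fun K hKD hK ξ hξ hξK v =>
      he.integral_fderiv_mul_eq_zero hn hM hN hr hh hmin hKD hK hξ hξK v) hx
  have hev' : ∀ᶠ q' in 𝓝 q, jacobian M N h (sliceParam e (e q').1) ^ 2 =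
      jacobian M N h (sliceParam e (e q).1) ^ 2 :=
    (continuous_fst.continuousAt.comp (e.continuousAt hqe)).eventually hev
  filter_upwards [self_mem_nhdsWithin, mem_nhdsWithin_of_mem_nhds hev',
    mem_nhdsWithin_of_mem_nhds (e.open_source.mem_nhds hqe)] with q' hq' h1 hq'e
  rw [he.sliceParam_fst hq' hq'e, he.sliceParam_fst hq hqe] at h1
  exact (sq_eq_sq_iff_abs_eq_abs _ _).1 h1.symm

end Variation

/-! ### Morphs preserve the orientation by outer normals -/

section Orientation

variable {n : ℕ} {M N : Set (Amb n)} {F : ℝ → Amb n → Amb n} {r : ℕ∞} {t₀ : ℝ}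

theorem continuous_stdVolForm : Continuous fun v : Fin (n + 1) → Amb n => stdVolForm n v := by
  simp only [stdVolForm, Module.Basis.det_apply]
  refine Continuous.matrix_det (continuous_matrix fun i j => ?_)
  simp only [Module.Basis.toMatrix_apply, OrthonormalBasis.coe_toBasis_repr_apply,
    EuclideanSpace.basisFun_repr]
  fun_prop

/-- The volume form evaluated on a basis of a hyperplane only sees the normal component of the
remaining argument. -/
theorem stdVolForm_vecCons_eq_inner_mul {A : Euc n →L[ℝ] Amb n} (hA : Function.Injective A)
    {η : Amb n} (hη : ‖η‖ = 1) (hηA : ∀ v, inner ℝ η (A v) = 0) (w : Amb n) :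
    stdVolForm n (Matrix.vecCons w fun i => A (EuclideanSpace.basisFun (Fin n) ℝ i)) =
      inner ℝ η w *
        stdVolForm n (Matrix.vecCons η fun i => A (EuclideanSpace.basisFun (Fin n) ℝ i)) := by
  set b : Fin n → Amb n := fun i => A (EuclideanSpace.basisFun (Fin n) ℝ i) with hb
  have hη0 : η ≠ 0 := norm_ne_zero_iff.1 (by rw [hη]; exact one_ne_zero)
  have : Fact (Module.finrank ℝ (Amb n) = n + 1) := ⟨finrank_euclideanSpace_fin⟩
  have hrange : LinearMap.range (A : Euc n →ₗ[ℝ] Amb n) = (Submodule.span ℝ {η})ᗮ := by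
    refine Submodule.eq_of_le_of_finrank_eq ?_ ?_
    · rintro _ ⟨v, rfl⟩
      exact Submodule.mem_orthogonal_singleton_iff_inner_right.2 (hηA v)
    · rw [LinearMap.finrank_range_of_inj hA, finrank_euclideanSpace_fin,
        Submodule.finrank_orthogonal_span_singleton (n := n) hη0]
  obtain ⟨v, hv⟩ : w - inner ℝ η w • η ∈ LinearMap.range (A : Euc n →ₗ[ℝ] Amb n) := by
    rw [hrange, Submodule.mem_orthogonal_singleton_iff_inner_right, inner_sub_right,
      inner_smul_right, real_inner_self_eq_norm_sq, hη]
    ring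
  have hzero : stdVolForm n (Matrix.vecCons (A v) b) = 0 := by
    have h1 : Matrix.vecCons (A v) b =
        (A : Euc n →ₗ[ℝ] Amb n) ∘ Matrix.vecCons v (EuclideanSpace.basisFun (Fin n) ℝ) := by
      funext i
      refine Fin.cases ?_ (fun j => ?_) i <;> simp [hb]
    rw [h1]
    refine ((stdVolForm n).compLinearMap (A : Euc n →ₗ[ℝ] Amb n)).map_linearDependent
      (Matrix.vecCons v (EuclideanSpace.basisFun (Fin n) ℝ)) fun hli => ?_
    have := hli.fintype_card_le_finrank
    simp at this
  have hw : w = A v + inner ℝ η w • η := by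
    have : A v = w - inner ℝ η w • η := hv
    rw [this, sub_add_cancel]
  calc stdVolForm n (Matrix.vecCons w b)
      = stdVolForm n (Matrix.vecCons (A v + inner ℝ η w • η) b) := by rw [← hw]
    _ = _ := by
      rw [AlternatingMap.map_vecCons_add, AlternatingMap.map_vecCons_smul, hzero, zero_add,
        smul_eq_mul]

/-- A `C¹` family of immersions stays, near a given point, off the normal ray at the image of that
point, uniformly in the parameter. -/
theorem exists_eventually_add_smul_ne {E E' : Type*} [NormedAddCommGroup E] [NormedSpace ℝ E]
    [FiniteDimensional ℝ E] [NormedAddCommGroup E'] [InnerProductSpace ℝ E'] {G : ℝ → E → E'}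
    {A : ℝ → E → E →L[ℝ] E'} {S : Set ℝ} {D : Set E} (hD : IsOpen D)
    (hA : ContinuousOn (fun z : ℝ × E => A z.1 z.2) (S ×ˢ D))
    (hG : ∀ t ∈ S, ∀ x ∈ D, HasFDerivAt (G t) (A t x) x) (ht₀ : t₀ ∈ S) {x₀ : E} (hx₀ : x₀ ∈ D)
    (hinj : Function.Injective (A t₀ x₀)) {w : E'} (hw : w ≠ 0)
    (hwA : ∀ v, inner ℝ w (A t₀ x₀ v) = 0) :
    ∃ δ > 0, ∀ᶠ t in 𝓝[S] t₀, ∀ x ∈ Metric.ball x₀ δ, ∀ s : ℝ, 0 < s → G t x₀ + s • w ≠ G t x := by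
  obtain ⟨K, hK, hKA⟩ := LinearMap.exists_antilipschitzWith (A t₀ x₀ : E →ₗ[ℝ] E')
    (LinearMap.ker_eq_bot.2 hinj)
  have hKA' : ∀ v, ‖v‖ ≤ K * ‖A t₀ x₀ v‖ := fun v => by
    simpa using hKA.le_mul_dist v 0
  have hKpos : (0 : ℝ) < K := hK
  -- The derivative is bounded below by `1 / K`, and half of that is left after perturbation.
  set c : ℝ := (2 * K)⁻¹ with hc
  have hcpos : 0 < c := by positivity
  have hev : ∀ᶠ z in 𝓝[S] t₀ ×ˢ 𝓝 x₀, ‖A z.1 z.2 - A t₀ x₀‖ < c ∧ z.2 ∈ D := by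
    refine Eventually.and ?_ (tendsto_snd.eventually (hD.mem_nhds hx₀))
    have h1 := hA (t₀, x₀) ⟨ht₀, hx₀⟩
    rw [ContinuousWithinAt, nhdsWithin_prod_eq, hD.nhdsWithin_eq hx₀] at h1
    filter_upwards [h1 (Metric.ball_mem_nhds _ hcpos)] with z hz
    simpa [dist_eq_norm] using hz
  obtain ⟨pa, hpa, pb, hpb, hab⟩ := eventually_prod_iff.1 hev
  obtain ⟨δ, hδ, hδb⟩ := Metric.eventually_nhds_iff_ball.1 hpb
  refine ⟨δ, hδ, ?_⟩
  filter_upwards [hpa, self_mem_nhdsWithin] with t ht htS x hx s hs heq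
  have h2 : ‖G t x - G t x₀ - A t₀ x₀ (x - x₀)‖ ≤ c * ‖x - x₀‖ :=
    (convex_ball x₀ δ).norm_image_sub_le_of_norm_hasFDerivWithin_le'
      (fun y hy => (hG t htS y (hab ht (hδb y hy)).2).hasFDerivWithinAt)
      (fun y hy => (hab ht (hδb y hy)).1.le) (Metric.mem_ball_self hδ) hx
  rw [← heq, add_sub_cancel_left] at h2
  have hsq : ‖s • w - A t₀ x₀ (x - x₀)‖ ^ 2 = (s * ‖w‖) ^ 2 + ‖A t₀ x₀ (x - x₀)‖ ^ 2 := by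
    rw [norm_sub_sq_real, inner_smul_left, hwA, mul_zero, mul_zero, sub_zero, norm_smul,
      Real.norm_of_nonneg hs.le]
  have hwpos : 0 < s * ‖w‖ := mul_pos hs (norm_pos_iff.2 hw)
  have h3 : ‖A t₀ x₀ (x - x₀)‖ < ‖s • w - A t₀ x₀ (x - x₀)‖ :=
    lt_of_pow_lt_pow_left₀ 2 (norm_nonneg _) (by rw [hsq]; nlinarith)
  have h4 : c * ‖x - x₀‖ ≤ ‖A t₀ x₀ (x - x₀)‖ := by
    rw [hc, inv_mul_le_iff₀ (by positivity)]
    nlinarith [hKA' (x - x₀), mul_nonneg hKpos.le (norm_nonneg (A t₀ x₀ (x - x₀)))]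
  linarith

theorem IsMorph.eventually_norm_sub_lt (hM : IsCompact M) (hF : IsMorph r M N F)
    (ht₀ : t₀ ∈ Icc (0 : ℝ) 1) {ε : ℝ} (hε : 0 < ε) :
    ∀ᶠ t in 𝓝[Icc 0 1] t₀, ∀ q ∈ M, dist (F t q) (F t₀ q) < ε := by
  have huc := (isCompact_Icc.prod hM).uniformContinuousOn_of_continuous hF.contDiffOn.continuousOn
  obtain ⟨δ, hδ, h⟩ := Metric.uniformContinuousOn_iff.1 huc ε hε
  filter_upwards [self_mem_nhdsWithin, mem_nhdsWithin_of_mem_nhds (Metric.ball_mem_nhds t₀ hδ)]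
    with t ht htδ q hq
  exact h (t, q) ⟨ht, hq⟩ (t₀, q) ⟨ht₀, hq⟩ (by simpa [Prod.dist_eq, hδ] using htδ)

/-- A point in the exterior of a member of a morph has a neighborhood in the exterior of all
nearby members: a path from the point to a far away point stays off nearby members. -/
theorem IsMorph.exists_eventually_ball_subset_exterior (hn : 1 ≤ n) (hM : IsCompact M)
    (hF : IsMorph r M N F) (ht₀ : t₀ ∈ Icc (0 : ℝ) 1) {q₀ : Amb n}
    (hq₀ : q₀ ∈ exterior (F t₀ '' M)) :
    ∃ δ > 0, ∀ᶠ t in 𝓝[Icc 0 1] t₀, Metric.ball q₀ δ ⊆ exterior (F t '' M) := by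
  have hM₀ := hF.isClosedHypersurface t₀ ht₀
  obtain ⟨R, hR, hMR⟩ := hM₀.exists_norm_le
  obtain ⟨q₁, hq₁, hRq₁⟩ : ∃ q₁ ∈ connectedComponentIn (F t₀ '' M)ᶜ q₀, R + 1 < ‖q₁‖ := by
    by_contra! hcon
    exact hq₀ (isBounded_iff_forall_norm_le.2 ⟨R + 1, hcon⟩)
  have hq₀M := exterior_subset_compl hq₀
  have hpath : IsPathConnected (connectedComponentIn (F t₀ '' M)ᶜ q₀) :=
    hM₀.isCompact.isClosed.isOpen_compl.connectedComponentIn.isConnected_iff_isPathConnected.1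
      (isConnected_connectedComponentIn_iff.2 hq₀M)
  obtain ⟨γ, hγ⟩ := hpath.joinedIn q₀ (mem_connectedComponentIn hq₀M) q₁ hq₁
  have hdisj : Disjoint (range γ) (F t₀ '' M) := by
    rw [Set.disjoint_left]
    rintro _ ⟨s, rfl⟩ h
    exact connectedComponentIn_subset _ _ (hγ s) h
  obtain ⟨δ, hδ, hthick⟩ := hdisj.exists_thickenings (isCompact_range γ.continuous)
    hM₀.isCompact.isClosed
  refine ⟨δ, hδ, ?_⟩
  filter_upwards [hF.eventually_norm_sub_lt hM ht₀ hδ, hF.eventually_norm_sub_lt hM ht₀ one_pos]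
    with t ht ht1 y hy
  have hq₀γ : q₀ ∈ range γ := ⟨0, γ.source⟩
  refine mem_exterior_of_isPreconnected (C := range γ ∪ Metric.ball q₀ δ) (x := q₁)
    ((isPreconnected_range γ.continuous).union q₀ hq₀γ (Metric.mem_ball_self hδ)
      (convex_ball q₀ δ).isPreconnected) ?_ (Or.inl ⟨1, γ.target⟩) (Or.inr hy)
    (mem_exterior_of_norm_gt hn (R := R + 1) (by positivity) ?_ hRq₁)
  · rintro z hz ⟨q, hq, rfl⟩
    refine Set.disjoint_left.1 hthick ?_
      (Metric.mem_thickening_iff.2 ⟨F t₀ q, mem_image_of_mem _ hq, ht q hq⟩)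
    rcases hz with hz | hz
    · exact Metric.self_subset_thickening hδ _ hz
    · exact Metric.mem_thickening_iff.2 ⟨q₀, hq₀γ, hz⟩
  · rintro _ ⟨q, hq, rfl⟩
    have h1 := hMR _ (mem_image_of_mem _ hq)
    have h2 := ht1 q hq
    rw [dist_eq_norm] at h2
    linarith [norm_sub_norm_le (F t q) (F t₀ q)]

/-- The sign of the Jacobian of a morph at a fixed point is locally constant in time. -/
theorem IsMorph.eventually_jacobian_mul_pos (hn : 1 ≤ n) (hM : IsClosedHypersurface n M)
    (hr : 1 ≤ r) (hF : IsMorph r M N F) (ht₀ : t₀ ∈ Icc (0 : ℝ) 1) {m : Amb n} (hm : m ∈ M) :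
    ∀ᶠ t in 𝓝[Icc 0 1] t₀,
      0 < jacobian M (F t₀ '' M) (F t₀) m * jacobian M (F t '' M) (F t) m := by
  obtain ⟨e, he, hme⟩ := hM.exists_isSliceChart hm
  set D := sliceDom e with hDdef
  have hD : IsOpen D := isOpen_sliceDom
  set x₀ := (e m).1 with hx₀def
  have hx₀ : x₀ ∈ D := he.fst_mem_sliceDom hm hme
  have hφx₀ : sliceParam e x₀ = m := he.sliceParam_fst hm hme
  set I : Set ℝ := Icc 0 1 with hI
  have hsub : MapsTo (sliceParam e) D M := fun x hx => he.sliceParam_mem hx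
  set G : ℝ × Euc n → Amb n := fun z => F z.1 (sliceParam e z.2) with hGdef
  have hGc : ContDiffOn ℝ 1 G (I ×ˢ D) :=
    hF.contDiffOn.comp (f := fun z : ℝ × Euc n => (z.1, sliceParam e z.2))
      (contDiffOn_fst.prodMk ((he.contDiffOn_sliceParam.of_le (by simp)).comp contDiffOn_snd
        fun z hz => hz.2)) fun z hz => ⟨hz.1, hsub hz.2⟩
  have huniq : UniqueDiffOn ℝ (I ×ˢ D) := (uniqueDiffOn_Icc one_pos).prod hD.uniqueDiffOn
  -- The partial derivative in the space variable.
  set A : ℝ → Euc n → Euc n →L[ℝ] Amb n := fun t x =>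
    fderivWithin ℝ G (I ×ˢ D) (t, x) ∘L ContinuousLinearMap.inr ℝ ℝ (Euc n) with hAdef
  have hAc : ContinuousOn (fun z : ℝ × Euc n => A z.1 z.2) (I ×ˢ D) :=
    (hGc.continuousOn_fderivWithin huniq le_rfl).clm_comp continuousOn_const
  have hGd : ∀ t ∈ I, ∀ x ∈ D, HasFDerivAt (fun x => F t (sliceParam e x)) (A t x) x := by
    intro t ht x hx
    have h1 := (hGc.differentiableOn one_ne_zero (t, x) ⟨ht, hx⟩).hasFDerivWithinAt
    have h2 : HasFDerivWithinAt (fun y : Euc n => (t, y)) (ContinuousLinearMap.inr ℝ ℝ (Euc n)) D x :=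
      (hasFDerivAt_prodMk_right t x).hasFDerivWithinAt
    exact (h1.comp x h2 fun y hy => ⟨ht, hy⟩).hasFDerivAt (hD.mem_nhds hx)
  have hdiff : ∀ t ∈ I, DifferentiableWithinAt ℝ (F t) M (sliceParam e x₀) := fun t ht =>
    (hF.isDiffeo t ht).differentiableOn hr _ (hsub hx₀)
  have hAeq : ∀ t ∈ I, A t x₀ =
      fderivWithin ℝ (F t) M (sliceParam e x₀) ∘L fderiv ℝ (sliceParam e) x₀ := fun t ht =>
    (hGd t ht x₀ hx₀).unique (he.hasFDerivAt_comp_sliceParam hx₀ (hdiff t ht))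
  have hAinj : ∀ t ∈ I, Function.Injective (A t x₀) := fun t ht => by
    have := (hF.isDiffeo t ht).injective_fderiv_comp_sliceParam hr he hx₀
    rwa [(he.hasFDerivAt_comp_sliceParam hx₀ (hdiff t ht)).fderiv, ← hAeq t ht] at this
  set η : ℝ → Amb n := fun t => outerNormal (F t '' M) (F t m) with hηdef
  have hη : ∀ t ∈ I, IsOuterUnitNormal (F t '' M) (F t m) (η t) := fun t ht =>
    (hF.isClosedHypersurface t ht).isOuterUnitNormal_outerNormal hn (mem_image_of_mem _ hm)
  have hηA : ∀ t ∈ I, ∀ v, inner ℝ (η t) (A t x₀ v) = 0 := fun t ht v => by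
    refine (hη t ht).2.1 _ ?_
    rw [hAeq t ht, ← hφx₀]
    exact map_mem_tangentAt (hdiff t ht).hasFDerivWithinAt (mapsTo_image _ _)
      (he.fderiv_sliceParam_mem_tangentAt hx₀ v)
  set w := η t₀ with hw
  have hw1 : ‖w‖ = 1 := (hη t₀ ht₀).1
  have hw0 : w ≠ 0 := norm_ne_zero_iff.1 (by rw [hw1]; exact one_ne_zero)
  -- Nearby members of the morph stay off a fixed initial piece of the normal ray with direction `w`.
  obtain ⟨δ₁, hδ₁, hloc⟩ := exists_eventually_add_smul_ne hD hAc hGd ht₀ hx₀ (hAinj t₀ ht₀) hw0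
    (hηA t₀ ht₀)
  set V : Set (Amb n) := e.source ∩ e ⁻¹' {z | z.1 ∈ Metric.ball x₀ δ₁} with hV
  have hVo : IsOpen V := e.isOpen_inter_preimage (Metric.isOpen_ball.preimage continuous_fst)
  have hmV : m ∈ V := ⟨hme, by simp [hx₀def, hδ₁]⟩
  have hcpt : IsCompact (M \ V) := hM.isCompact.diff hVo
  have hFc₀ : ContinuousOn (F t₀) M := (hF.isDiffeo t₀ ht₀).contDiffOn.continuousOn
  -- Points of `M` away from `m` are excluded by the injectivity of `F t₀` and uniform continuity.
  obtain ⟨d, hd, hdist⟩ : ∃ d > 0, ∀ q ∈ M \ V, d ≤ dist (F t₀ q) (F t₀ m) := by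
    rcases (M \ V).eq_empty_or_nonempty with h | h
    · exact ⟨1, one_pos, by simp [h]⟩
    · obtain ⟨q, hq, hmin⟩ := hcpt.exists_isMinOn h
        (f := fun q => dist (F t₀ q) (F t₀ m))
        (continuous_dist.comp_continuousOn
          ((hFc₀.mono sdiff_subset).prodMk continuousOn_const))
      refine ⟨_, dist_pos.2 fun heq => ?_, fun q' hq' => hmin hq'⟩
      rw [(hF.isDiffeo t₀ ht₀).bijOn.injOn hq.1 hm heq] at hq
      exact hq.2 hmV
  have hray : ∀ᶠ t in 𝓝[I] t₀, ∀ s ∈ Ioc 0 (d / 3), F t m + s • w ∉ F t '' M := by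
    filter_upwards [hloc, hF.eventually_norm_sub_lt hM.isCompact ht₀ (ε := d / 3) (by positivity)]
      with t ht1 ht2 s hs
    rintro ⟨q, hq, heq⟩
    by_cases hqV : q ∈ V
    · refine ht1 (e q).1 hqV.2 s hs.1 ?_
      simp only [hφx₀, he.sliceParam_fst hq hqV.1]
      exact heq.symm
    · have h1 := hdist q ⟨hq, hqV⟩
      have h2 := ht2 q hq
      have h3 := ht2 m hm
      have h4 : dist (F t q) (F t m) ≤ d / 3 := by
        rw [heq, dist_eq_norm, add_sub_cancel_left, norm_smul, hw1, Real.norm_of_nonneg hs.1.le,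
          mul_one]
        exact hs.2
      have h5 := dist_triangle4 (F t₀ q) (F t q) (F t m) (F t₀ m)
      rw [dist_comm (F t₀ q) (F t q)] at h5
      linarith
  obtain ⟨s₀, hs₀, hs₀ext⟩ : ∃ s₀ ∈ Ioc 0 (d / 3), F t₀ m + s₀ • w ∈ exterior (F t₀ '' M) := by
    have h1 := (hη t₀ ht₀).2.2
    have h2 : ∀ᶠ s : ℝ in 𝓝[>] 0, s ∈ Ioc 0 (d / 3) := Ioc_mem_nhdsGT (by positivity)
    exact (h2.and h1).exists
  obtain ⟨δ₂, hδ₂, hball⟩ := hF.exists_eventually_ball_subset_exterior hn hM.isCompact ht₀ hs₀ext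
  have hext : ∀ᶠ t in 𝓝[I] t₀, ∀ᶠ s : ℝ in 𝓝[>] 0, F t m + s • w ∈ exterior (F t '' M) := by
    filter_upwards [hray, hball, hF.eventually_norm_sub_lt hM.isCompact ht₀ hδ₂] with t h1 h2 h3
    have h4 : F t m + s₀ • w ∈ exterior (F t '' M) := h2 (by
      rw [Metric.mem_ball, dist_add_right]
      exact h3 m hm)
    filter_upwards [Ioc_mem_nhdsGT hs₀.1] with s hs
    refine mem_exterior_of_isPreconnected (C := (fun s : ℝ => F t m + s • w) '' Ioc 0 s₀)
      (isPreconnected_Ioc.image _ (by fun_prop)) ?_ (mem_image_of_mem _ ⟨hs₀.1, le_rfl⟩)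
      (mem_image_of_mem _ hs) h4
    rintro _ ⟨s', hs', rfl⟩
    exact h1 s' ⟨hs'.1, hs'.2.trans hs₀.2⟩
  -- The volume form evaluated on `w` and the moving tangent frame is continuous in time.
  set κ : ℝ := stdVolForm n (Matrix.vecCons (outerNormal M m)
    fun i => fderiv ℝ (sliceParam e) x₀ (EuclideanSpace.basisFun (Fin n) ℝ i)) with hκ
  set Θ : ℝ → ℝ := fun t => stdVolForm n (Matrix.vecCons w
    fun i => A t x₀ (EuclideanSpace.basisFun (Fin n) ℝ i)) with hΘ
  have hΘc : ContinuousOn Θ I := by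
    have h1 : ContinuousOn (fun t => A t x₀) I :=
      hAc.comp (f := fun t : ℝ => (t, x₀)) (by fun_prop) fun t ht => ⟨ht, hx₀⟩
    refine continuous_stdVolForm.comp_continuousOn (continuousOn_pi.2 fun i => ?_)
    refine Fin.cases ?_ (fun j => ?_) i
    · exact continuousOn_const
    · exact h1.clm_apply continuousOn_const
  have hΘJ : ∀ t ∈ I, Θ t = inner ℝ (η t) w * (jacobian M (F t '' M) (F t) m * κ) := by
    intro t ht
    rw [hΘ]
    simp only
    rw [stdVolForm_vecCons_eq_inner_mul (hAinj t ht) (hη t ht).1 (hηA t ht)]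
    have := he.jacobian_mul (N := F t '' M) (h := F t) hn hM hx₀
    rw [hφx₀] at this
    rw [hκ, this, hηdef, hAeq t ht, hφx₀]
    rfl
  have hJ : ∀ t ∈ I, jacobian M (F t '' M) (F t) m ≠ 0 := fun t ht =>
    (hF.isDiffeo t ht).jacobian_ne_zero hn hM (hF.isClosedHypersurface t ht) hr hm
  have hκ0 : κ ≠ 0 := he.stdVolForm_ne_zero hx₀ (by
    rw [hφx₀]
    exact hM.isOuterUnitNormal_outerNormal hn hm)
  have hΘ₀ : Θ t₀ = jacobian M (F t₀ '' M) (F t₀) m * κ := by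
    rw [hΘJ t₀ ht₀, ← hw, real_inner_self_eq_norm_sq, hw1]
    ring
  have hΘ₀ne : Θ t₀ ≠ 0 := by
    rw [hΘ₀]
    exact mul_ne_zero (hJ t₀ ht₀) hκ0
  have hsign : ∀ᶠ t in 𝓝[I] t₀, 0 < Θ t₀ * Θ t :=
    (continuousWithinAt_const.mul (hΘc t₀ ht₀)).eventually
      (lt_mem_nhds (mul_self_pos.2 hΘ₀ne))
  filter_upwards [hsign, hext, self_mem_nhdsWithin] with t h1 h2 ht
  have h3 : inner ℝ (η t) w ≠ 0 := fun h => by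
    rw [hΘJ t ht, h, zero_mul, mul_zero] at h1
    exact h1.false
  have h4 : 0 < inner ℝ (η t) w := (hF.isClosedHypersurface t ht).inner_outerNormal_pos hn
    (mem_image_of_mem _ hm) h2 h3
  rw [hΘ₀, hΘJ t ht] at h1
  have h5 : 0 < (inner ℝ (η t) w * κ ^ 2) *
      (jacobian M (F t₀ '' M) (F t₀) m * jacobian M (F t '' M) (F t) m) := by
    linarith
  exact pos_of_mul_pos_right h5 (by positivity)

/-- A morph starting at the identity has positive Jacobians. -/
theorem IsMorph.jacobian_pos (hn : 1 ≤ n) (hM : IsClosedHypersurface n M) (hr : 1 ≤ r)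
    (hF : IsMorph r M N F) (hF0 : ∀ m ∈ M, F 0 m = m) {t : ℝ} (ht : t ∈ Icc (0 : ℝ) 1) {m : Amb n}
    (hm : m ∈ M) : 0 < jacobian M (F t '' M) (F t) m := by
  have h0 : jacobian M (F 0 '' M) (F 0) m = 1 := by
    rw [hF.isDiffeo_zero.bijOn.image_eq, jacobian_congr (h' := id) hF0 hm, jacobian_id hn hM hm]
  have h := isPreconnected_Icc.induction₂ (s := Icc (0 : ℝ) 1)
    (fun s t => 0 < jacobian M (F s '' M) (F s) m * jacobian M (F t '' M) (F t) m)
    (fun s hs => hF.eventually_jacobian_mul_pos hn hM hr hs hm)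
    (fun a b c _ _ _ h1 h2 => by
      have h3 : 0 < jacobian M (F b '' M) (F b) m ^ 2 *
          (jacobian M (F a '' M) (F a) m * jacobian M (F c '' M) (F c) m) := by
        nlinarith [mul_pos h1 h2]
      exact pos_of_mul_pos_right h3 (sq_nonneg _))
    (fun _ _ _ _ h => by rwa [mul_comm]) (left_mem_Icc.2 zero_le_one) ht
  rwa [h0, one_mul] at h

end Orientation

/-! ### Pairwise minimal morphs -/

theorem mainTheorem6 (n : ℕ) (hn : 1 ≤ n) (r : ℕ∞) (hr : 1 ≤ r)
    (M N : Set (Amb n)) (hM : IsClosedHypersurface n M) (hN : IsClosedHypersurface n N)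
    (F : ℝ → Amb n → Amb n) (hF : IsMorph r M N F) (hF0 : ∀ m ∈ M, F 0 m = m) :
    IsPairwiseMinimal r M F ↔
      ∀ t ∈ Set.Icc (0 : ℝ) 1, ∀ m ∈ M,
        jacobian M (F t '' M) (F t) m / Vol (F t '' M) = 1 / Vol M := by
  constructor
  · intro hmin t ht m hm
    have h0 : (0 : ℝ) ∈ Icc (0 : ℝ) 1 := left_mem_Icc.2 zero_le_one
    have himage : F 0 '' M = M := hF.isDiffeo_zero.bijOn.image_eq
    have hMt := hF.isClosedHypersurface t ht
    obtain ⟨hT, hTmin⟩ := hmin 0 h0 t ht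
    rw [himage] at hT hTmin
    have hT0 : EqOn (transition M F 0 t) (F t) M := fun p hp => by
      have h1 := hF.isDiffeo_zero.invFunOn_apply hp
      rw [hF0 p hp] at h1
      rw [transition, Function.comp_apply, h1]
    obtain ⟨c, hc⟩ := exists_abs_jacobian_eq_of_minimal hn hM hMt hr hT hTmin
    have hcV := (hT.integral_sq_jacobian_of_const hn hM hMt hr hc).1
    have hJ := hc m hm
    rw [jacobian_congr hT0 hm, abs_of_pos (hF.jacobian_pos hn hM hr hF0 ht hm), hcV] at hJ
    have hV := hM.Vol_pos
    have hVt := hMt.Vol_pos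
    rw [hJ]
    field_simp
  · intro hJ s hs t ht
    refine ⟨hF.isDiffeo_transition hs ht, fun k hk => ?_⟩
    have hMs := hF.isClosedHypersurface s hs
    have hMt := hF.isClosedHypersurface t ht
    refine Phi1_le_of_abs_jacobian_const hn hMs hMt hr (hF.isDiffeo_transition hs ht) hk
      (c := Vol (F t '' M) / Vol (F s '' M)) ?_
    rintro _ ⟨m, hm, rfl⟩
    have h1 := hF.jacobian_transition hn hM hr hs ht hm
    have h2 := hJ s hs m hm
    have h3 := hJ t ht m hm
    have hV := hM.Vol_pos
    have hVs := hMs.Vol_pos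
    have hVt := hMt.Vol_pos
    rw [div_eq_div_iff hVs.ne' hV.ne', one_mul] at h2
    rw [div_eq_div_iff hVt.ne' hV.ne', one_mul, h1, mul_assoc, h2] at h3
    rw [eq_div_iff_mul_eq hVs.ne' |>.2 h3, abs_of_pos (by positivity)]
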